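/- **Setting.** Let $\mathcal S\subset\mathbb R^{n_s}$ and $\mathcal A\subset\mathbb R^{n_a}$ be the state and action spaces of a Markov decision process with transition kernel $P(\mathrm ds'|s,a)$ and measurable costs $C_0,\dots,C_m:\mathcal S\times\mathcal A\to\mathbb R$ ($C_0$ is minus the reward); let $c_1,\dots,c_m\in\mathbb R$ and put $C_0'=C_0$, $C_i'=C_i-c_i$ for $i\ge1$. Let $\Theta\subset\mathbb R^{n_\theta}$. For $\theta$ in an open set $U\supseteq\Theta$, the policy $\pi_\theta(\cdot|s)$ has a positive density (or probability mass function) $\pi_\theta(a|s)$ with respect to a fixed $\sigma$-finite measure on $\mathcal A$, measurable in $(s,a)$ and differentiable in $\theta$. Let $$J_i(\theta)=\lim_{L\to\infty}\frac1L\,\mathbb E_{\pi_\theta}\Big[\sum_{l=0}^{L-1}C_i'(s_l,a_l)\Big],\qquad s_0\sim\text{a given law},\ a_l\sim\pi_\theta(\cdot|s_l),\ s_{l+1}\sim P(\cdot|s_l,a_l),$$ and write $\|\mu-\nu\|_{TV}=\int|\mu(\mathrm ds)-\nu(\mathrm ds)|$. **Assumption 1.** (1) $\Theta$ is compact and convex.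 (2) $\mathcal S,\mathcal A$ are compact. (3) The $C_i$ are bounded; each $J_i$ is twice differentiable at the points of $\Theta$, with first and second derivatives bounded on $\Theta$; the policy is Lipschitz in the parameter: $\|\pi_\theta(\cdot|s)-\pi_{\theta'}(\cdot|s)\|_{TV}\le L\|\theta-\theta'\|$ for $\theta,\theta'\in\Theta$, $s\in\mathcal S$; the score $\nabla_\theta\log\pi_\theta(a|s)$ is bounded on $U\times\mathcal S\times\mathcal A$, and Lipschitz in $\theta\in\Theta$ uniformly in $(s,a)$. (4) There are $m_c>0$ and $\rho\in(0,1)$ such that every $\pi_\theta$, $\theta\in\Theta$, has a stationary state distribution $\mathbf P_{\pi_\theta}$ with $\sup_{s}\|\mathbf P(S_t\in\cdot\,|S_0=s)-\mathbf P_{\pi_\theta}\|_{TV}\le m_c\rho^t$ for all $t\ge0$. **Assumption 2.** $(\alpha_t)_{t\ge 0}$, $(\beta_t)_{t\ge 0}$ are positive and non-increasing, $\beta_t\le1$, and 1. $\alpha_t\to0$, $1/\alpha_t=O(t^\kappa)$ for some $\kappa\in(0,1)$, $\sum_{t\ge1}\alpha_tt^{-1}<\infty$, $\sum_{t\ge1}\alpha_t\log^2t\sum_{t-\log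 t\le t'\le t}\beta_{t'}<\infty$, $\sum_t\alpha_t^2<\infty$; 2. $\beta_t\to0$, $\sum_t\beta_t=\infty$, $\sum_t\beta_t^2<\infty$; 3. $\beta_t/\alpha_t\to0$. **Algorithm.** Let the integers $T_t\ge1$ satisfy $T_t\to\infty$ and $T_t=O(\log t)$, let $\varsigma_0,\dots,\varsigma_m>0$, let the initial values $\hat J_i^{-1}\in\mathbb R$, $\hat g_i^{-1}\in\mathbb R^{n_\theta}$ be arbitrary, and let $\theta^0\in\Theta$. A finite number $N_0$ of initial state-action experiences (of arbitrary law), followed by an initial state $s_0$, is available, with $2T_t\le N_0+t+1$ for all $t\ge0$; they are indexed by negative times. At iteration $t=0,1,\dots$, given the past, $a_t\sim\pi_{\theta^t}(\cdot|s_t)$ and then $s_{t+1}\sim P(\cdot|s_t,a_t)$. With $T=T_t$ and $x_n=(s_n,a_n)$, for $i=0,\dots,m$, $$\tilde J_i^t=\frac1{2T}\sum_{l=1}^{2T}C_i'(x_{t-2T+l}),\qquad \hat J_i^t=(1-\alpha_t)\hat J_i^{t-1}+\alpha_t\tilde J_i^t,$$ $$\tilde g_i^t=\frac1T\sum_{l=1}^{T}\Big(\sum_{l'=0}^{T-1}\big(C_i'(x_{t-2T+l+l'})-\hat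 J_i^t\big)\Big)\nabla_\theta\log\pi_{\theta}(a_{t-2T+l}|s_{t-2T+l})\big|_{\theta=\theta^t},\qquad \hat g_i^t=(1-\alpha_t)\hat g_i^{t-1}+\alpha_t\tilde g_i^t .$$ Put $\bar J_i^t(\theta)=\hat J_i^t+(\hat g_i^t)^{\mathsf T}(\theta-\theta^t)+\varsigma_i\|\theta-\theta^t\|_2^2$. If $\{\theta\in\Theta:\bar J_i^t(\theta)\le0,\ i=1,\dots,m\}$ is non-empty, $\bar\theta^t$ minimizes $\bar J_0^t$ over this set; otherwise $\bar\theta^t$ is the $\theta$-part of a minimizer of $x$ over all $(\theta,x)\in\Theta\times\mathbb R$ with $\bar J_i^t(\theta)\le x$, $i=1,\dots,m$. Finally $\theta^{t+1}=(1-\beta_t)\theta^t+\beta_t\bar\theta^t$. **Lemma (asymptotic consistency).** Under Assumptions 1 and 2, almost surely, for every $i\in\{0,\dots,m\}$, $$\lim_{t\to\infty}\big|\hat J_i^t-J_i(\theta^t)\big|=0\qquad\text{and}\qquad\lim_{t\to\infty}\big\|\hat g_i^t-\nabla J_i(\theta^t)\big\|_2=0 .$$ -/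

import Mathlib

open MeasureTheory ProbabilityTheory Filter Topology Asymptotics
open scoped Gradient

noncomputable section

/-- `ℝⁿ` with the Euclidean norm. -/
abbrev RVec (n : ℕ) := EuclideanSpace ℝ (Fin n)

/-- Total-variation distance `∫ |μ(dx) - ν(dx)|` (total mass of the variation of `μ - ν`). -/
def tvDistance {X : Type*} [MeasurableSpace X] (μ ν : Measure X)
    [IsFiniteMeasure μ] [IsFiniteMeasure ν] : ℝ :=
  (μ.toSignedMeasure - ν.toSignedMeasure).totalVariation.real Set.univ

/-- A constrained Markov decision process with state space `S ⊆ ℝ^ns`, action space `A ⊆ ℝ^na`,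
costs `C_0, …, C_m` (with `C_0` minus the reward), limits `c_1, …, c_m`, and a parametrized policy
`π_θ` which, for `θ` in an open set `dom` containing the parameter space `Θ`, has the positive
density (probability mass function, when `refMeasure` is a counting measure) `π_θ(a|s)`. -/
structure CMDP (nθ ns na m : ℕ) where
  /-- state space -/
  S : Set (RVec ns)
  /-- action space -/
  A : Set (RVec na)
  /-- the transition probabilities `P(ds' | s, a)` -/
  transition : Kernel (S × A) S
  markov_transition : IsMarkovKernel transition
  /-- law of the initial state `s_0` in the definition of the long-run costs -/
  init : Measure S
  prob_init : IsProbabilityMeasure init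
  /-- the cost functions `C_0, …, C_m` -/
  cost : Fin (m + 1) → S × A → ℝ
  measurable_cost : ∀ i, Measurable (cost i)
  /-- the limits `c_1, …, c_m` -/
  limit : Fin m → ℝ
  /-- parameter space -/
  Θ : Set (RVec nθ)
  /-- open set of parameters on which the policy is differentiable -/
  dom : Set (RVec nθ)
  isOpen_dom : IsOpen dom
  subset_dom : Θ ⊆ dom
  /-- the policies `π_θ(da | s)`; only the values for `θ ∈ dom` matter -/
  policy : RVec nθ → Kernel S A
  markov_policy : ∀ θ, IsMarkovKernel (policy θ)
  /-- reference measure on the actions (e.g. Lebesgue or counting measure) -/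
  refMeasure : Measure A
  sigmaFinite_refMeasure : SigmaFinite refMeasure
  /-- the density `π_θ(a | s)`, written `dens θ s a` -/
  dens : RVec nθ → S → A → ℝ
  measurable_dens : ∀ θ ∈ dom, Measurable (Function.uncurry (dens θ))
  dens_pos : ∀ θ ∈ dom, ∀ s a, 0 < dens θ s a
  policy_eq : ∀ θ ∈ dom, ∀ s,
    policy θ s = refMeasure.withDensity (fun a => ENNReal.ofReal (dens θ s a))
  differentiable_dens : ∀ θ ∈ dom, ∀ s a, DifferentiableAt ℝ (fun θ' => dens θ' s a) θ

attribute [instance] CMDP.markov_transition CMDP.prob_init CMDP.markov_policy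
  CMDP.sigmaFinite_refMeasure

namespace CMDP

variable {nθ ns na m : ℕ} (M : CMDP nθ ns na m)

/-- `C'_0 = C_0` and `C'_i = C_i - c_i` for `i = 1, …, m`. -/
def cost' (i : Fin (m + 1)) (x : M.S × M.A) : ℝ :=
  M.cost i x - (Fin.cons 0 M.limit : Fin (m + 1) → ℝ) i

/-- The score `∇_θ log π_θ(a | s)`. -/
def score (θ : RVec nθ) (x : M.S × M.A) : RVec nθ :=
  ∇ (fun θ' => Real.log (M.dens θ' x.1 x.2)) θ

/-- One step of the state process under `π_θ`: `K_θ(s, ds') = ∫ P(ds' | s, a) π_θ(da | s)`,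
applied to the state law `μ`. -/
def step (θ : RVec nθ) (μ : Measure M.S) : Measure M.S :=
  M.transition ∘ₘ (μ ⊗ₘ M.policy θ)

/-- Law of the state `S_t` under `π_θ` when `S_0 ∼ μ`. -/
def stateLaw (θ : RVec nθ) (μ : Measure M.S) : ℕ → Measure M.S
  | 0 => μ
  | t + 1 => M.step θ (stateLaw θ μ t)

instance (θ : RVec nθ) (μ : Measure M.S) [IsProbabilityMeasure μ] :
    IsProbabilityMeasure (M.step θ μ) := by
  unfold step; infer_instance

instance (θ : RVec nθ) (μ : Measure M.S) [h : IsProbabilityMeasure μ] (t : ℕ) :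
    IsProbabilityMeasure (M.stateLaw θ μ t) := by
  induction t with
  | zero => exact h
  | succ t ih => unfold stateLaw; infer_instance

/-- `(1/L) E[∑_{l<L} C'_i(s_l, a_l)]` for a trajectory generated by `π_θ` from `s_0 ∼ init`. -/
def avgCost (i : Fin (m + 1)) (θ : RVec nθ) (L : ℕ) : ℝ :=
  (1 / (L : ℝ)) * ∑ l ∈ Finset.range L,
    ∫ x, M.cost' i x ∂(M.stateLaw θ M.init l ⊗ₘ M.policy θ)

/-- The long-run average cost `J_i(θ)` (limit `c_i` subtracted when `i ≥ 1`). -/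
def J (i : Fin (m + 1)) (θ : RVec nθ) : ℝ := limUnder atTop (M.avgCost i θ)

/-- The structural assumptions on the problem. -/
structure ProblemAssumptions : Prop where
  compact_Θ : IsCompact M.Θ
  convex_Θ : Convex ℝ M.Θ
  compact_S : IsCompact M.S
  compact_A : IsCompact M.A
  bounded_cost : ∃ B : ℝ, ∀ i x, |M.cost i x| ≤ B
  /-- `J_i` is twice differentiable on `Θ`, with bounded first and second derivatives -/
  deriv_J : ∃ B : ℝ, ∀ i, ∀ θ ∈ M.Θ,
    DifferentiableAt ℝ (M.J i) θ ∧ ‖∇ (M.J i) θ‖ ≤ B ∧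
    DifferentiableAt ℝ (∇ (M.J i)) θ ∧ ‖fderiv ℝ (∇ (M.J i)) θ‖ ≤ B
  /-- the policy is Lipschitz in the parameter -/
  lipschitz_policy : ∃ L : ℝ, ∀ θ ∈ M.Θ, ∀ θ' ∈ M.Θ, ∀ s,
    tvDistance (M.policy θ s) (M.policy θ' s) ≤ L * ‖θ - θ'‖
  /-- regularity of the score: bounded … -/
  bounded_score : ∃ B : ℝ, ∀ θ ∈ M.dom, ∀ x, ‖M.score θ x‖ ≤ B
  /-- … and Lipschitz in the parameter -/
  lipschitz_score : ∃ L : ℝ, ∀ θ ∈ M.Θ, ∀ θ' ∈ M.Θ, ∀ x,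
    ‖M.score θ x - M.score θ' x‖ ≤ L * ‖θ - θ'‖
  /-- uniform geometric ergodicity -/
  ergodic : ∃ mc > (0 : ℝ), ∃ ρ ∈ Set.Ioo (0 : ℝ) 1, ∀ θ ∈ M.Θ,
    ∃ (P : Measure M.S) (_ : IsProbabilityMeasure P), M.step θ P = P ∧
      ∀ (s : M.S) (t : ℕ), tvDistance (M.stateLaw θ (Measure.dirac s) t) P ≤ mc * ρ ^ t

/-! The estimates, as functions of a sequence of experiences `x n = (s_n, a_n)`, `n = 0, 1, …`.
Before iteration `0`, `N₀` experiences have been accumulated; thus the experience of iteration `t`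
has index `N₀ + t`, and the latest `2 T_t` experiences at iteration `t` are those with index
`N₀ + t + 1 - 2 T_t + l`, `l = 0, …, 2 T_t - 1`. -/

section Estimates

variable (T : ℕ → ℕ) (N₀ : ℕ) (α : ℕ → ℝ) (x : ℕ → M.S × M.A)

/-- The `l`-th of the stored experiences at iteration `t`. -/
def stored (t l : ℕ) : M.S × M.A := x (N₀ + t + 1 - 2 * T t + l)

/-- The new estimate `J̃_i^t` of the function value. -/
def Jtilde (i : Fin (m + 1)) (t : ℕ) : ℝ :=
  (1 / (2 * T t : ℝ)) * ∑ l ∈ Finset.range (2 * T t), M.cost' i (M.stored T N₀ x t l)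

/-- The recursive estimate `Ĵ_i^t`, with `Ĵ_i^{-1} = J₀ i`. -/
def Jhat (J₀ : Fin (m + 1) → ℝ) (i : Fin (m + 1)) : ℕ → ℝ
  | 0 => (1 - α 0) * J₀ i + α 0 * M.Jtilde T N₀ x i 0
  | t + 1 => (1 - α (t + 1)) * Jhat J₀ i t + α (t + 1) * M.Jtilde T N₀ x i (t + 1)

/-- The estimate of the Q-value at the `l`-th stored state-action pair. -/
def Qhat (J₀ : Fin (m + 1) → ℝ) (i : Fin (m + 1)) (t l : ℕ) : ℝ :=
  ∑ l' ∈ Finset.range (T t),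
    (M.cost' i (M.stored T N₀ x t (l + l')) - M.Jhat T N₀ α x J₀ i t)

/-- The new estimate `g̃_i^t` of the gradient, given the policy parameters `θ`. -/
def gtilde (J₀ : Fin (m + 1) → ℝ) (θ : ℕ → RVec nθ) (i : Fin (m + 1)) (t : ℕ) : RVec nθ :=
  (1 / (T t : ℝ)) • ∑ l ∈ Finset.range (T t),
    M.Qhat T N₀ α x J₀ i t l • M.score (θ t) (M.stored T N₀ x t l)

/-- The recursive estimate `ĝ_i^t`, with `ĝ_i^{-1} = g₀ i`. -/
def ghat (J₀ : Fin (m + 1) → ℝ) (g₀ : Fin (m + 1) → RVec nθ) (θ : ℕ → RVec nθ)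
    (i : Fin (m + 1)) : ℕ → RVec nθ
  | 0 => (1 - α 0) • g₀ i + α 0 • M.gtilde T N₀ α x J₀ θ i 0
  | t + 1 => (1 - α (t + 1)) • ghat J₀ g₀ θ i t + α (t + 1) • M.gtilde T N₀ α x J₀ θ i (t + 1)

end Estimates

end CMDP

/-- The quadratic surrogate `J + gᵀ(θ - θt) + ς ‖θ - θt‖²`. -/
def surrogate {n : ℕ} (J : ℝ) (g θt : RVec n) (ς : ℝ) (θ : RVec n) : ℝ :=
  J + inner ℝ g (θ - θt) + ς * ‖θ - θt‖ ^ 2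

/-- `θbar` solves the convex subproblem for the surrogates `Jb 0, …, Jb m`: the objective update
when that is feasible, and the feasible update otherwise. -/
def IsSubproblemSolution {n m : ℕ} (Θ : Set (RVec n)) (Jb : Fin (m + 1) → RVec n → ℝ)
    (θbar : RVec n) : Prop :=
  let F : Set (RVec n) := {θ | θ ∈ Θ ∧ ∀ j : Fin m, Jb j.succ θ ≤ 0}
  let G : Set (RVec n × ℝ) := {q | q.1 ∈ Θ ∧ ∀ j : Fin m, Jb j.succ q.1 ≤ q.2}
  (F.Nonempty → θbar ∈ F ∧ IsMinOn (Jb 0) F θbar) ∧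
  (¬ F.Nonempty → ∃ y : ℝ, (θbar, y) ∈ G ∧ IsMinOn Prod.snd G (θbar, y))

/-- The assumptions on the step sizes. -/
structure StepSizes (α β : ℕ → ℝ) : Prop where
  α_pos : ∀ t, 0 < α t
  α_anti : Antitone α
  α_lim : Tendsto α atTop (𝓝 0)
  α_inv : ∃ κ ∈ Set.Ioo (0 : ℝ) 1, (fun t => 1 / α t) =O[atTop] fun t : ℕ => (t : ℝ) ^ κ
  α_div : Summable fun t : ℕ => α t * (t : ℝ)⁻¹
  α_log : Summable fun t : ℕ =>
    α t * (Real.log t ^ 2 * ∑ t' ∈ Finset.Icc (t - ⌊Real.log t⌋₊) t, β t')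
  α_sq : Summable fun t => α t ^ 2
  β_pos : ∀ t, 0 < β t
  β_le_one : ∀ t, β t ≤ 1
  β_anti : Antitone β
  β_lim : Tendsto β atTop (𝓝 0)
  β_sum : Tendsto (fun n => ∑ t ∈ Finset.range n, β t) atTop atTop
  β_sq : Summable fun t => β t ^ 2
  ratio : Tendsto (fun t => β t / α t) atTop (𝓝 0)

/-- A run of the algorithm on a probability space. `𝓕 n` is the information available when the
state `s n` has just been observed. Experiences with index `n < N₀` are the initially accumulated
ones, whose law is arbitrary; the experience of iteration `t` has index `N₀ + t`. -/
structure SCAOPORun {nθ ns na m : ℕ} (M : CMDP nθ ns na m) (α β : ℕ → ℝ) (T : ℕ → ℕ) (N₀ : ℕ)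
    (ς : Fin (m + 1) → ℝ) (J₀ : Fin (m + 1) → ℝ) (g₀ : Fin (m + 1) → RVec nθ)
    {Ω : Type*} [mΩ : MeasurableSpace Ω] (μ : Measure Ω) (𝓕 : Filtration ℕ mΩ) where
  /-- states -/
  s : ℕ → Ω → M.S
  /-- actions -/
  a : ℕ → Ω → M.A
  /-- policy parameters `θ^t` -/
  θ : ℕ → Ω → RVec nθ
  /-- solutions of the subproblems -/
  θbar : ℕ → Ω → RVec nθ
  /-- at least one sample is used, and enough experiences are available -/
  one_le_T : ∀ t, 1 ≤ T t
  window : ∀ t, 2 * T t ≤ N₀ + t + 1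
  measurable_s : ∀ n, Measurable[𝓕 n] (s n)
  measurable_a : ∀ n, Measurable[𝓕 (n + 1)] (a n)
  measurable_θ : ∀ t, Measurable[𝓕 (N₀ + t)] (θ t)
  /-- `a_t ∼ π_{θ^t}(· | s_t)` given the past -/
  action_law : ∀ (t : ℕ) (B : Set M.A), MeasurableSet B →
    μ⟦a (N₀ + t) ⁻¹' B | 𝓕 (N₀ + t)⟧ =ᵐ[μ]
      fun ω => (M.policy (θ t ω) (s (N₀ + t) ω)).real B
  /-- `s_{t+1} ∼ P(· | s_t, a_t)` given the past -/
  state_law : ∀ (t : ℕ) (B : Set M.S), MeasurableSet B →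
    μ⟦s (N₀ + t + 1) ⁻¹' B |
        𝓕 (N₀ + t) ⊔ MeasurableSpace.comap (a (N₀ + t)) inferInstance⟧ =ᵐ[μ]
      fun ω => (M.transition (s (N₀ + t) ω, a (N₀ + t) ω)).real B
  θ_zero_mem : ∀ ω, θ 0 ω ∈ M.Θ
  /-- `θ̄^t` solves the subproblem built from the current estimates -/
  subproblem : ∀ t ω, IsSubproblemSolution M.Θ
    (fun i => surrogate (M.Jhat T N₀ α (fun n => (s n ω, a n ω)) J₀ i t)
      (M.ghat T N₀ α (fun n => (s n ω, a n ω)) J₀ g₀ (fun t' => θ t' ω) i t) (θ t ω) (ς i))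
    (θbar t ω)
  update : ∀ t ω, θ (t + 1) ω = (1 - β t) • θ t ω + β t • θbar t ω

namespace SCAOPORun

variable {nθ ns na m : ℕ} {M : CMDP nθ ns na m} {α β : ℕ → ℝ} {T : ℕ → ℕ} {N₀ : ℕ}
  {ς J₀ : Fin (m + 1) → ℝ} {g₀ : Fin (m + 1) → RVec nθ}
  {Ω : Type*} [mΩ : MeasurableSpace Ω] {μ : Measure Ω} {𝓕 : Filtration ℕ mΩ}

/-- The random variable `Ĵ_i^t` of a run. -/
def Jhat (X : SCAOPORun M α β T N₀ ς J₀ g₀ μ 𝓕) (i : Fin (m + 1)) (t : ℕ) (ω : Ω) : ℝ :=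
  M.Jhat T N₀ α (fun n => (X.s n ω, X.a n ω)) J₀ i t

/-- The random vector `ĝ_i^t` of a run. -/
def ghat (X : SCAOPORun M α β T N₀ ς J₀ g₀ μ 𝓕) (i : Fin (m + 1)) (t : ℕ) (ω : Ω) : RVec nθ :=
  M.ghat T N₀ α (fun n => (X.s n ω, X.a n ω)) J₀ g₀ (fun t' => X.θ t' ω) i t

end SCAOPORun

end

/-!
Both estimates are relaxations `Y t = (1 - α t) * Y (t - 1) + α t * y t`. Such a relaxation follows
a target `g` that moves by `o(α t)` per step if its input is `g t`, plus an error that tends to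
zero, plus a noise whose weighted averages tend to zero (`tendsto_sub_target_of_relaxation`). The
iterates move by at most a multiple of `β t = o(α t)`, and `J_i` and its gradient are Lipschitz on
`Θ`, so it remains to show that the inputs computed from the latest `2 * T t` experiences have this
form.

*Decomposition of the inputs.* Freeze the parameter `θ` at the start of the window. For a function
`f` of the transitions, let `val θ f j` be its expected total over `j` transitions under `π_θ`.
Telescoping these values along the trajectory writes the sum of `f` over the window as the expected
total from the first state, plus a sum of martingale differences, plus an error from the motion of
the parameter over the window (`SCAOPORun.exists_isMartingaleSum_sub_val`). By geometric ergodicity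
the expected total is the length of the window times the stationary mean of `f`, up to a bounded
error (`CMDP.ErgodicLaw.abs_val_sub_le`). For the cost this settles the first estimate. For the
gradient, each Q-estimate is the cost of one transition plus the sum of the later costs. Replacing
that sum by its expectation leaves a martingale sum, and turns the estimate into an average of score
times truncated Q-value, whose stationary mean is the gradient, up to an error `O(ρ ^ T t)`, by the
policy gradient theorem (`CMDP.ErgodicLaw.abs_inner_gradient_sub_le`). The baseline `Ĵ_i^t` need not
be accurate: its value before the window is known at the start of the window, and the score has mean
zero, so the baseline contributes a martingale sum again, up to its change over the window.

*The policy gradient theorem* is derived from the assumed differentiability of `J_i` and a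
performance difference formula (`CMDP.ErgodicLaw.abs_J_sub_J_sub_le`) for parameters near `θ`, where
the policies are close because the score is bounded. These parameters may lie outside `Θ`, where no
ergodicity is assumed, but a contraction over finitely many steps persists under small perturbations
(`CMDP.ErgodicLaw.exists_tendsto_of_policyClose`).

*Averaging of the noise.* At time `t` the relaxation gives each input a weight `O(t ^ (-1/2))`, by
`∑ α ^ 2 < ∞` and `1 / α = O(t ^ κ)` (`StepSizes.exists_relaxWeight_le`). The weighted sum of the
overlapping martingale sums regroups into one martingale with small increments, and the
Azuma–Hoeffding inequality with the Borel–Cantelli lemma give almost sure convergence to zero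
(`ae_tendsto_relaxAvg_zero`).
-/

/-! ### Martingale sums and the Azuma–Hoeffding inequality -/

section MartingaleSums

variable {Ω : Type*} [mΩ : MeasurableSpace Ω]

/-- `D` is a martingale difference of time `n`, bounded by `c`: it is known at time `n + 1` and
orthogonal to every bounded random variable that is known at time `n`. This says that the
conditional expectation given `𝓖 n` vanishes, in the form in which it is used. The bound holds
everywhere, not just almost surely. -/
structure IsMartingaleDiff (μ : Measure Ω) (𝓖 : Filtration ℕ mΩ) (n : ℕ) (c : ℝ) (D : Ω → ℝ) :
    Prop where
  meas : Measurable[𝓖 (n + 1)] D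
  bound : ∀ ω, |D ω| ≤ c
  orth : ∀ G : Ω → ℝ, Measurable[𝓖 n] G → (∃ C, ∀ ω, |G ω| ≤ C) → ∫ ω, G ω * D ω ∂μ = 0

/-- `f` is a sum of martingale differences with times in `[lo, hi)`, each bounded by `c`. -/
def IsMartingaleSum (μ : Measure Ω) (𝓖 : Filtration ℕ mΩ) (lo hi : ℕ) (c : ℝ) (f : Ω → ℝ) :
    Prop :=
  ∃ D : ℕ → Ω → ℝ, (∀ n, IsMartingaleDiff μ 𝓖 n c (D n)) ∧
    (∀ n, n ∉ Finset.Ico lo hi → D n = 0) ∧ ∀ ω, f ω = ∑ n ∈ Finset.Ico lo hi, D n ω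

variable {μ : Measure Ω} {𝓖 : Filtration ℕ mΩ}

lemma integrable_of_abs_le {X : Type*} [MeasurableSpace X] {ν : Measure X} [IsFiniteMeasure ν]
    {f : X → ℝ} {C : ℝ} (hf : Measurable f) (hC : ∀ x, |f x| ≤ C) : Integrable f ν :=
  Integrable.of_bound hf.aestronglyMeasurable C (ae_of_all _ hC)

namespace IsMartingaleDiff

variable {n : ℕ} {c c' : ℝ} {D D' : Ω → ℝ}

lemma measurable' (h : IsMartingaleDiff μ 𝓖 n c D) : Measurable D :=
  h.meas.mono (𝓖.le _) le_rfl

lemma mono (h : IsMartingaleDiff μ 𝓖 n c D) (hc : c ≤ c') : IsMartingaleDiff μ 𝓖 n c' D :=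
  ⟨h.meas, fun ω => (h.bound ω).trans hc, h.orth⟩

lemma zero (hc : 0 ≤ c) : IsMartingaleDiff μ 𝓖 n c 0 :=
  ⟨measurable_const, fun ω => by simpa using hc, fun G _ _ => by simp⟩

lemma add [IsProbabilityMeasure μ] (h : IsMartingaleDiff μ 𝓖 n c D)
    (h' : IsMartingaleDiff μ 𝓖 n c' D') :
    IsMartingaleDiff μ 𝓖 n (c + c') (D + D') := by
  refine ⟨h.meas.add h'.meas, fun ω => (abs_add_le _ _).trans (add_le_add (h.bound ω) (h'.bound ω)),
    fun G hG hGb => ?_⟩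
  obtain ⟨C, hC⟩ := hGb
  have hG' : Measurable G := hG.mono (𝓖.le _) le_rfl
  have key : ∀ {E : Ω → ℝ} {e : ℝ}, IsMartingaleDiff μ 𝓖 n e E →
      Integrable (fun ω => G ω * E ω) μ := fun {E e} hE =>
    integrable_of_abs_le (C := C * e) (hG'.mul hE.measurable') fun ω => by
      rw [abs_mul]
      exact mul_le_mul (hC ω) (hE.bound ω) (abs_nonneg _) ((abs_nonneg _).trans (hC ω))
  simp only [Pi.add_apply, mul_add]
  rw [integral_add (key h) (key h'), h.orth G hG ⟨C, hC⟩, h'.orth G hG ⟨C, hC⟩, add_zero]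

/-- Multiplying by a bounded factor that is known beforehand keeps a martingale difference. -/
lemma mul {F : Ω → ℝ} {b : ℝ} (h : IsMartingaleDiff μ 𝓖 n c D) (hF : Measurable[𝓖 n] F)
    (hb : ∀ ω, |F ω| ≤ b) : IsMartingaleDiff μ 𝓖 n (b * c) (fun ω => F ω * D ω) := by
  refine ⟨(hF.mono (𝓖.mono n.le_succ) le_rfl).mul h.meas, fun ω => ?_, fun G hG hGb => ?_⟩
  · rw [abs_mul]
    exact mul_le_mul (hb ω) (h.bound ω) (abs_nonneg _) ((abs_nonneg _).trans (hb ω))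
  · obtain ⟨C, hC⟩ := hGb
    have := h.orth (fun ω => G ω * F ω) (hG.mul hF) ⟨C * b, fun ω => by
      rw [abs_mul]
      exact mul_le_mul (hC ω) (hb ω) (abs_nonneg _) ((abs_nonneg _).trans (hC ω))⟩
    simpa only [mul_assoc] using this

lemma const_mul (h : IsMartingaleDiff μ 𝓖 n c D) (b : ℝ) :
    IsMartingaleDiff μ 𝓖 n (|b| * c) (fun ω => b * D ω) :=
  h.mul measurable_const fun _ => le_rfl

lemma sum [IsProbabilityMeasure μ] {ι : Type*} (s : Finset ι) {c : ι → ℝ} {D : ι → Ω → ℝ}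
    (h : ∀ i ∈ s, IsMartingaleDiff μ 𝓖 n (c i) (D i)) :
    IsMartingaleDiff μ 𝓖 n (∑ i ∈ s, c i) (∑ i ∈ s, D i) := by
  classical
  induction s using Finset.induction_on with
  | empty => simpa using zero le_rfl
  | insert i s hi ih =>
    rw [Finset.sum_insert hi, Finset.sum_insert hi]
    exact (h i (by simp)).add (ih fun j hj => h j (by simp [hj]))

end IsMartingaleDiff

namespace IsMartingaleSum

variable {lo hi : ℕ} {c c' : ℝ} {f f' : Ω → ℝ}

lemma mono (h : IsMartingaleSum μ 𝓖 lo hi c f) (hc : c ≤ c') :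
    IsMartingaleSum μ 𝓖 lo hi c' f := by
  obtain ⟨D, h1, h2, h3⟩ := h
  exact ⟨D, fun n => (h1 n).mono hc, h2, h3⟩

lemma zero (hc : 0 ≤ c) : IsMartingaleSum μ 𝓖 lo hi c (fun _ => 0) :=
  ⟨fun _ => 0, fun _ => .zero hc, fun _ _ => rfl, fun _ => by simp⟩

lemma add [IsProbabilityMeasure μ] (h : IsMartingaleSum μ 𝓖 lo hi c f)
    (h' : IsMartingaleSum μ 𝓖 lo hi c' f') :
    IsMartingaleSum μ 𝓖 lo hi (c + c') (fun ω => f ω + f' ω) := by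
  obtain ⟨D, h1, h2, h3⟩ := h
  obtain ⟨D', h1', h2', h3'⟩ := h'
  refine ⟨fun n => D n + D' n, fun n => (h1 n).add (h1' n), fun n hn => ?_, fun ω => ?_⟩
  · simp only [h2 n hn, h2' n hn, add_zero]
  · simp [h3, h3', Finset.sum_add_distrib]

lemma sum [IsProbabilityMeasure μ] {ι : Type*} (s : Finset ι) {c : ι → ℝ} {f : ι → Ω → ℝ}
    (h : ∀ i ∈ s, IsMartingaleSum μ 𝓖 lo hi (c i) (f i)) :
    IsMartingaleSum μ 𝓖 lo hi (∑ i ∈ s, c i) (fun ω => ∑ i ∈ s, f i ω) := by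
  classical
  induction s using Finset.induction_on with
  | empty => simpa using zero le_rfl
  | insert i s hi ih =>
    simp only [Finset.sum_insert hi]
    exact (h i (by simp)).add (ih fun j hj => h j (by simp [hj]))

lemma const_mul (h : IsMartingaleSum μ 𝓖 lo hi c f) (b : ℝ) :
    IsMartingaleSum μ 𝓖 lo hi (|b| * c) (fun ω => b * f ω) := by
  obtain ⟨D, h1, h2, h3⟩ := h
  refine ⟨fun n ω => b * D n ω, fun n => (h1 n).const_mul b, fun n hn => ?_, fun ω => ?_⟩
  · ext ω; simp [h2 n hn]
  · simp only [h3, Finset.mul_sum]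

lemma single {n : ℕ} (h : IsMartingaleDiff μ 𝓖 n c f) (h0 : 0 ≤ c)
    (hn : n ∈ Finset.Ico lo hi) : IsMartingaleSum μ 𝓖 lo hi c f := by
  classical
  refine ⟨fun k => if k = n then f else 0, fun k => ?_, fun k hk => ?_, fun ω => ?_⟩
  · by_cases hk : k = n
    · subst hk; simpa using h
    · simpa [hk] using IsMartingaleDiff.zero h0
  · exact if_neg fun h : k = n => hk (h ▸ hn)
  · rw [Finset.sum_eq_single_of_mem n hn fun k _ hk => by simp [hk]]; simp

end IsMartingaleSum

/-- The exponential moments of a martingale with bounded differences are at most Gaussian. -/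
lemma integral_exp_martingale_le [IsProbabilityMeasure μ] {D : ℕ → Ω → ℝ} {b : ℕ → ℝ}
    (h : ∀ n, IsMartingaleDiff μ 𝓖 n (b n) (D n)) (l : ℝ) (N : ℕ) :
    Measurable[𝓖 N] (fun ω => ∑ n ∈ Finset.range N, D n ω) ∧
    (∀ ω, |∑ n ∈ Finset.range N, D n ω| ≤ ∑ n ∈ Finset.range N, b n) ∧
    ∫ ω, Real.exp (l * ∑ n ∈ Finset.range N, D n ω) ∂μ
      ≤ Real.exp (l ^ 2 * (∑ n ∈ Finset.range N, b n ^ 2) / 2) := by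
  induction N with
  | zero => simp
  | succ N ih =>
    obtain ⟨hm, hb, hI⟩ := ih
    set S : Ω → ℝ := fun ω => ∑ n ∈ Finset.range N, D n ω with hS
    have hbN : 0 ≤ b N := by
      obtain ⟨ω⟩ : Nonempty Ω := by
        by_contra hne
        rw [not_nonempty_iff] at hne
        have := IsProbabilityMeasure.ne_zero μ
        exact this (Measure.eq_zero_of_isEmpty μ)
      exact (abs_nonneg _).trans ((h N).bound ω)
    have hmS : Measurable S := hm.mono (𝓖.le _) le_rfl
    refine ⟨?_, fun ω => ?_, ?_⟩
    · simp only [Finset.sum_range_succ]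
      exact (hm.mono (𝓖.mono N.le_succ) le_rfl).add (h N).meas
    · rw [Finset.sum_range_succ, Finset.sum_range_succ]
      exact (abs_add_le _ _).trans (add_le_add (hb ω) ((h N).bound ω))
    · have hGm : Measurable[𝓖 N] (fun ω => Real.exp (l * S ω)) :=
        Real.measurable_exp.comp (hm.const_mul l)
      have hGb : ∀ ω, |Real.exp (l * S ω)| ≤ Real.exp (|l| * ∑ n ∈ Finset.range N, b n) := by
        intro ω
        rw [abs_of_pos (Real.exp_pos _)]
        refine Real.exp_le_exp.2 ((le_abs_self _).trans ?_)
        rw [abs_mul]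
        exact mul_le_mul_of_nonneg_left (hb ω) (abs_nonneg _)
      have hGi : Integrable (fun ω => Real.exp (l * S ω)) μ :=
        integrable_of_abs_le (hGm.mono (𝓖.le _) le_rfl) hGb
      -- `exp (l * x)` lies below its chord over `[-b N, b N]`, whose slope is `q`; the linear term
      -- vanishes in expectation by orthogonality, which leaves the factor `cosh (l * b N)`
      set q : ℝ := Real.sinh (l * b N) / b N with hq
      have hGD : Integrable (fun ω => Real.exp (l * S ω) * D N ω) μ := by
        refine integrable_of_abs_le (C := Real.exp (|l| * ∑ n ∈ Finset.range N, b n) * b N)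
          ((hGm.mono (𝓖.le _) le_rfl).mul (h N).measurable') fun ω => ?_
        rw [abs_mul]
        exact mul_le_mul (hGb ω) ((h N).bound ω) (abs_nonneg _) (Real.exp_pos _).le
      have hpt : ∀ ω, Real.exp (l * ∑ n ∈ Finset.range (N + 1), D n ω) ≤
          Real.exp (l * S ω) * Real.cosh (l * b N) + q * (Real.exp (l * S ω) * D N ω) := by
        intro ω
        rw [Finset.sum_range_succ, mul_add, Real.exp_add]
        have : Real.exp (l * D N ω) ≤ Real.cosh (l * b N) + q * D N ω := by
          rcases hbN.eq_or_lt with h0 | hpos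
          · have : D N ω = 0 := by
              have := (h N).bound ω; rw [← h0] at this; exact abs_nonpos_iff.1 this
            simp [this, ← h0]
          · have h1 : |D N ω / b N| ≤ 1 := by
              rw [abs_div, abs_of_pos hpos, div_le_one hpos]; exact (h N).bound ω
            have := Real.exp_mul_le_cosh_add_mul_sinh h1 (l * b N)
            have e1 : D N ω / b N * (l * b N) = l * D N ω := by field_simp
            have e2 : D N ω / b N * Real.sinh (l * b N) = q * D N ω := by rw [hq]; ring
            rwa [e1, e2] at this
        calc _ ≤ Real.exp (l * S ω) * (Real.cosh (l * b N) + q * D N ω) :=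
              mul_le_mul_of_nonneg_left this (Real.exp_pos _).le
          _ = _ := by ring
      calc _ ≤ ∫ ω, (Real.exp (l * S ω) * Real.cosh (l * b N)
                + q * (Real.exp (l * S ω) * D N ω)) ∂μ :=
            integral_mono_of_nonneg (ae_of_all _ fun _ => (Real.exp_pos _).le)
              ((hGi.mul_const _).add (hGD.const_mul _)) (ae_of_all _ hpt)
        _ = (∫ ω, Real.exp (l * S ω) ∂μ) * Real.cosh (l * b N) := by
            rw [integral_add (hGi.mul_const _) (hGD.const_mul _), integral_const_mul,
              (h N).orth _ hGm ⟨_, hGb⟩, mul_zero, add_zero, integral_mul_const]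
        _ ≤ Real.exp (l ^ 2 * (∑ n ∈ Finset.range N, b n ^ 2) / 2)
              * Real.exp ((l * b N) ^ 2 / 2) :=
            mul_le_mul hI (Real.cosh_le_exp_half_sq _) (Real.cosh_pos _).le (Real.exp_pos _).le
        _ = _ := by
            rw [← Real.exp_add, Finset.sum_range_succ]; congr 1; ring

/-- The Azuma–Hoeffding inequality, with the exponent `l` left free. -/
lemma measure_abs_martingale_ge_le [IsProbabilityMeasure μ] {D : ℕ → Ω → ℝ} {b : ℕ → ℝ}
    (h : ∀ n, IsMartingaleDiff μ 𝓖 n (b n) (D n)) {l ε V : ℝ} (hl : 0 ≤ l) (N : ℕ)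
    (hV : ∑ n ∈ Finset.range N, b n ^ 2 ≤ V) :
    μ.real {ω | ε ≤ |∑ n ∈ Finset.range N, D n ω|}
      ≤ 2 * Real.exp (l ^ 2 * V / 2) * Real.exp (-(l * ε)) := by
  have one : ∀ {D : ℕ → Ω → ℝ}, (∀ n, IsMartingaleDiff μ 𝓖 n (b n) (D n)) →
      μ.real {ω | ε ≤ ∑ n ∈ Finset.range N, D n ω}
        ≤ Real.exp (l ^ 2 * V / 2) * Real.exp (-(l * ε)) := by
    intro D h
    obtain ⟨hm, hb, hI⟩ := integral_exp_martingale_le h l N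
    have hint : Integrable (fun ω => Real.exp (l * ∑ n ∈ Finset.range N, D n ω)) μ := by
      refine integrable_of_abs_le (C := Real.exp (|l| * ∑ n ∈ Finset.range N, b n))
        (Real.measurable_exp.comp ((hm.mono (𝓖.le _) le_rfl).const_mul l)) fun ω => ?_
      rw [abs_of_pos (Real.exp_pos _)]
      refine Real.exp_le_exp.2 ((le_abs_self _).trans ?_)
      rw [abs_mul]
      exact mul_le_mul_of_nonneg_left (hb ω) (abs_nonneg _)
    have hM := mul_meas_ge_le_integral_of_nonneg (μ := μ)
      (ae_of_all _ fun ω => (Real.exp_pos (l * ∑ n ∈ Finset.range N, D n ω)).le) hint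
      (Real.exp (l * ε))
    have hsub : μ.real {ω | ε ≤ ∑ n ∈ Finset.range N, D n ω} ≤
        μ.real {ω | Real.exp (l * ε) ≤ Real.exp (l * ∑ n ∈ Finset.range N, D n ω)} :=
      measureReal_mono fun ω (hω : _ ≤ _) =>
        Real.exp_le_exp.2 (mul_le_mul_of_nonneg_left hω hl)
    have hfin : Real.exp (l * ε) * μ.real {ω | ε ≤ ∑ n ∈ Finset.range N, D n ω} ≤
        Real.exp (l ^ 2 * V / 2) := by
      refine (mul_le_mul_of_nonneg_left hsub (Real.exp_pos _).le).trans (hM.trans (hI.trans ?_))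
      exact Real.exp_le_exp.2 (by gcongr)
    rw [Real.exp_neg, ← div_eq_mul_inv, le_div_iff₀ (Real.exp_pos _), mul_comm]
    exact hfin
  have hneg : ∀ n, IsMartingaleDiff μ 𝓖 n (b n) (fun ω => -D n ω) := fun n => by
    simpa using (h n).const_mul (-1)
  have hsub : {ω | ε ≤ |∑ n ∈ Finset.range N, D n ω|} ⊆
      {ω | ε ≤ ∑ n ∈ Finset.range N, D n ω} ∪ {ω | ε ≤ ∑ n ∈ Finset.range N, -D n ω} := by
    intro ω hω
    rw [Set.mem_ofPred_eq, le_abs] at hω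
    simpa [Finset.sum_neg_distrib] using hω
  calc _ ≤ _ := measureReal_mono hsub
    _ ≤ _ := measureReal_union_le _ _
    _ ≤ _ := add_le_add (one h) (one hneg)
    _ = _ := by ring

end MartingaleSums

/-! ### Relaxations -/

section Relaxation

/-- The weight of the input of time `u` in the output of time `t` of the relaxation
`Y (t + 1) = (1 - α (t + 1)) * Y t + α (t + 1) * y (t + 1)`. -/
def relaxWeight (α : ℕ → ℝ) (t u : ℕ) : ℝ := α u * ∏ v ∈ Finset.Ioc u t, (1 - α v)

/-- The output at time `t` of the relaxation with input `y`, started from `0` at time `t₀`. -/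
def relaxAvg (α : ℕ → ℝ) (t₀ : ℕ) (y : ℕ → ℝ) (t : ℕ) : ℝ :=
  ∑ u ∈ Finset.Ioc t₀ t, relaxWeight α t u * y u

variable {α : ℕ → ℝ} {t₀ : ℕ}

lemma relaxAvg_succ (y : ℕ → ℝ) {t : ℕ} (ht : t₀ ≤ t) :
    relaxAvg α t₀ y (t + 1) = (1 - α (t + 1)) * relaxAvg α t₀ y t + α (t + 1) * y (t + 1) := by
  unfold relaxAvg relaxWeight
  rw [Finset.sum_Ioc_succ_top (by omega), Finset.mul_sum]
  congr 1
  · refine Finset.sum_congr rfl fun u hu => ?_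
    rw [Finset.mem_Ioc] at hu
    rw [Finset.prod_Ioc_succ_top (by omega)]
    ring
  · simp

lemma relaxWeight_nonneg (h01 : ∀ v > t₀, 0 ≤ α v ∧ α v ≤ 1) {t u : ℕ} (hu : t₀ < u) :
    0 ≤ relaxWeight α t u :=
  mul_nonneg (h01 u hu).1 (Finset.prod_nonneg fun v hv => by
    rw [Finset.mem_Ioc] at hv
    linarith [(h01 v (by omega)).2])

lemma sum_relaxWeight_le_one (h01 : ∀ v > t₀, 0 ≤ α v ∧ α v ≤ 1) (t : ℕ) :
    ∑ u ∈ Finset.Ioc t₀ t, relaxWeight α t u ≤ 1 := by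
  rcases le_or_gt t t₀ with h | h
  · simp [Finset.Ioc_eq_empty_of_le h]
  · have key : ∀ t, t₀ ≤ t → relaxAvg α t₀ (fun _ => 1) t ≤ 1 := by
      intro t ht
      induction t, ht using Nat.le_induction with
      | base => simp [relaxAvg]
      | succ t ht ih =>
        rw [relaxAvg_succ _ ht]
        have := h01 (t + 1) (by omega)
        nlinarith
    simpa [relaxAvg] using key t h.le

/-- A relaxation with diverging total weight and inputs that tend to zero tends to zero. -/
lemma tendsto_zero_of_relaxation {z b : ℕ → ℝ} (h01 : ∀ v > t₀, 0 ≤ α v ∧ α v ≤ 1)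
    (hdiv : Tendsto (fun n => ∑ v ∈ Finset.range n, α v) atTop atTop)
    (hb : Tendsto b atTop (𝓝 0))
    (hz : ∀ t ≥ t₀, z (t + 1) = (1 - α (t + 1)) * z t + α (t + 1) * b (t + 1)) :
    Tendsto z atTop (𝓝 0) := by
  rw [Metric.tendsto_atTop]
  intro ε hε
  obtain ⟨s₀, hs₀⟩ := Metric.tendsto_atTop.1 hb (ε / 2) (half_pos hε)
  set s := max s₀ t₀ with hs
  -- once the inputs are below `ε / 2`, the excess of `|z|` over `ε / 2` decays
  have hstep : ∀ t ≥ s, |z t| - ε / 2 ≤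
      |z s| * Real.exp (-∑ v ∈ Finset.Ioc s t, α v) := by
    intro t ht
    induction t, ht using Nat.le_induction with
    | base => simp; positivity
    | succ t ht ih =>
      have h1 := h01 (t + 1) (by omega)
      have hbt : |b (t + 1)| ≤ ε / 2 := by
        have := hs₀ (t + 1) (by omega)
        rw [Real.dist_eq, sub_zero] at this
        exact this.le
      rw [Finset.sum_Ioc_succ_top (by omega), neg_add, Real.exp_add]
      have hz1 : |z (t + 1)| ≤ (1 - α (t + 1)) * |z t| + α (t + 1) * (ε / 2) := by
        rw [hz t (by omega)]
        refine (abs_add_le _ _).trans ?_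
        rw [abs_mul, abs_mul, abs_of_nonneg (sub_nonneg.2 h1.2), abs_of_nonneg h1.1]
        gcongr
        exact h1.1
      have hexp : 1 - α (t + 1) ≤ Real.exp (-α (t + 1)) := by
        have := Real.add_one_le_exp (-α (t + 1)); linarith
      have hpos : 0 ≤ |z s| * Real.exp (-∑ v ∈ Finset.Ioc s t, α v) := by positivity
      calc |z (t + 1)| - ε / 2 ≤ (1 - α (t + 1)) * (|z t| - ε / 2) := by linarith
        _ ≤ (1 - α (t + 1)) * (|z s| * Real.exp (-∑ v ∈ Finset.Ioc s t, α v)) :=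
            mul_le_mul_of_nonneg_left ih (sub_nonneg.2 h1.2)
        _ ≤ Real.exp (-α (t + 1)) * (|z s| * Real.exp (-∑ v ∈ Finset.Ioc s t, α v)) :=
            mul_le_mul_of_nonneg_right hexp hpos
        _ = _ := by ring
  have hlim : Tendsto (fun t => |z s| * Real.exp (-∑ v ∈ Finset.Ioc s t, α v)) atTop (𝓝 0) := by
    rw [← mul_zero |z s|]
    refine (Real.tendsto_exp_neg_atTop_nhds_zero.comp ?_).const_mul _
    have : Tendsto (fun t : ℕ => ∑ v ∈ Finset.range (t + 1), α v
        - ∑ v ∈ Finset.range (s + 1), α v) atTop atTop :=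
      tendsto_atTop_add_const_right _ _ (hdiv.comp (tendsto_add_atTop_nat 1))
    refine this.congr' ?_
    filter_upwards [eventually_ge_atTop s] with t ht
    rw [← Finset.sum_Ico_eq_sub _ (by omega)]
    exact Finset.sum_congr (by ext v; simp only [Finset.mem_Ico, Finset.mem_Ioc]; omega)
      fun _ _ => rfl
  obtain ⟨t₁, ht₁⟩ := eventually_atTop.1 (hlim.eventually (gt_mem_nhds (half_pos hε)))
  refine ⟨max t₁ s, fun t ht => ?_⟩
  rw [Real.dist_eq, sub_zero]
  have h1 := hstep t (by omega)
  have h2 := ht₁ t (by omega)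
  linarith

/-- Consistency of a relaxation that tracks a slowly moving target `g`: the inputs are the target
plus a noise with vanishing averages and an error that tends to zero. -/
lemma tendsto_sub_target_of_relaxation {Y y g n b : ℕ → ℝ}
    (h01 : ∀ v > t₀, 0 < α v ∧ α v ≤ 1)
    (hdiv : Tendsto (fun n => ∑ v ∈ Finset.range n, α v) atTop atTop)
    (hY : ∀ t ≥ t₀, Y (t + 1) = (1 - α (t + 1)) * Y t + α (t + 1) * y (t + 1))
    (hy : ∀ t > t₀, |y t - g t - n t| ≤ b t) (hb : Tendsto b atTop (𝓝 0))
    (hg : Tendsto (fun t => (g (t + 1) - g t) / α t) atTop (𝓝 0))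
    (hα : Tendsto α atTop (𝓝 0))
    (hn : Tendsto (relaxAvg α t₀ n) atTop (𝓝 0)) :
    Tendsto (fun t => Y t - g t) atTop (𝓝 0) := by
  -- compare with the target of the next time, so that its drift is divided by the current `α`
  set z : ℕ → ℝ := fun t => Y t - g (t + 1) - relaxAvg α t₀ n t with hz
  set e : ℕ → ℝ := fun t => if t₀ < t then (y t - g t - n t) - (g (t + 1) - g t) / α t else 0
    with he
  have he0 : Tendsto e atTop (𝓝 0) := by
    have h1 : Tendsto (fun t => if t₀ < t then y t - g t - n t else 0) atTop (𝓝 0) := by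
      refine squeeze_zero_norm' ?_ hb
      filter_upwards [eventually_gt_atTop t₀] with t ht
      simpa [ht] using hy t ht
    have h2 := h1.sub hg
    rw [sub_zero] at h2
    refine h2.congr' ?_
    filter_upwards [eventually_gt_atTop t₀] with t ht
    simp [he, ht]
  have hz0 : Tendsto z atTop (𝓝 0) := by
    refine tendsto_zero_of_relaxation (t₀ := t₀) (fun v hv => ⟨(h01 v hv).1.le, (h01 v hv).2⟩)
      hdiv he0 fun t ht => ?_
    have hpos := (h01 (t + 1) (by omega)).1
    simp only [hz, he, if_pos (show t₀ < t + 1 by omega)]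
    rw [hY t ht, relaxAvg_succ _ ht]
    field_simp
    ring
  have hd : Tendsto (fun t => g (t + 1) - g t) atTop (𝓝 0) := by
    have := hg.mul hα
    rw [mul_zero] at this
    refine this.congr' ?_
    filter_upwards [eventually_gt_atTop t₀] with t ht
    exact div_mul_cancel₀ _ (h01 t ht).1.ne'
  have := (hz0.add hn).add hd
  simp only [add_zero] at this
  refine this.congr fun t => ?_
  simp only [hz]; ring

lemma summable_exp_neg_mul_rpow {ε r : ℝ} (hε : 0 < ε) (hr : 0 < r) :
    Summable fun t : ℕ => Real.exp (-(ε * (t : ℝ) ^ r)) := by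
  have h1 := (isLittleO_exp_neg_mul_rpow_atTop hε (-2 / r)).comp_tendsto
    ((tendsto_rpow_atTop hr).comp tendsto_natCast_atTop_atTop)
  refine summable_of_isBigO_nat (g := fun t : ℕ => (t : ℝ) ^ (-2 : ℝ))
    (Real.summable_nat_rpow.2 (by norm_num)) ?_
  refine h1.isBigO.congr (fun t => by simp) fun t => ?_
  simp only [Function.comp]
  rw [← Real.rpow_mul (Nat.cast_nonneg _)]
  congr 1
  field_simp

end Relaxation

/-! ### Averaging of noise -/

section Noise

variable {Ω : Type*} [mΩ : MeasurableSpace Ω] {μ : Measure Ω} [IsProbabilityMeasure μ]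
  {𝓖 : Filtration ℕ mΩ} {α : ℕ → ℝ} {t₀ : ℕ}

/-- For a fixed time `t`, the weighted sum of martingale sums over short windows is regrouped into a
single martingale, to which the Azuma–Hoeffding inequality applies. The windows have length at most
`p` and the weights are at most `w`, so the difference of time `j`, which collects the windows that
contain `j`, has a bound `b j ≤ w * p ^ 2`, while `∑ b j ≤ p ^ 2` as the weights add up to at most
one; hence `∑ b j ^ 2 ≤ w * p ^ 4`. -/
lemma measure_abs_relaxAvg_ge_le (h01 : ∀ v > t₀, 0 ≤ α v ∧ α v ≤ 1) {k : ℕ → ℕ}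
    {n : ℕ → Ω → ℝ} {t : ℕ} {p w : ℝ} (hp : 0 ≤ p)
    (hn : ∀ u ∈ Finset.Ioc t₀ t, IsMartingaleSum μ 𝓖 (k u) (u + 1) p (n u))
    (hk : ∀ u ∈ Finset.Ioc t₀ t, (u : ℝ) + 1 ≤ k u + p)
    (hw : ∀ u ∈ Finset.Ioc t₀ t, relaxWeight α t u ≤ w) (hw0 : 0 ≤ w)
    {l ε : ℝ} (hl : 0 ≤ l) :
    μ.real {ω | ε ≤ |relaxAvg α t₀ (fun u => n u ω) t|}
      ≤ 2 * Real.exp (l ^ 2 * (w * p ^ 4) / 2) * Real.exp (-(l * ε)) := by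
  classical
  choose! D hD1 hD2 hD3 using hn
  set b : ℕ → ℝ := fun j => ∑ u ∈ Finset.Ioc t₀ t,
    relaxWeight α t u * (if j ∈ Finset.Ico (k u) (u + 1) then p else 0) with hbdef
  set E : ℕ → Ω → ℝ := fun j => ∑ u ∈ Finset.Ioc t₀ t, fun ω => relaxWeight α t u * D u j ω
    with hE
  have hw_nonneg : ∀ u ∈ Finset.Ioc t₀ t, 0 ≤ relaxWeight α t u := fun u hu =>
    relaxWeight_nonneg h01 (Finset.mem_Ioc.1 hu).1
  have hEd : ∀ j, IsMartingaleDiff μ 𝓖 j (b j) (E j) := by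
    intro j
    refine IsMartingaleDiff.sum _ fun u hu => ?_
    have : IsMartingaleDiff μ 𝓖 j (if j ∈ Finset.Ico (k u) (u + 1) then p else 0) (D u j) := by
      split_ifs with hj
      · exact hD1 u hu j
      · rw [hD2 u hu j hj]; exact .zero le_rfl
    have := this.const_mul (relaxWeight α t u)
    rwa [abs_of_nonneg (hw_nonneg u hu)] at this
  have hEsum : ∀ ω, relaxAvg α t₀ (fun u => n u ω) t = ∑ j ∈ Finset.range (t + 1), E j ω := by
    intro ω
    simp only [hE, Finset.sum_apply]
    rw [Finset.sum_comm]
    refine Finset.sum_congr rfl fun u hu => ?_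
    beta_reduce
    rw [hD3 u hu, ← Finset.mul_sum]
    congr 1
    refine Finset.sum_subset (fun j hj => ?_) fun j _ hj => by rw [hD2 u hu j hj]; rfl
    have := Finset.mem_Ioc.1 hu
    have := Finset.mem_Ico.1 hj
    exact Finset.mem_range.2 (by omega)
  have hb0 : ∀ j, 0 ≤ b j := fun j => Finset.sum_nonneg fun u hu =>
    mul_nonneg (hw_nonneg u hu) (by split_ifs <;> simp [hp])
  have hbmax : ∀ j, b j ≤ w * p ^ 2 := by
    intro j
    -- only the windows that end less than `p` after `j` contain `j`
    have hcard : (((Finset.Ioc t₀ t).filter fun u => j ∈ Finset.Ico (k u) (u + 1)).card : ℝ)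
        ≤ p := by
      have hsub : (Finset.Ioc t₀ t).filter (fun u => j ∈ Finset.Ico (k u) (u + 1)) ⊆
          Finset.Ico j (j + ⌊p⌋₊) := by
        intro u hu
        rw [Finset.mem_filter, Finset.mem_Ico] at hu
        have h1 := hk u hu.1
        have h2 : (k u : ℝ) ≤ j := by exact_mod_cast hu.2.1
        have h3 : u + 1 - j ≤ ⌊p⌋₊ := by
          refine Nat.le_floor ?_
          rw [Nat.cast_sub (by omega)]
          push_cast
          linarith
        rw [Finset.mem_Ico]; omega
      refine (Nat.cast_le.2 (Finset.card_le_card hsub)).trans ?_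
      simpa using Nat.floor_le hp
    calc b j = ∑ u ∈ (Finset.Ioc t₀ t).filter (fun u => j ∈ Finset.Ico (k u) (u + 1)),
            relaxWeight α t u * p := by
          rw [hbdef, Finset.sum_filter]
          exact Finset.sum_congr rfl fun u _ => by split_ifs <;> simp
      _ ≤ ∑ u ∈ (Finset.Ioc t₀ t).filter (fun u => j ∈ Finset.Ico (k u) (u + 1)), w * p :=
          Finset.sum_le_sum fun u hu =>
            mul_le_mul_of_nonneg_right (hw u (Finset.mem_filter.1 hu).1) hp
      _ ≤ p * (w * p) := by
          rw [Finset.sum_const, nsmul_eq_mul]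
          exact mul_le_mul_of_nonneg_right hcard (mul_nonneg hw0 hp)
      _ = _ := by ring
  have hbsum : ∑ j ∈ Finset.range (t + 1), b j ≤ p ^ 2 := by
    rw [hbdef, Finset.sum_comm]
    calc _ ≤ ∑ u ∈ Finset.Ioc t₀ t, relaxWeight α t u * p ^ 2 := by
          refine Finset.sum_le_sum fun u hu => ?_
          rw [← Finset.mul_sum]
          refine mul_le_mul_of_nonneg_left ?_ (hw_nonneg u hu)
          rw [← Finset.sum_filter, Finset.sum_const, nsmul_eq_mul, sq]
          refine mul_le_mul_of_nonneg_right ?_ hp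
          have hsub : (Finset.range (t + 1)).filter (fun j => j ∈ Finset.Ico (k u) (u + 1)) ⊆
              Finset.Ico (k u) (u + 1) := fun j hj => (Finset.mem_filter.1 hj).2
          refine (Nat.cast_le.2 (Finset.card_le_card hsub)).trans ?_
          rw [Nat.card_Ico]
          rcases le_total (k u) (u + 1) with h | h
          · rw [Nat.cast_sub h]; push_cast; linarith [hk u hu]
          · rw [Nat.sub_eq_zero_of_le h]; simpa using hp
      _ = (∑ u ∈ Finset.Ioc t₀ t, relaxWeight α t u) * p ^ 2 := (Finset.sum_mul _ _ _).symm
      _ ≤ 1 * p ^ 2 := mul_le_mul_of_nonneg_right (sum_relaxWeight_le_one h01 t) (sq_nonneg p)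
      _ = _ := one_mul _
  have hV : ∑ j ∈ Finset.range (t + 1), b j ^ 2 ≤ w * p ^ 4 := by
    calc _ ≤ ∑ j ∈ Finset.range (t + 1), w * p ^ 2 * b j := Finset.sum_le_sum fun j _ => by
          rw [sq]; exact mul_le_mul_of_nonneg_right (hbmax j) (hb0 j)
      _ = w * p ^ 2 * ∑ j ∈ Finset.range (t + 1), b j := (Finset.mul_sum _ _ _).symm
      _ ≤ w * p ^ 2 * p ^ 2 :=
          mul_le_mul_of_nonneg_left hbsum (mul_nonneg hw0 (sq_nonneg p))
      _ = _ := by ring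
  simp only [hEsum]
  exact measure_abs_martingale_ge_le hEd hl (t + 1) hV

/-- The relaxation averages out a noise made of martingale sums over windows of slowly growing
length. With `p = C * t ^ (1/16)`, `w = Cw * t ^ (-1/2)` and `l = t ^ (1/8)`, the term
`l ^ 2 * w * p ^ 4` in the Azuma–Hoeffding bound stays constant, so that the bound is of the order
of `exp (-ε * t ^ (1/8))`, which is summable. -/
lemma ae_tendsto_relaxAvg_zero (h01 : ∀ v > t₀, 0 ≤ α v ∧ α v ≤ 1) {k : ℕ → ℕ}
    {n : ℕ → Ω → ℝ} {C Cw : ℝ} (hC : 0 ≤ C) (hCw : 0 ≤ Cw)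
    (hn : ∀ u > t₀, IsMartingaleSum μ 𝓖 (k u) (u + 1) (C * (u : ℝ) ^ (1 / 16 : ℝ)) (n u))
    (hk : ∀ u > t₀, (u : ℝ) + 1 ≤ k u + C * (u : ℝ) ^ (1 / 16 : ℝ))
    (hw : ∀ᶠ t : ℕ in atTop, ∀ u ∈ Finset.Ioc t₀ t,
      relaxWeight α t u ≤ Cw * (t : ℝ) ^ (-(1 / 2) : ℝ)) :
    ∀ᵐ ω ∂μ, Tendsto (relaxAvg α t₀ fun u => n u ω) atTop (𝓝 0) := by
  have hev : ∀ ε > 0, ∀ᵐ ω ∂μ, ∀ᶠ t in atTop, |relaxAvg α t₀ (fun u => n u ω) t| < ε := by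
    intro ε hε
    have hsum : Summable fun t : ℕ => μ.real {ω | ε ≤ |relaxAvg α t₀ (fun u => n u ω) t|} := by
      refine summable_of_isBigO_nat (summable_exp_neg_mul_rpow hε (r := 1 / 8) (by norm_num)) ?_
      refine IsBigO.of_bound (2 * Real.exp (Cw * C ^ 4 / 2)) ?_
      filter_upwards [hw, eventually_gt_atTop 0] with t hwt ht
      have ht' : (0 : ℝ) < t := by exact_mod_cast ht
      have hpm : ∀ u ∈ Finset.Ioc t₀ t, C * (u : ℝ) ^ (1 / 16 : ℝ) ≤ C * (t : ℝ) ^ (1 / 16 : ℝ) :=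
        fun u hu => by
          have : (u : ℝ) ≤ t := by exact_mod_cast (Finset.mem_Ioc.1 hu).2
          gcongr
      have := measure_abs_relaxAvg_ge_le (μ := μ) (𝓖 := 𝓖) h01 (t := t) (k := k) (n := n)
        (p := C * (t : ℝ) ^ (1 / 16 : ℝ)) (w := Cw * (t : ℝ) ^ (-(1 / 2) : ℝ))
        (l := (t : ℝ) ^ (1 / 8 : ℝ)) (ε := ε) (by positivity)
        (fun u hu => (hn u (Finset.mem_Ioc.1 hu).1).mono (hpm u hu))
        (fun u hu => (hk u (Finset.mem_Ioc.1 hu).1).trans (by linarith [hpm u hu]))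
        hwt (by positivity) (by positivity)
      rw [Real.norm_of_nonneg measureReal_nonneg, Real.norm_of_nonneg (Real.exp_pos _).le]
      refine this.trans_eq ?_
      have e1 : ((t : ℝ) ^ (1 / 8 : ℝ)) ^ 2 * (Cw * (t : ℝ) ^ (-(1 / 2) : ℝ) *
          (C * (t : ℝ) ^ (1 / 16 : ℝ)) ^ 4) = Cw * C ^ 4 := by
        have e2 : ((t : ℝ) ^ (1 / 8 : ℝ)) ^ 2 = (t : ℝ) ^ (1 / 4 : ℝ) := by
          rw [← Real.rpow_mul_natCast ht'.le]; norm_num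
        have e3 : ((t : ℝ) ^ (1 / 16 : ℝ)) ^ 4 = (t : ℝ) ^ (1 / 4 : ℝ) := by
          rw [← Real.rpow_mul_natCast ht'.le]; norm_num
        have e4 : (t : ℝ) ^ (1 / 4 : ℝ) * (t : ℝ) ^ (1 / 4 : ℝ) * (t : ℝ) ^ (-(1 / 2) : ℝ) = 1 := by
          rw [← Real.rpow_add ht', ← Real.rpow_add ht']; norm_num
        rw [mul_pow, e2, e3]
        linear_combination Cw * C ^ 4 * e4
      rw [e1, mul_comm ε]
    have := ae_eventually_notMem (μ := μ)
      (s := fun t => {ω | ε ≤ |relaxAvg α t₀ (fun u => n u ω) t|}) (by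
        have h := hsum.tsum_ofReal_ne_top
        simpa only [ofReal_measureReal (measure_ne_top μ _)] using h)
    filter_upwards [this] with ω hω
    filter_upwards [hω] with t ht
    simpa using ht
  have hall : ∀ᵐ ω ∂μ, ∀ j : ℕ, ∀ᶠ t in atTop,
      |relaxAvg α t₀ (fun u => n u ω) t| < 1 / ((j : ℝ) + 1) :=
    ae_all_iff.2 fun j => hev _ (by positivity)
  filter_upwards [hall] with ω hω
  rw [Metric.tendsto_nhds]
  intro ε hε
  obtain ⟨j, hj⟩ := exists_nat_one_div_lt hε
  filter_upwards [hω j] with t ht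
  rw [Real.dist_eq, sub_zero]
  exact ht.trans hj

end Noise

/-! ### Step sizes -/

section StepSizeBounds

/-- A non-increasing square-summable sequence is `O(t ^ (-1/2))`. -/
lemma exists_le_mul_rpow_neg_half {α : ℕ → ℝ} (hpos : ∀ t, 0 < α t) (hanti : Antitone α)
    (hsq : Summable fun t => α t ^ 2) :
    ∃ C, 0 ≤ C ∧ ∀ t : ℕ, 0 < t → α t ≤ C * (t : ℝ) ^ (-(1 / 2) : ℝ) := by
  refine ⟨√(∑' t, α t ^ 2), Real.sqrt_nonneg _, fun t ht => ?_⟩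
  have ht' : (0 : ℝ) < t := by exact_mod_cast ht
  have h1 : (t : ℝ) * α t ^ 2 ≤ ∑' t, α t ^ 2 := by
    calc (t : ℝ) * α t ^ 2 = ∑ v ∈ Finset.range t, α t ^ 2 := by simp
      _ ≤ ∑ v ∈ Finset.range t, α v ^ 2 := Finset.sum_le_sum fun v hv =>
          pow_le_pow_left₀ (hpos t).le (hanti (Finset.mem_range.1 hv).le) 2
      _ ≤ _ := hsq.sum_le_tsum _ fun _ _ => sq_nonneg _
  have h2 : √(t : ℝ) * α t ≤ √(∑' t, α t ^ 2) := by
    refine Real.le_sqrt_of_sq_le ?_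
    rw [mul_pow, Real.sq_sqrt ht'.le]
    exact h1
  rw [Real.rpow_neg ht'.le, ← Real.sqrt_eq_rpow, ← div_eq_mul_inv, le_div_iff₀ (by positivity)]
  linarith

namespace StepSizes

variable {α β : ℕ → ℝ} (h : StepSizes α β)
include h

/-- The lower bound for `α` in the form in which it is used. -/
lemma exists_le_α_mul_rpow : ∃ κ < (1 : ℝ), ∃ c > 0, ∀ᶠ t : ℕ in atTop,
    c * (t : ℝ) ^ (-κ) ≤ α t := by
  obtain ⟨κ, hκ, hO⟩ := h.α_inv
  obtain ⟨C, hC, hb⟩ := hO.exists_pos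
  refine ⟨κ, hκ.2, C⁻¹, inv_pos.2 hC, ?_⟩
  filter_upwards [hb.bound, eventually_gt_atTop 0] with t ht ht0
  have ht' : (0 : ℝ) < t := by exact_mod_cast ht0
  rw [Real.norm_of_nonneg (one_div_pos.2 (h.α_pos t)).le,
    Real.norm_of_nonneg (by positivity), div_le_iff₀ (h.α_pos t)] at ht
  rw [Real.rpow_neg ht'.le, ← mul_inv, inv_le_iff_one_le_mul₀ (by positivity)]
  linarith

lemma tendsto_sum_α : Tendsto (fun n => ∑ v ∈ Finset.range n, α v) atTop atTop := by
  refine (not_summable_iff_tendsto_nat_atTop_of_nonneg fun t => (h.α_pos t).le).1 fun hs => ?_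
  obtain ⟨κ, hκ, c, hc, hev⟩ := h.exists_le_α_mul_rpow
  have : Summable fun t : ℕ => (t : ℝ) ^ (-κ) := by
    refine summable_of_isBigO_nat hs (IsBigO.of_bound c⁻¹ ?_)
    filter_upwards [hev] with t ht
    rw [Real.norm_of_nonneg (by positivity), Real.norm_of_nonneg (h.α_pos t).le,
      inv_mul_eq_div, le_div_iff₀ hc]
    linarith
  rw [Real.summable_nat_rpow] at this
  linarith

lemma eventually_α_le_one : ∀ᶠ t in atTop, α t ≤ 1 :=
  (h.α_lim.eventually (gt_mem_nhds one_pos)).mono fun _ ht => ht.le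

/-- Recent weights are at most `α (t / 2) = O(t ^ (-1/2))`; older ones are exponentially small
because the step sizes between `t / 2` and `t` add up to at least `c * t ^ (1 - κ)`. -/
lemma exists_relaxWeight_le {t₀ : ℕ} (h1 : ∀ v > t₀, α v ≤ 1) :
    ∃ C, 0 ≤ C ∧ ∀ᶠ t : ℕ in atTop, ∀ u ∈ Finset.Ioc t₀ t,
      relaxWeight α t u ≤ C * (t : ℝ) ^ (-(1 / 2) : ℝ) := by
  obtain ⟨C, hC, hα⟩ := exists_le_mul_rpow_neg_half h.α_pos h.α_anti h.α_sq
  obtain ⟨κ, hκ, c, hc, hev⟩ := h.exists_le_α_mul_rpow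
  have hexp : ∀ᶠ t : ℕ in atTop,
      Real.exp (-(c / 2 * (t : ℝ) ^ (1 - κ))) ≤ (t : ℝ) ^ (-(1 / 2) : ℝ) := by
    have h1κ : 0 < 1 - κ := by linarith
    have := (isLittleO_exp_neg_mul_rpow_atTop (half_pos hc) (-(1 / 2) / (1 - κ))).comp_tendsto
      ((tendsto_rpow_atTop h1κ).comp tendsto_natCast_atTop_atTop)
    filter_upwards [this.bound one_pos, eventually_gt_atTop 0] with t ht ht0
    have ht' : (0 : ℝ) < t := by exact_mod_cast ht0
    simp only [Function.comp, one_mul] at ht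
    rw [Real.norm_of_nonneg (Real.exp_pos _).le, Real.norm_of_nonneg (by positivity),
      ← Real.rpow_mul ht'.le, mul_div_cancel₀ _ h1κ.ne'] at ht
    rwa [← neg_mul]
  refine ⟨C * (1 / 2 : ℝ) ^ (-(1 / 2) : ℝ) + 1, by positivity, ?_⟩
  filter_upwards [hev, hexp, eventually_gt_atTop 0] with t htα htexp ht0 u hu
  have ht' : (0 : ℝ) < t := by exact_mod_cast ht0
  rw [Finset.mem_Ioc] at hu
  have hfac : ∀ v ∈ Finset.Ioc u t, 0 ≤ 1 - α v ∧ 1 - α v ≤ Real.exp (-α t) := by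
    intro v hv
    rw [Finset.mem_Ioc] at hv
    refine ⟨by linarith [h1 v (by omega)], ?_⟩
    have h2 := Real.add_one_le_exp (-α t)
    have h3 := h.α_anti hv.2
    linarith
  have hpos : 0 ≤ ∏ v ∈ Finset.Ioc u t, (1 - α v) := Finset.prod_nonneg fun v hv => (hfac v hv).1
  rw [add_mul, one_mul]
  unfold relaxWeight
  rcases lt_or_ge t (2 * u) with hcase | hcase
  · have hu0 : (t : ℝ) * (1 / 2) ≤ u := by
      have : (t : ℝ) ≤ 2 * u := by exact_mod_cast hcase.le
      linarith
    have hle1 : ∏ v ∈ Finset.Ioc u t, (1 - α v) ≤ 1 :=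
      Finset.prod_le_one (fun v hv => (hfac v hv).1) fun v _ => by linarith [h.α_pos v]
    have hu' : α u ≤ C * (1 / 2 : ℝ) ^ (-(1 / 2) : ℝ) * (t : ℝ) ^ (-(1 / 2) : ℝ) := by
      refine (hα u (by omega)).trans ?_
      rw [mul_assoc, ← Real.mul_rpow (by norm_num) ht'.le]
      refine mul_le_mul_of_nonneg_left ?_ hC
      exact Real.rpow_le_rpow_of_nonpos (by positivity) (by linarith) (by norm_num)
    calc α u * ∏ v ∈ Finset.Ioc u t, (1 - α v) ≤ α u * 1 :=
          mul_le_mul_of_nonneg_left hle1 (h.α_pos u).le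
      _ ≤ _ := by rw [mul_one]; linarith [Real.rpow_nonneg ht'.le (-(1 / 2) : ℝ)]
  · have hprod : ∏ v ∈ Finset.Ioc u t, (1 - α v) ≤ (t : ℝ) ^ (-(1 / 2) : ℝ) := by
      calc ∏ v ∈ Finset.Ioc u t, (1 - α v) ≤ ∏ v ∈ Finset.Ioc u t, Real.exp (-α t) :=
            Finset.prod_le_prod (fun v hv => (hfac v hv).1) fun v hv => (hfac v hv).2
        _ = Real.exp (-(((t - u : ℕ) : ℝ) * α t)) := by
            rw [Finset.prod_const, Nat.card_Ioc, ← Real.exp_nat_mul]; congr 1; ring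
        _ ≤ Real.exp (-(c / 2 * (t : ℝ) ^ (1 - κ))) := by
            refine Real.exp_le_exp.2 (neg_le_neg ?_)
            have h2 : (t : ℝ) / 2 ≤ ((t - u : ℕ) : ℝ) := by
              rw [Nat.cast_sub hu.2]
              have : (2 : ℝ) * u ≤ t := by exact_mod_cast hcase
              linarith
            calc c / 2 * (t : ℝ) ^ (1 - κ) = (t : ℝ) / 2 * (c * (t : ℝ) ^ (-κ)) := by
                  rw [sub_eq_add_neg, Real.rpow_add ht', Real.rpow_one]; ring
              _ ≤ _ := mul_le_mul h2 htα (by positivity) (by positivity)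
        _ ≤ _ := htexp
    calc α u * ∏ v ∈ Finset.Ioc u t, (1 - α v) ≤ 1 * (t : ℝ) ^ (-(1 / 2) : ℝ) :=
          mul_le_mul (h1 u hu.1) hprod hpos zero_le_one
      _ ≤ _ := by rw [one_mul]; linarith [show 0 ≤ C * (1 / 2 : ℝ) ^ (-(1 / 2) : ℝ)
                    * (t : ℝ) ^ (-(1 / 2) : ℝ) by positivity]

end StepSizes

variable {T : ℕ → ℕ}

lemma eventually_le_rpow_of_isBigO_log
    (hTlog : (fun t => (T t : ℝ)) =O[atTop] fun t : ℕ => Real.log t) {r : ℝ} (hr : 0 < r)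
    {c : ℝ} (hc : 0 < c) : ∀ᶠ t : ℕ in atTop, (T t : ℝ) ≤ c * (t : ℝ) ^ r := by
  have := hTlog.trans_isLittleO ((isLittleO_log_rpow_atTop hr).comp_tendsto
    tendsto_natCast_atTop_atTop)
  filter_upwards [this.bound hc] with t ht
  rwa [Real.norm_of_nonneg (Nat.cast_nonneg _), Function.comp,
    Real.norm_of_nonneg (by positivity)] at ht

lemma eventually_window_le
    (hTlog : (fun t => (T t : ℝ)) =O[atTop] fun t : ℕ => Real.log t) :
    ∀ᶠ t : ℕ in atTop, 4 * T t ≤ t := by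
  filter_upwards [eventually_le_rpow_of_isBigO_log hTlog one_pos (c := 1 / 4) (by norm_num)]
    with t ht
  rw [Real.rpow_one] at ht
  have : (4 * T t : ℝ) ≤ t := by linarith
  exact_mod_cast this

/-- A non-increasing step size of order `t ^ (-1/2)`, taken at the start of the window of the latest
`2 * T t` times, beats the square of `T t`. -/
lemma tendsto_sq_mul_window {γ : ℕ → ℝ} {C : ℝ} (hpos : ∀ t, 0 < γ t)
    (hγ : ∀ t : ℕ, 0 < t → γ t ≤ C * (t : ℝ) ^ (-(1 / 2) : ℝ))
    (hTlog : (fun t => (T t : ℝ)) =O[atTop] fun t : ℕ => Real.log t) :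
    Tendsto (fun t => (T t : ℝ) ^ 2 * γ (t - 2 * T t)) atTop (𝓝 0) := by
  have hC : 0 ≤ C := by
    have h1 := hγ 1 one_pos
    simp at h1
    exact (hpos 1).le.trans h1
  have hlim : Tendsto (fun t : ℕ => C * (1 / 2 : ℝ) ^ (-(1 / 2) : ℝ) * (t : ℝ) ^ (-(1 / 4) : ℝ))
      atTop (𝓝 0) := by
    rw [← mul_zero (C * (1 / 2 : ℝ) ^ (-(1 / 2) : ℝ))]
    exact ((tendsto_rpow_neg_atTop (by norm_num : (0 : ℝ) < 1 / 4)).comp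
      tendsto_natCast_atTop_atTop).const_mul _
  refine squeeze_zero' (Eventually.of_forall fun t =>
    mul_nonneg (sq_nonneg _) (hpos _).le) ?_ hlim
  filter_upwards [eventually_window_le hTlog, eventually_ge_atTop 2,
    eventually_le_rpow_of_isBigO_log hTlog (r := 1 / 8) (by norm_num) one_pos] with t ht ht0 hT
  have ht' : (0 : ℝ) < t := by exact_mod_cast (by omega : 0 < t)
  have hs : t ≤ 2 * (t - 2 * T t) := by omega
  set s := t - 2 * T t with hsdef
  have hs0 : 0 < s := by omega
  have hs' : (1 / 2 : ℝ) * t ≤ s := by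
    have : (t : ℝ) ≤ 2 * s := by exact_mod_cast hs
    linarith
  have h1 : γ s ≤ C * ((1 / 2 : ℝ) ^ (-(1 / 2) : ℝ) * (t : ℝ) ^ (-(1 / 2) : ℝ)) := by
    refine (hγ s hs0).trans (mul_le_mul_of_nonneg_left ?_ hC)
    rw [← Real.mul_rpow (by norm_num) ht'.le]
    exact Real.rpow_le_rpow_of_nonpos (by positivity) hs' (by norm_num)
  have h2 : (T t : ℝ) ^ 2 ≤ (t : ℝ) ^ (1 / 4 : ℝ) := by
    calc (T t : ℝ) ^ 2 ≤ ((t : ℝ) ^ (1 / 8 : ℝ)) ^ 2 :=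
          pow_le_pow_left₀ (Nat.cast_nonneg _) (by simpa using hT) 2
      _ = _ := by rw [← Real.rpow_mul_natCast ht'.le]; norm_num
  calc (T t : ℝ) ^ 2 * γ s
      ≤ (t : ℝ) ^ (1 / 4 : ℝ) * (C * ((1 / 2 : ℝ) ^ (-(1 / 2) : ℝ) * (t : ℝ) ^ (-(1 / 2) : ℝ))) :=
        mul_le_mul h2 h1 (hpos _).le (by positivity)
    _ = C * (1 / 2 : ℝ) ^ (-(1 / 2) : ℝ) * ((t : ℝ) ^ (1 / 4 : ℝ) * (t : ℝ) ^ (-(1 / 2) : ℝ)) := by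
        ring
    _ = _ := by rw [← Real.rpow_add ht']; norm_num

end StepSizeBounds

/-! ### Total variation -/

section TotalVariation

lemma abs_integral_le_of_abs_le {X : Type*} [MeasurableSpace X] {ν : Measure X} [IsFiniteMeasure ν]
    {f : X → ℝ} {C : ℝ} (hC : ∀ x, |f x| ≤ C) : |∫ x, f x ∂ν| ≤ C * ν.real Set.univ := by
  have := norm_integral_le_of_norm_le_const (f := f) (μ := ν) (ae_of_all _ fun x => hC x)
  rwa [Real.norm_eq_abs] at this

lemma abs_integral_le_of_abs_le_prob {X : Type*} [MeasurableSpace X] {ν : Measure X}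
    [IsProbabilityMeasure ν] {f : X → ℝ} {C : ℝ} (hC : ∀ x, |f x| ≤ C) : |∫ x, f x ∂ν| ≤ C := by
  simpa using abs_integral_le_of_abs_le (ν := ν) hC

/-- Integrals of a bounded function differ by at most its bound times the total-variation distance:
the Jordan decomposition of `μ - ν` writes `μ + σ⁻ = ν + σ⁺`. -/
lemma abs_integral_sub_integral_le_tvDistance {X : Type*} [MeasurableSpace X] (μ ν : Measure X)
    [IsFiniteMeasure μ] [IsFiniteMeasure ν] {g : X → ℝ} {C : ℝ} (hg : Measurable g)
    (hC : ∀ x, |g x| ≤ C) :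
    |∫ x, g x ∂μ - ∫ x, g x ∂ν| ≤ C * tvDistance μ ν := by
  set j := (μ.toSignedMeasure - ν.toSignedMeasure).toJordanDecomposition with hj
  have h1 : j.posPart.toSignedMeasure - j.negPart.toSignedMeasure
      = μ.toSignedMeasure - ν.toSignedMeasure :=
    SignedMeasure.toSignedMeasure_toJordanDecomposition _
  have h2 : μ + j.negPart = ν + j.posPart := by
    rw [← Measure.toSignedMeasure_eq_toSignedMeasure_iff, Measure.toSignedMeasure_add,
      Measure.toSignedMeasure_add]
    rw [sub_eq_sub_iff_add_eq_add] at h1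
    rw [← h1, add_comm]
  have hi : ∀ ν' : Measure X, IsFiniteMeasure ν' → Integrable g ν' := fun ν' _ =>
    integrable_of_abs_le hg hC
  have h3 : ∫ x, g x ∂μ + ∫ x, g x ∂j.negPart = ∫ x, g x ∂ν + ∫ x, g x ∂j.posPart := by
    rw [← integral_add_measure (hi _ inferInstance) (hi _ inferInstance), h2,
      integral_add_measure (hi _ inferInstance) (hi _ inferInstance)]
  have h4 : ∫ x, g x ∂μ - ∫ x, g x ∂ν = ∫ x, g x ∂j.posPart - ∫ x, g x ∂j.negPart := by linarith
  rw [h4]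
  refine (abs_sub _ _).trans ?_
  have h5 := abs_integral_le_of_abs_le (ν := j.posPart) hC
  have h6 := abs_integral_le_of_abs_le (ν := j.negPart) hC
  have h7 : tvDistance μ ν = j.posPart.real Set.univ + j.negPart.real Set.univ := by
    rw [tvDistance, SignedMeasure.totalVariation, measureReal_add_apply]
  rw [h7, mul_add]
  exact add_le_add h5 h6

end TotalVariation

/-! ### Expectations under a fixed policy, and ergodicity -/

noncomputable section

namespace CMDP

variable {nθ ns na m : ℕ} (M : CMDP nθ ns na m)

/-- The joint law of the action and of the next state under `π_θ`, given the present state. -/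
def next (θ : RVec nθ) : Kernel M.S (M.A × M.S) := M.policy θ ⊗ₖ M.transition

instance (θ : RVec nθ) : IsMarkovKernel (M.next θ) := by unfold next; infer_instance

/-- The expectation under `π_θ` of a function `f` of (state, action, next state), given the present
state `s`. -/
def expNext (θ : RVec nθ) (f : M.S × M.A × M.S → ℝ) (s : M.S) : ℝ := ∫ y, f (s, y) ∂(M.next θ s)

/-- The transition operator of the state process under `π_θ`, acting on functions. -/
def stateOp (θ : RVec nθ) (g : M.S → ℝ) : M.S → ℝ := M.expNext θ fun z => g z.2.2

/-- The expected total of `f` over `j` transitions under `π_θ`, as a function of the first state. -/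
def val (θ : RVec nθ) (f : M.S × M.A × M.S → ℝ) : ℕ → M.S → ℝ
  | 0 => fun _ => 0
  | j + 1 => M.expNext θ fun z => f z + val θ f j z.2.2

variable {M} {θ θ' : RVec nθ} {f f' : M.S × M.A × M.S → ℝ} {g g' : M.S → ℝ} {C C' : ℝ}

lemma measurable_expNext (hf : Measurable f) : Measurable (M.expNext θ f) :=
  (StronglyMeasurable.integral_kernel_prod_right (κ := M.next θ)
    (f := fun s y => f (s, y)) hf.stronglyMeasurable).measurable

lemma integrable_next (hf : Measurable f) (hC : ∀ z, |f z| ≤ C) (s : M.S) :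
    Integrable (fun y => f (s, y)) (M.next θ s) :=
  integrable_of_abs_le (hf.comp measurable_prodMk_left) fun _ => hC _

lemma abs_expNext_le (hC : ∀ z, |f z| ≤ C) (s : M.S) : |M.expNext θ f s| ≤ C :=
  abs_integral_le_of_abs_le_prob fun _ => hC _

lemma expNext_add (hf : Measurable f) (hC : ∀ z, |f z| ≤ C) (hf' : Measurable f')
    (hC' : ∀ z, |f' z| ≤ C') (s : M.S) :
    M.expNext θ (fun z => f z + f' z) s = M.expNext θ f s + M.expNext θ f' s :=
  integral_add (integrable_next hf hC s) (integrable_next hf' hC' s)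

lemma expNext_sub (hf : Measurable f) (hC : ∀ z, |f z| ≤ C) (hf' : Measurable f')
    (hC' : ∀ z, |f' z| ≤ C') (s : M.S) :
    M.expNext θ (fun z => f z - f' z) s = M.expNext θ f s - M.expNext θ f' s :=
  integral_sub (integrable_next hf hC s) (integrable_next hf' hC' s)

lemma expNext_of_state (h : M.S → ℝ) (s : M.S) : M.expNext θ (fun z => h z.1) s = h s := by
  simp [expNext]

lemma expNext_eq (hf : Measurable f) (hC : ∀ z, |f z| ≤ C) (s : M.S) :
    M.expNext θ f s = ∫ a, ∫ s', f (s, a, s') ∂(M.transition (s, a)) ∂(M.policy θ s) :=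
  integral_compProd (integrable_next hf hC s)

lemma expNext_of_stateAction {h : M.S × M.A → ℝ} (hh : Measurable h) (hC : ∀ x, |h x| ≤ C)
    (s : M.S) : M.expNext θ (fun z => h (z.1, z.2.1)) s = ∫ a, h (s, a) ∂(M.policy θ s) := by
  rw [expNext_eq (C := C) (by fun_prop) (fun z => hC _)]
  simp

lemma measurable_transition_integral (hf : Measurable f) :
    Measurable fun x : M.S × M.A => ∫ s', f (x.1, x.2, s') ∂(M.transition x) :=
  (StronglyMeasurable.integral_kernel_prod_right (κ := M.transition)
    (f := fun (x : M.S × M.A) s' => f (x.1, x.2, s'))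
    (Measurable.stronglyMeasurable (by unfold Function.uncurry; fun_prop))).measurable

/-- The policies of `θ` and `θ'` are within `ε` of each other, as functionals on the bounded
functions of the action, uniformly over the states. -/
def PolicyClose (M : CMDP nθ ns na m) (θ θ' : RVec nθ) (ε : ℝ) : Prop :=
  ∀ (s : M.S) (q : M.A → ℝ) (C : ℝ), Measurable q → (∀ a, |q a| ≤ C) →
    |∫ a, q a ∂(M.policy θ s) - ∫ a, q a ∂(M.policy θ' s)| ≤ ε * C

lemma PolicyClose.abs_expNext_sub_le {ε : ℝ} (h : M.PolicyClose θ θ' ε) (hf : Measurable f)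
    (hC : ∀ z, |f z| ≤ C) (s : M.S) : |M.expNext θ f s - M.expNext θ' f s| ≤ ε * C := by
  rw [expNext_eq hf hC, expNext_eq hf hC]
  exact h s _ C ((measurable_transition_integral hf).comp measurable_prodMk_left)
    fun a => abs_integral_le_of_abs_le_prob fun _ => hC _

lemma measurable_stateOp (hg : Measurable g) : Measurable (M.stateOp θ g) :=
  measurable_expNext (by fun_prop)

lemma measurable_stateOp_iterate (hg : Measurable g) (j : ℕ) :
    Measurable ((M.stateOp θ)^[j] g) := by
  induction j with
  | zero => exact hg
  | succ j ih => rw [Function.iterate_succ_apply']; exact measurable_stateOp ih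

lemma abs_stateOp_le (hC : ∀ s, |g s| ≤ C) (s : M.S) : |M.stateOp θ g s| ≤ C :=
  abs_expNext_le (fun _ => hC _) s

lemma abs_stateOp_iterate_le (hC : ∀ s, |g s| ≤ C) (j : ℕ) (s : M.S) :
    |(M.stateOp θ)^[j] g s| ≤ C := by
  induction j generalizing s with
  | zero => exact hC s
  | succ j ih => rw [Function.iterate_succ_apply']; exact abs_stateOp_le ih s

lemma stateOp_sub (hg : Measurable g) (hC : ∀ s, |g s| ≤ C) (hg' : Measurable g')
    (hC' : ∀ s, |g' s| ≤ C') :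
    M.stateOp θ (fun s => g s - g' s) = fun s => M.stateOp θ g s - M.stateOp θ g' s :=
  funext fun s => expNext_sub (by fun_prop) (fun _ => hC _) (by fun_prop) (fun _ => hC' _) s

lemma stateOp_iterate_sub (hg : Measurable g) (hC : ∀ s, |g s| ≤ C) (hg' : Measurable g')
    (hC' : ∀ s, |g' s| ≤ C') (j : ℕ) :
    (M.stateOp θ)^[j] (fun s => g s - g' s)
      = fun s => (M.stateOp θ)^[j] g s - (M.stateOp θ)^[j] g' s := by
  induction j with
  | zero => rfl
  | succ j ih =>
    simp only [Function.iterate_succ_apply']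
    rw [ih, stateOp_sub (measurable_stateOp_iterate hg j) (abs_stateOp_iterate_le hC j)
      (measurable_stateOp_iterate hg' j) (abs_stateOp_iterate_le hC' j)]

lemma stateOp_iterate_const (c : ℝ) (j : ℕ) :
    (M.stateOp θ)^[j] (fun _ => c) = fun _ => c := by
  induction j with
  | zero => rfl
  | succ j ih =>
    rw [Function.iterate_succ_apply', ih]
    funext s
    exact expNext_of_state (fun _ => c) s

lemma integral_step {ν : Measure M.S} [IsProbabilityMeasure ν] (hg : Measurable g)
    (hC : ∀ s, |g s| ≤ C) : ∫ s, g s ∂(M.step θ ν) = ∫ s, M.stateOp θ g s ∂ν := by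
  have h1 : M.step θ ν = ((ν ⊗ₘ M.policy θ) ⊗ₘ M.transition).map Prod.snd := by
    rw [step, ← Measure.snd_compProd]; rfl
  rw [h1, integral_map measurable_snd.aemeasurable hg.aestronglyMeasurable,
    Measure.integral_compProd (f := fun x => g x.2)
      (integrable_of_abs_le (hg.comp measurable_snd) fun _ => hC _),
    Measure.integral_compProd]
  · refine integral_congr_ae (ae_of_all _ fun s => ?_)
    rw [stateOp, expNext_eq (C := C) (by fun_prop) (fun _ => hC _)]
  · exact integrable_of_abs_le (C := C)
      (measurable_transition_integral (M := M) (f := fun z => g z.2.2) (by fun_prop))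
      fun x => abs_integral_le_of_abs_le_prob fun _ => hC _

lemma integral_stateLaw {ν : Measure M.S} [IsProbabilityMeasure ν] (hg : Measurable g)
    (hC : ∀ s, |g s| ≤ C) (j : ℕ) :
    ∫ s, g s ∂(M.stateLaw θ ν j) = ∫ s, (M.stateOp θ)^[j] g s ∂ν := by
  induction j generalizing g with
  | zero => rfl
  | succ j ih =>
    rw [Function.iterate_succ_apply, ← ih (measurable_stateOp hg) (abs_stateOp_le hC)]
    exact integral_step hg hC

lemma measurable_val (hf : Measurable f) (j : ℕ) : Measurable (M.val θ f j) := by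
  induction j with
  | zero => exact measurable_const
  | succ j ih => exact measurable_expNext (by fun_prop)

lemma abs_val_le (hC : ∀ z, |f z| ≤ C) (j : ℕ) (s : M.S) : |M.val θ f j s| ≤ j * C := by
  induction j generalizing s with
  | zero => simp [val]
  | succ j ih =>
    refine abs_expNext_le (fun z => ?_) s
    refine (abs_add_le _ _).trans ?_
    push_cast
    linarith [hC z, ih z.2.2]

lemma val_succ (hf : Measurable f) (hC : ∀ z, |f z| ≤ C) (j : ℕ) (s : M.S) :
    M.val θ f (j + 1) s = M.expNext θ f s + M.stateOp θ (M.val θ f j) s :=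
  expNext_add hf hC ((measurable_val hf j).comp (by fun_prop)) (fun _ => abs_val_le hC j _) s

lemma val_eq_sum (hf : Measurable f) (hC : ∀ z, |f z| ≤ C) (j : ℕ) (s : M.S) :
    M.val θ f j s = ∑ i ∈ Finset.range j, (M.stateOp θ)^[i] (M.expNext θ f) s := by
  have hE : ∀ s, |M.expNext θ f s| ≤ C := abs_expNext_le hC
  have hmE : Measurable (M.expNext θ f) := measurable_expNext hf
  have hlin : ∀ j s, M.stateOp θ (fun s => ∑ i ∈ Finset.range j,
      (M.stateOp θ)^[i] (M.expNext θ f) s) s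
      = ∑ i ∈ Finset.range j, (M.stateOp θ)^[i + 1] (M.expNext θ f) s := by
    intro j s
    simp only [Function.iterate_succ_apply']
    exact integral_finsetSum _ fun i _ => integrable_next
      (f := fun z => (M.stateOp θ)^[i] (M.expNext θ f) z.2.2)
      ((measurable_stateOp_iterate hmE i).comp (by fun_prop))
      (fun _ => abs_stateOp_iterate_le hE i _) s
  induction j generalizing s with
  | zero => rfl
  | succ j ih =>
    rw [val_succ hf hC, funext ih, hlin, Finset.sum_range_succ', add_comm]
    rfl

/-- `P` is the limit law of the state process under `π_θ`, approached at the rate `mc * ρ ^ t` from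
every initial state, in the sense of expectations of bounded functions. It is in particular the
stationary law. -/
structure ErgodicLaw (M : CMDP nθ ns na m) (θ : RVec nθ) (P : Measure M.S) (mc ρ : ℝ) : Prop where
  prob : IsProbabilityMeasure P
  mc_pos : 0 < mc
  ρ_pos : 0 < ρ
  ρ_lt_one : ρ < 1
  mixing : ∀ (g : M.S → ℝ) (C : ℝ), Measurable g → (∀ s, |g s| ≤ C) → ∀ (j : ℕ) (s : M.S),
    |(M.stateOp θ)^[j] g s - ∫ s, g s ∂P| ≤ mc * ρ ^ j * C

lemma ProblemAssumptions.exists_ergodicLaw (hM : M.ProblemAssumptions) :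
    ∃ mc ρ : ℝ, 0 < mc ∧ 0 < ρ ∧ ρ < 1 ∧ ∀ θ ∈ M.Θ, ∃ P, M.ErgodicLaw θ P mc ρ := by
  obtain ⟨mc, hmc, ρ, hρ, h⟩ := hM.ergodic
  refine ⟨mc, ρ, hmc, hρ.1, hρ.2, fun θ hθ => ?_⟩
  obtain ⟨P, hP, -, hmix⟩ := h θ hθ
  refine ⟨P, hP, hmc, hρ.1, hρ.2, fun g C hg hC j s => ?_⟩
  have hC0 : 0 ≤ C := (abs_nonneg _).trans (hC s)
  have h1 := abs_integral_sub_integral_le_tvDistance (M.stateLaw θ (Measure.dirac s) j) P hg hC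
  rw [integral_stateLaw hg hC,
    integral_dirac' _ _ (measurable_stateOp_iterate hg j).stronglyMeasurable] at h1
  refine h1.trans ?_
  rw [mul_comm]
  exact mul_le_mul_of_nonneg_right (hmix s j) hC0

namespace ErgodicLaw

variable {P : Measure M.S} {mc ρ : ℝ}

/-- Expected totals grow at the rate of the stationary mean, up to a bounded error. -/
lemma abs_val_sub_le (h : M.ErgodicLaw θ P mc ρ) (hf : Measurable f) (hC : ∀ z, |f z| ≤ C)
    (j : ℕ) (s : M.S) :
    |M.val θ f j s - j * ∫ s, M.expNext θ f s ∂P| ≤ mc / (1 - ρ) * C := by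
  have hC0 : 0 ≤ C := by
    have := M.prob_init
    obtain ⟨a⟩ : Nonempty M.A := nonempty_of_isProbabilityMeasure (M.policy θ s)
    exact (abs_nonneg _).trans (hC (s, a, s))
  rw [val_eq_sum hf hC]
  have h1 : ∑ i ∈ Finset.range j, (M.stateOp θ)^[i] (M.expNext θ f) s
      - j * ∫ s, M.expNext θ f s ∂P = ∑ i ∈ Finset.range j,
        ((M.stateOp θ)^[i] (M.expNext θ f) s - ∫ s, M.expNext θ f s ∂P) := by
    simp [Finset.sum_sub_distrib]
  rw [h1]
  have h2 : ∑ i ∈ Finset.range j, ρ ^ i ≤ (1 - ρ)⁻¹ := by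
    rw [← tsum_geometric_of_lt_one h.ρ_pos.le h.ρ_lt_one]
    exact (summable_geometric_of_lt_one h.ρ_pos.le h.ρ_lt_one).sum_le_tsum _
      fun _ _ => pow_nonneg h.ρ_pos.le _
  calc _ ≤ ∑ i ∈ Finset.range j, |(M.stateOp θ)^[i] (M.expNext θ f) s
          - ∫ s, M.expNext θ f s ∂P| := Finset.abs_sum_le_sum_abs _ _
    _ ≤ ∑ i ∈ Finset.range j, mc * ρ ^ i * C := Finset.sum_le_sum fun i _ =>
        h.mixing _ C (measurable_expNext hf) (abs_expNext_le hC) i s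
    _ = mc * C * ∑ i ∈ Finset.range j, ρ ^ i := by
        rw [Finset.mul_sum]; exact Finset.sum_congr rfl fun i _ => by ring
    _ ≤ mc * C * (1 - ρ)⁻¹ := mul_le_mul_of_nonneg_left h2 (mul_nonneg h.mc_pos.le hC0)
    _ = _ := by ring

lemma tendsto_integral_stateOp_iterate (h : M.ErgodicLaw θ P mc ρ) {ν : Measure M.S}
    [IsProbabilityMeasure ν] (hg : Measurable g) (hC : ∀ s, |g s| ≤ C) :
    Tendsto (fun j => ∫ s, (M.stateOp θ)^[j] g s ∂ν) atTop (𝓝 (∫ s, g s ∂P)) := by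
  rw [tendsto_iff_norm_sub_tendsto_zero]
  have hlim : Tendsto (fun j : ℕ => mc * ρ ^ j * C) atTop (𝓝 0) := by
    have := ((tendsto_pow_atTop_nhds_zero_of_lt_one h.ρ_pos.le h.ρ_lt_one).const_mul mc).mul_const C
    simpa using this
  refine squeeze_zero (fun _ => norm_nonneg _) (fun j => ?_) hlim
  have h1 : ∫ s, (M.stateOp θ)^[j] g s ∂ν - ∫ s, g s ∂P
      = ∫ s, ((M.stateOp θ)^[j] g s - ∫ s, g s ∂P) ∂ν := by
    rw [integral_sub (integrable_of_abs_le (measurable_stateOp_iterate hg j)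
      (abs_stateOp_iterate_le hC j)) (integrable_const _)]
    simp
  rw [h1]
  exact abs_integral_le_of_abs_le_prob fun s => h.mixing g C hg hC j s

end ErgodicLaw

/-- The shifted cost `C'_i`, as a function of (state, action, next state). -/
def costFn (M : CMDP nθ ns na m) (i : Fin (m + 1)) (z : M.S × M.A × M.S) : ℝ :=
  M.cost' i (z.1, z.2.1)

lemma measurable_cost' (i : Fin (m + 1)) : Measurable (M.cost' i) :=
  (M.measurable_cost i).sub_const _

lemma measurable_costFn (i : Fin (m + 1)) : Measurable (M.costFn i) :=
  (measurable_cost' i).comp (by fun_prop)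

lemma ProblemAssumptions.exists_cost'_bound (hM : M.ProblemAssumptions) :
    ∃ B, 0 ≤ B ∧ ∀ i x, |M.cost' i x| ≤ B := by
  obtain ⟨B, hB⟩ := hM.bounded_cost
  refine ⟨|B| + ∑ i, |(Fin.cons 0 M.limit : Fin (m + 1) → ℝ) i|, by positivity, fun i x => ?_⟩
  refine (abs_sub _ _).trans (add_le_add ((hB i x).trans (le_abs_self B)) ?_)
  exact Finset.single_le_sum (f := fun i => |(Fin.cons 0 M.limit : Fin (m + 1) → ℝ) i|)
    (fun _ _ => abs_nonneg _) (Finset.mem_univ i)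

/-- The long-run average cost is the limit of the expected costs per step, if that exists. -/
lemma J_eq_of_tendsto {i : Fin (m + 1)} {B c : ℝ} (hB : ∀ x, |M.cost' i x| ≤ B)
    (h : Tendsto (fun j => ∫ s, (M.stateOp θ)^[j] (M.expNext θ (M.costFn i)) s ∂M.init)
      atTop (𝓝 c)) : M.J i θ = c := by
  refine Tendsto.limUnder_eq (h.cesaro.congr fun L => ?_)
  rw [avgCost, one_div]
  congr 1
  refine Finset.sum_congr rfl fun l _ => ?_
  have hE : M.expNext θ (M.costFn i) = fun s => ∫ a, M.cost' i (s, a) ∂(M.policy θ s) :=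
    funext fun s => expNext_of_stateAction (measurable_cost' i) hB s
  rw [Measure.integral_compProd (integrable_of_abs_le (measurable_cost' i) hB),
    ← integral_stateLaw (C := B) (measurable_expNext (measurable_costFn i))
      (abs_expNext_le fun _ => hB _), hE]

lemma ErgodicLaw.J_eq {P : Measure M.S} {mc ρ : ℝ} (h : M.ErgodicLaw θ P mc ρ) {i : Fin (m + 1)}
    {B : ℝ} (hB : ∀ x, |M.cost' i x| ≤ B) :
    M.J i θ = ∫ s, M.expNext θ (M.costFn i) s ∂P :=
  J_eq_of_tendsto hB (h.tendsto_integral_stateOp_iterate (C := B)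
    (measurable_expNext (measurable_costFn i)) (abs_expNext_le fun _ => hB _))

end CMDP

end

/-! ### Densities and scores -/

lemma abs_exp_sub_one_le_mul_exp (y : ℝ) : |Real.exp y - 1| ≤ |y| * Real.exp |y| := by
  rcases le_total 0 y with hy | hy
  · rw [abs_of_nonneg hy, abs_of_nonneg (by linarith [Real.add_one_le_exp y])]
    have h1 := Real.add_one_le_exp (-y)
    have h2 : Real.exp (-y) * Real.exp y = 1 := by rw [← Real.exp_add]; simp
    nlinarith [Real.exp_pos y]
  · rw [abs_of_nonpos hy, abs_of_nonpos (by linarith [Real.exp_le_one_iff.2 hy])]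
    have h1 := Real.add_one_le_exp y
    have h2 : 1 ≤ Real.exp (-y) := Real.one_le_exp (by linarith)
    nlinarith

namespace CMDP

variable {nθ ns na m : ℕ} {M : CMDP nθ ns na m} {θ θ₀ : RVec nθ}

section Density

lemma measurable_dens_right (hθ : θ ∈ M.dom) (s : M.S) : Measurable (M.dens θ s) :=
  (M.measurable_dens θ hθ).comp measurable_prodMk_left

lemma integral_policy_eq (hθ : θ ∈ M.dom) (s : M.S) (q : M.A → ℝ) :
    ∫ a, q a ∂(M.policy θ s) = ∫ a, M.dens θ s a * q a ∂M.refMeasure := by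
  rw [M.policy_eq θ hθ, integral_withDensity_eq_integral_toReal_smul
    (measurable_dens_right hθ s).ennreal_ofReal (ae_of_all _ fun _ => ENNReal.ofReal_lt_top)]
  simp [ENNReal.toReal_ofReal (M.dens_pos θ hθ s _).le]

lemma integrable_dens (hθ : θ ∈ M.dom) (s : M.S) : Integrable (M.dens θ s) M.refMeasure := by
  refine ⟨(measurable_dens_right hθ s).aestronglyMeasurable, ?_⟩
  rw [hasFiniteIntegral_iff_ofReal (ae_of_all _ fun a => (M.dens_pos θ hθ s a).le)]
  have h := M.policy_eq θ hθ s
  have h1 : M.policy θ s Set.univ = 1 := measure_univ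
  rw [h, withDensity_apply _ MeasurableSet.univ, Measure.restrict_univ] at h1
  rw [h1]
  exact ENNReal.one_lt_top

lemma integral_dens (hθ : θ ∈ M.dom) (s : M.S) : ∫ a, M.dens θ s a ∂M.refMeasure = 1 := by
  have := integral_policy_eq hθ s (fun _ => 1)
  simpa using this.symm

lemma integrable_dens_mul (hθ : θ ∈ M.dom) (s : M.S) {q : M.A → ℝ} {C : ℝ} (hq : Measurable q)
    (hC : ∀ a, |q a| ≤ C) : Integrable (fun a => M.dens θ s a * q a) M.refMeasure :=
  (integrable_dens hθ s).mul_bdd (c := C) hq.aestronglyMeasurable (ae_of_all _ hC)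

lemma differentiableAt_log_dens (hθ : θ ∈ M.dom) (s : M.S) (a : M.A) :
    DifferentiableAt ℝ (fun θ' => Real.log (M.dens θ' s a)) θ :=
  (M.differentiable_dens θ hθ s a).log (M.dens_pos θ hθ s a).ne'

/-- A bounded score makes the log-density Lipschitz near a parameter, so the densities of nearby
parameters agree up to a factor close to one. -/
lemma abs_dens_sub_le {B r : ℝ} (hB : ∀ θ ∈ M.dom, ∀ x, ‖M.score θ x‖ ≤ B)
    (hr : Metric.ball θ₀ r ⊆ M.dom) (hθ : θ ∈ Metric.ball θ₀ r) (s : M.S) (a : M.A) :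
    |M.dens θ s a - M.dens θ₀ s a| ≤
      M.dens θ₀ s a * (B * ‖θ - θ₀‖ * Real.exp (B * ‖θ - θ₀‖)) := by
  have hθ₀ : θ₀ ∈ Metric.ball θ₀ r := Metric.mem_ball_self (Metric.pos_of_mem_ball hθ)
  have hlog : |Real.log (M.dens θ s a) - Real.log (M.dens θ₀ s a)| ≤ B * ‖θ - θ₀‖ := by
    refine (convex_ball θ₀ r).norm_image_sub_le_of_norm_fderiv_le (𝕜 := ℝ)
      (f := fun θ' => Real.log (M.dens θ' s a))
      (fun θ' h' => differentiableAt_log_dens (hr h') s a) (fun θ' h' => ?_) hθ₀ hθ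
    have := hB θ' (hr h') (s, a)
    rwa [score, gradient, LinearIsometryEquiv.norm_map] at this
  have hp := M.dens_pos θ (hr hθ) s a
  have hp₀ := M.dens_pos θ₀ (hr hθ₀) s a
  set y := Real.log (M.dens θ s a) - Real.log (M.dens θ₀ s a) with hy
  have h1 : M.dens θ s a - M.dens θ₀ s a = M.dens θ₀ s a * (Real.exp y - 1) := by
    rw [hy, Real.exp_sub, Real.exp_log hp, Real.exp_log hp₀]
    field_simp
  rw [h1, abs_mul, abs_of_pos hp₀]
  refine mul_le_mul_of_nonneg_left ((abs_exp_sub_one_le_mul_exp y).trans ?_) hp₀.le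
  exact mul_le_mul hlog (Real.exp_le_exp.2 hlog) (Real.exp_pos _).le
    ((abs_nonneg _).trans hlog)

lemma policyClose_of_mem_ball {B r : ℝ} (hB : ∀ θ ∈ M.dom, ∀ x, ‖M.score θ x‖ ≤ B)
    (hr : Metric.ball θ₀ r ⊆ M.dom) (hθ : θ ∈ Metric.ball θ₀ r) :
    M.PolicyClose θ θ₀ (B * ‖θ - θ₀‖ * Real.exp (B * ‖θ - θ₀‖)) := by
  intro s q C hq hC
  have hθ₀ : θ₀ ∈ Metric.ball θ₀ r := Metric.mem_ball_self (Metric.pos_of_mem_ball hθ)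
  rw [integral_policy_eq (hr hθ), integral_policy_eq (hr hθ₀),
    ← integral_sub (integrable_dens_mul (hr hθ) s hq hC) (integrable_dens_mul (hr hθ₀) s hq hC)]
  set e := B * ‖θ - θ₀‖ * Real.exp (B * ‖θ - θ₀‖)
  have h1 : ∀ a, ‖M.dens θ s a * q a - M.dens θ₀ s a * q a‖ ≤ M.dens θ₀ s a * (e * C) := by
    intro a
    rw [← sub_mul, norm_mul, ← mul_assoc]
    have := abs_dens_sub_le hB hr hθ s a
    exact mul_le_mul this (hC a) (norm_nonneg _) ((abs_nonneg _).trans this)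
  have h2 := norm_integral_le_of_norm_le ((integrable_dens (hr hθ₀) s).mul_const (e * C))
    (ae_of_all _ h1)
  rwa [integral_mul_const, integral_dens (hr hθ₀), one_mul] at h2

/-- The log-derivative trick along a direction. -/
lemma hasDerivAt_dens (hθ : θ ∈ M.dom) (v : RVec nθ) (s : M.S) (a : M.A) :
    HasDerivAt (fun h : ℝ => M.dens (θ + h • v) s a)
      (M.dens θ s a * inner ℝ (M.score θ (s, a)) v) 0 := by
  have hline : HasDerivAt (fun h : ℝ => θ + h • v) v 0 := by
    simpa using ((hasDerivAt_id (0 : ℝ)).smul_const v).const_add θ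
  have hd := (M.differentiable_dens θ hθ s a)
  have h1 : HasDerivAt (fun h : ℝ => M.dens (θ + h • v) s a)
      (fderiv ℝ (fun θ' => M.dens θ' s a) θ v) 0 := by
    have hf : HasFDerivAt (fun θ' => M.dens θ' s a) (fderiv ℝ (fun θ' => M.dens θ' s a) θ)
        (θ + (0 : ℝ) • v) := by simpa using hd.hasFDerivAt
    exact hf.comp_hasDerivAt (0 : ℝ) hline
  have h2 : fderiv ℝ (fun θ' => M.dens θ' s a) θ v
      = M.dens θ s a * inner ℝ (M.score θ (s, a)) v := by
    have hp := (M.dens_pos θ hθ s a).ne'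
    rw [score, inner_gradient_left, fderiv.log hd hp]
    simp [hp]
  rwa [h2] at h1

lemma eventually_add_smul_mem {U : Set (RVec nθ)} (hU : IsOpen U) (hθ : θ ∈ U) (v : RVec nθ) :
    ∀ᶠ h : ℝ in 𝓝[>] 0, θ + h • v ∈ U := by
  have hc : ContinuousAt (fun h : ℝ => θ + h • v) 0 := by fun_prop
  refine (hc.eventually ?_).filter_mono nhdsWithin_le_nhds
  simpa using hU.mem_nhds hθ

/-- The score is a pointwise limit of difference quotients of the density, which are measurable. -/
lemma measurable_inner_score (hθ : θ ∈ M.dom) (v : RVec nθ) :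
    Measurable fun x : M.S × M.A => inner ℝ (M.score θ x) v := by
  classical
  refine measurable_of_tendsto_metrizable' (𝓝[>] (0 : ℝ)) (f := fun h x =>
    if θ + h • v ∈ M.dom then
      (h⁻¹ * (M.dens (θ + h • v) x.1 x.2 - M.dens θ x.1 x.2)) / M.dens θ x.1 x.2 else 0)
    (fun h => ?_) (tendsto_pi_nhds.2 fun x => ?_)
  · by_cases hh : θ + h • v ∈ M.dom
    · simp only [hh, if_true]
      exact (((M.measurable_dens _ hh).sub (M.measurable_dens θ hθ)).const_mul _).div
        (M.measurable_dens θ hθ)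
    · simp only [hh, if_false]; exact measurable_const
  · have hp := (M.dens_pos θ hθ x.1 x.2).ne'
    have h1 := ((hasDerivAt_dens hθ v x.1 x.2).tendsto_slope_zero_right).div_const
      (M.dens θ x.1 x.2)
    rw [mul_div_cancel_left₀ _ hp] at h1
    refine h1.congr' ?_
    filter_upwards [eventually_add_smul_mem M.isOpen_dom hθ v] with h hh
    simp [hh]

lemma abs_inner_score_le {B : ℝ} (hB : ∀ θ ∈ M.dom, ∀ x, ‖M.score θ x‖ ≤ B) (hθ : θ ∈ M.dom)
    (v : RVec nθ) (x : M.S × M.A) : |inner ℝ (M.score θ x) v| ≤ B * ‖v‖ :=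
  (abs_real_inner_le_norm _ _).trans (mul_le_mul_of_nonneg_right (hB θ hθ x) (norm_nonneg _))

/-- Differentiation of an expected value under the policy, by dominated convergence. -/
lemma tendsto_slope_integral_policy {B : ℝ} (hB : ∀ θ ∈ M.dom, ∀ x, ‖M.score θ x‖ ≤ B)
    (hθ : θ ∈ M.dom) (v : RVec nθ) (s : M.S) {q : M.A → ℝ} {C : ℝ} (hq : Measurable q)
    (hC : ∀ a, |q a| ≤ C) :
    Tendsto (fun h : ℝ => h⁻¹ * (∫ a, q a ∂(M.policy (θ + h • v) s) - ∫ a, q a ∂(M.policy θ s)))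
      (𝓝[>] 0) (𝓝 (∫ a, inner ℝ (M.score θ (s, a)) v * q a ∂(M.policy θ s))) := by
  obtain ⟨r, hr0, hr⟩ := Metric.isOpen_iff.1 M.isOpen_dom θ hθ
  have hball : ∀ᶠ h : ℝ in 𝓝[>] 0, θ + h • v ∈ Metric.ball θ r :=
    eventually_add_smul_mem Metric.isOpen_ball (Metric.mem_ball_self hr0) v
  have hpos : ∀ᶠ h : ℝ in 𝓝[>] 0, 0 < h ∧ h ≤ 1 := by
    filter_upwards [Ioo_mem_nhdsGT (zero_lt_one (α := ℝ))] with h hh using ⟨hh.1, hh.2.le⟩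
  have hB0 : ∀ a, 0 ≤ B := fun a => (norm_nonneg _).trans (hB θ hθ (s, a))
  have hlim := tendsto_integral_filter_of_dominated_convergence (μ := M.refMeasure)
    (l := 𝓝[>] (0 : ℝ))
    (F := fun h a => h⁻¹ * (M.dens (θ + h • v) s a * q a - M.dens θ s a * q a))
    (f := fun a => M.dens θ s a * (inner ℝ (M.score θ (s, a)) v * q a))
    (fun a => M.dens θ s a * (B * ‖v‖ * Real.exp (B * ‖v‖) * C)) ?_ ?_
    ((integrable_dens hθ s).mul_const _) (ae_of_all _ fun a => ?_)
  · rw [integral_policy_eq hθ s fun a => inner ℝ (M.score θ (s, a)) v * q a]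
    refine hlim.congr' ?_
    filter_upwards [hball] with h hh
    rw [integral_const_mul, integral_sub (integrable_dens_mul (hr hh) s hq hC)
      (integrable_dens_mul hθ s hq hC), integral_policy_eq (hr hh), integral_policy_eq hθ]
  · filter_upwards [hball] with h hh
    exact ((((measurable_dens_right (hr hh) s).mul hq).sub
      ((measurable_dens_right hθ s).mul hq)).const_mul _).aestronglyMeasurable
  · filter_upwards [hball, hpos] with h hh hh0
    refine ae_of_all _ fun a => ?_
    have h1 := abs_dens_sub_le hB hr hh s a
    have e1 : ‖θ + h • v - θ‖ = h * ‖v‖ := by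
      rw [add_sub_cancel_left, norm_smul, Real.norm_of_nonneg hh0.1.le]
    rw [e1] at h1
    have h2 : B * (h * ‖v‖) * Real.exp (B * (h * ‖v‖)) ≤
        h * (B * ‖v‖ * Real.exp (B * ‖v‖)) := by
      have h3 : B * (h * ‖v‖) ≤ B * ‖v‖ :=
        mul_le_mul_of_nonneg_left (mul_le_of_le_one_left (norm_nonneg v) hh0.2) (hB0 a)
      calc _ ≤ B * (h * ‖v‖) * Real.exp (B * ‖v‖) :=
            mul_le_mul_of_nonneg_left (Real.exp_le_exp.2 h3)
              (mul_nonneg (hB0 a) (mul_nonneg hh0.1.le (norm_nonneg v)))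
        _ = _ := by ring
    have hp := (M.dens_pos θ hθ s a).le
    rw [← sub_mul, norm_mul, norm_mul, Real.norm_of_nonneg (inv_pos.2 hh0.1).le]
    calc h⁻¹ * (‖M.dens (θ + h • v) s a - M.dens θ s a‖ * ‖q a‖)
        ≤ h⁻¹ * (M.dens θ s a * (h * (B * ‖v‖ * Real.exp (B * ‖v‖))) * C) := by
          refine mul_le_mul_of_nonneg_left ?_ (inv_pos.2 hh0.1).le
          refine mul_le_mul (h1.trans (mul_le_mul_of_nonneg_left h2 hp)) (hC a) (norm_nonneg _) ?_
          exact (abs_nonneg _).trans (h1.trans (mul_le_mul_of_nonneg_left h2 hp))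
      _ = _ := by field_simp [hh0.1.ne']
  · have h1 := ((hasDerivAt_dens hθ v s a).tendsto_slope_zero_right).mul_const (q a)
    rw [mul_assoc] at h1
    refine h1.congr fun h => ?_
    simp only [zero_add, zero_smul, add_zero, smul_eq_mul]
    ring

/-- The score has mean zero under its own policy. -/
lemma integral_inner_score {B : ℝ} (hB : ∀ θ ∈ M.dom, ∀ x, ‖M.score θ x‖ ≤ B)
    (hθ : θ ∈ M.dom) (v : RVec nθ) (s : M.S) :
    ∫ a, inner ℝ (M.score θ (s, a)) v ∂(M.policy θ s) = 0 := by
  have h1 := tendsto_slope_integral_policy hB hθ v s (q := fun _ => 1) (C := 1) measurable_const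
    (by simp)
  simp only [integral_const, probReal_univ, mul_one, sub_self, mul_zero] at h1
  exact tendsto_nhds_unique h1 tendsto_const_nhds

end Density

/-! ### Perturbation of an ergodic policy -/

section Perturbation

variable {ε mc ρ C : ℝ} {P : Measure M.S} {g : M.S → ℝ}

lemma PolicyClose.abs_iterate_sub_le (h : M.PolicyClose θ θ₀ ε) (hg : Measurable g)
    (hC : ∀ s, |g s| ≤ C) (n : ℕ) (s : M.S) :
    |(M.stateOp θ)^[n] g s - (M.stateOp θ₀)^[n] g s| ≤ n * ε * C := by
  induction n generalizing s with
  | zero => simp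
  | succ n ih =>
    simp only [Function.iterate_succ_apply']
    have hm := measurable_stateOp_iterate (M := M) (θ := θ) hg n
    have hm₀ := measurable_stateOp_iterate (M := M) (θ := θ₀) hg n
    have hb := abs_stateOp_iterate_le (M := M) (θ := θ) hC n
    have hb₀ := abs_stateOp_iterate_le (M := M) (θ := θ₀) hC n
    have h1 : M.stateOp θ ((M.stateOp θ)^[n] g) s - M.stateOp θ ((M.stateOp θ₀)^[n] g) s
        = M.stateOp θ (fun s => (M.stateOp θ)^[n] g s - (M.stateOp θ₀)^[n] g s) s := by
      rw [stateOp_sub hm hb hm₀ hb₀]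
    have h2 := abs_stateOp_le (θ := θ) ih s
    have h3 : |M.stateOp θ ((M.stateOp θ₀)^[n] g) s - M.stateOp θ₀ ((M.stateOp θ₀)^[n] g) s|
        ≤ ε * C :=
      h.abs_expNext_sub_le (f := fun z => (M.stateOp θ₀)^[n] g z.2.2)
        (hm₀.comp (by fun_prop)) (fun _ => hb₀ _) s
    rw [← h1] at h2
    have h4 := abs_sub_le (M.stateOp θ ((M.stateOp θ)^[n] g) s)
      (M.stateOp θ ((M.stateOp θ₀)^[n] g) s) (M.stateOp θ₀ ((M.stateOp θ₀)^[n] g) s)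
    push_cast
    linarith

/-- Uniform closeness to a constant is preserved by further steps. -/
lemma abs_stateOp_iterate_sub_const_le (hg : Measurable g) (hC : ∀ s, |g s| ≤ C) {n j : ℕ}
    {c e : ℝ} (h : ∀ s, |(M.stateOp θ)^[n] g s - c| ≤ e) (hj : n ≤ j) (s : M.S) :
    |(M.stateOp θ)^[j] g s - c| ≤ e := by
  obtain ⟨k, rfl⟩ := Nat.exists_eq_add_of_le hj
  have h1 := stateOp_iterate_sub (θ := θ) (measurable_stateOp_iterate (θ := θ) hg n)
    (abs_stateOp_iterate_le (θ := θ) hC n) (g' := fun _ => c) (C' := |c|) measurable_const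
    (fun _ => le_rfl) k
  rw [stateOp_iterate_const, ← Function.iterate_add_apply, add_comm k] at h1
  rw [← congrFun h1 s]
  exact abs_stateOp_iterate_le h k s

/-- Near a parameter with an ergodic law, finitely many steps of the state process contract the
oscillation of every bounded function by one half; hence expectations converge, to a limit close to
the stationary expectation. -/
lemma ErgodicLaw.exists_tendsto_of_policyClose (hP : M.ErgodicLaw θ₀ P mc ρ)
    (h : M.PolicyClose θ θ₀ ε) {n : ℕ} (hn : n * ε + mc * ρ ^ n ≤ 1 / 2) (hg : Measurable g)
    (hC : ∀ s, |g s| ≤ C) :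
    ∃ L, Tendsto (fun j => ∫ s, (M.stateOp θ)^[j] g s ∂M.init) atTop (𝓝 L) ∧
      ∀ n' : ℕ, |L - ∫ s, g s ∂P| ≤ (n' * ε + mc * ρ ^ n') * C := by
  have := hP.prob
  obtain ⟨s₀⟩ : Nonempty M.S := nonempty_of_isProbabilityMeasure P
  have hC0 : 0 ≤ C := (abs_nonneg _).trans (hC s₀)
  -- one block of `n'` steps
  have block : ∀ (n' : ℕ) (g : M.S → ℝ) (C : ℝ), Measurable g → (∀ s, |g s| ≤ C) → ∀ s,
      |(M.stateOp θ)^[n'] g s - ∫ s, g s ∂P| ≤ (n' * ε + mc * ρ ^ n') * C := by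
    intro n' g C hg hC s
    have h1 := h.abs_iterate_sub_le hg hC n' s
    have h2 := hP.mixing g C hg hC n' s
    have h3 := abs_sub_le ((M.stateOp θ)^[n'] g s) ((M.stateOp θ₀)^[n'] g s) (∫ s, g s ∂P)
    linarith
  have contract : ∀ k : ℕ, ∃ c, ∀ s, |(M.stateOp θ)^[n * k] g s - c| ≤ (1 / 2) ^ k * C := by
    intro k
    induction k with
    | zero => exact ⟨0, by simpa using hC⟩
    | succ k ih =>
      obtain ⟨c, hc⟩ := ih
      set g' : M.S → ℝ := fun s => (M.stateOp θ)^[n * k] g s - c with hg'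
      have hmg' : Measurable g' := (measurable_stateOp_iterate hg _).sub_const _
      refine ⟨c + ∫ s, g' s ∂P, fun s => ?_⟩
      have h1 := block n g' _ hmg' hc s
      have h2 := stateOp_iterate_sub (θ := θ) (measurable_stateOp_iterate (θ := θ) hg (n * k))
        (abs_stateOp_iterate_le (θ := θ) hC (n * k)) (g' := fun _ => c) (C' := |c|)
        measurable_const (fun _ => le_rfl) n
      rw [stateOp_iterate_const, ← Function.iterate_add_apply,
        show n + n * k = n * (k + 1) by ring] at h2
      rw [show (M.stateOp θ)^[n] g' s = _ from congrFun h2 s] at h1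
      rw [← sub_sub]
      refine h1.trans ((mul_le_mul_of_nonneg_right hn (by positivity)).trans_eq ?_)
      rw [pow_succ]; ring
  have hint : ∀ j c, ∫ s, (M.stateOp θ)^[j] g s ∂M.init - c
      = ∫ s, ((M.stateOp θ)^[j] g s - c) ∂M.init := by
    intro j c
    rw [integral_sub (integrable_of_abs_le (measurable_stateOp_iterate hg j)
      (abs_stateOp_iterate_le hC j)) (integrable_const _)]
    simp
  have hcauchy : CauchySeq fun j => ∫ s, (M.stateOp θ)^[j] g s ∂M.init := by
    rw [Metric.cauchySeq_iff']
    intro δ hδ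
    have hlim : Tendsto (fun k : ℕ => 2 * ((1 / 2 : ℝ) ^ k * C)) atTop (𝓝 0) := by
      have := ((tendsto_pow_atTop_nhds_zero_of_lt_one (r := (1 / 2 : ℝ)) (by norm_num)
        (by norm_num)).mul_const C).const_mul 2
      simpa using this
    obtain ⟨k, hk⟩ := (hlim.eventually (gt_mem_nhds hδ)).exists
    obtain ⟨c, hc⟩ := contract k
    have hj : ∀ j ≥ n * k, |∫ s, (M.stateOp θ)^[j] g s ∂M.init - c| ≤ (1 / 2) ^ k * C := by
      intro j hj
      rw [hint]
      exact abs_integral_le_of_abs_le_prob (abs_stateOp_iterate_sub_const_le hg hC hc hj)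
    refine ⟨n * k, fun j hjk => ?_⟩
    have h1 := hj j hjk
    have h2 := hj (n * k) le_rfl
    rw [abs_sub_comm] at h2
    rw [Real.dist_eq]
    have h3 := abs_sub_le (∫ s, (M.stateOp θ)^[j] g s ∂M.init) c
      (∫ s, (M.stateOp θ)^[n * k] g s ∂M.init)
    linarith
  obtain ⟨L, hL⟩ := cauchySeq_tendsto_of_complete hcauchy
  refine ⟨L, hL, fun n' => ?_⟩
  refine le_of_tendsto (hL.sub_const _).abs ?_
  filter_upwards [eventually_ge_atTop n'] with j hj
  rw [hint]
  exact abs_integral_le_of_abs_le_prob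
    (abs_stateOp_iterate_sub_const_le hg hC (block n' g C hg hC) hj)

end Perturbation

/-! ### Relative values and the policy gradient theorem -/

section ValueFunction

variable {mc ρ B : ℝ} {P : Measure M.S} {i : Fin (m + 1)}

/-- The cost relative to its long-run average `J_i(θ)`. -/
noncomputable def relCost (M : CMDP nθ ns na m) (i : Fin (m + 1)) (θ : RVec nθ)
    (z : M.S × M.A × M.S) : ℝ :=
  M.costFn i z - M.J i θ

/-- One transition's relative cost plus the relative value of the next state over `j` further
transitions; its expectation given the state and the action is a truncated Q-value. -/
noncomputable def qFn (M : CMDP nθ ns na m) (i : Fin (m + 1)) (θ : RVec nθ) (j : ℕ)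
    (z : M.S × M.A × M.S) : ℝ :=
  M.relCost i θ z + M.val θ (M.relCost i θ) j z.2.2

lemma measurable_relCost : Measurable (M.relCost i θ) := (measurable_costFn i).sub_const _

lemma measurable_qFn (j : ℕ) : Measurable (M.qFn i θ j) :=
  measurable_relCost.add ((measurable_val measurable_relCost j).comp (by fun_prop))

namespace ErgodicLaw

lemma abs_J_le (hP : M.ErgodicLaw θ P mc ρ) (hB : ∀ x, |M.cost' i x| ≤ B) : |M.J i θ| ≤ B := by
  have := hP.prob
  rw [hP.J_eq hB]
  exact abs_integral_le_of_abs_le_prob fun s => abs_expNext_le (fun _ => hB _) s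

lemma abs_relCost_le (hP : M.ErgodicLaw θ P mc ρ) (hB : ∀ x, |M.cost' i x| ≤ B)
    (z : M.S × M.A × M.S) : |M.relCost i θ z| ≤ 2 * B := by
  have h1 := abs_sub (M.costFn i z) (M.J i θ)
  have h2 := hP.abs_J_le hB
  have h3 : |M.costFn i z| ≤ B := hB _
  unfold relCost; linarith

lemma expNext_relCost (hB : ∀ x, |M.cost' i x| ≤ B) (θ' : RVec nθ) (s : M.S) :
    M.expNext θ' (M.relCost i θ) s = M.expNext θ' (M.costFn i) s - M.J i θ := by
  have h1 := expNext_sub (θ := θ') (measurable_costFn i) (fun _ => hB _)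
    (f' := fun _ => M.J i θ) (C' := |M.J i θ|) measurable_const (fun _ => le_rfl) s
  rwa [expNext_of_state (fun _ => M.J i θ)] at h1

lemma integral_expNext_relCost (hP : M.ErgodicLaw θ P mc ρ) (hB : ∀ x, |M.cost' i x| ≤ B) :
    ∫ s, M.expNext θ (M.relCost i θ) s ∂P = 0 := by
  have := hP.prob
  simp only [expNext_relCost hB]
  rw [integral_sub (integrable_of_abs_le (C := B) (measurable_expNext (measurable_costFn i))
    (abs_expNext_le fun _ => hB _)) (integrable_const _), ← hP.J_eq hB]
  simp

lemma abs_val_relCost_le (hP : M.ErgodicLaw θ P mc ρ) (hB : ∀ x, |M.cost' i x| ≤ B) (j : ℕ)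
    (s : M.S) : |M.val θ (M.relCost i θ) j s| ≤ mc / (1 - ρ) * (2 * B) := by
  have := hP.abs_val_sub_le measurable_relCost (hP.abs_relCost_le hB) j s
  rwa [hP.integral_expNext_relCost hB, mul_zero, sub_zero] at this

lemma abs_qFn_le (hP : M.ErgodicLaw θ P mc ρ) (hB : ∀ x, |M.cost' i x| ≤ B) (j : ℕ)
    (z : M.S × M.A × M.S) : |M.qFn i θ j z| ≤ (1 + mc / (1 - ρ)) * (2 * B) := by
  have h1 := abs_add_le (M.relCost i θ z) (M.val θ (M.relCost i θ) j z.2.2)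
  have h2 := hP.abs_relCost_le hB z
  have h3 := hP.abs_val_relCost_le hB j z.2.2
  unfold qFn; linarith

/-- The relative values form a Cauchy sequence with geometric rate, since the relative cost has
stationary mean zero. -/
lemma abs_val_relCost_sub_le (hP : M.ErgodicLaw θ P mc ρ) (hB : ∀ x, |M.cost' i x| ≤ B) {n N : ℕ}
    (hnN : n ≤ N) (s : M.S) :
    |M.val θ (M.relCost i θ) N s - M.val θ (M.relCost i θ) n s|
      ≤ mc / (1 - ρ) * (2 * B) * ρ ^ n := by
  have hB0 : 0 ≤ 2 * B := by
    obtain ⟨a⟩ : Nonempty M.A := nonempty_of_isProbabilityMeasure (M.policy θ s)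
    exact (abs_nonneg _).trans (hP.abs_relCost_le hB (s, a, s))
  have h1ρ : 0 < 1 - ρ := by linarith [hP.ρ_lt_one]
  have key : |M.val θ (M.relCost i θ) N s - M.val θ (M.relCost i θ) n s|
      ≤ mc / (1 - ρ) * (2 * B) * (ρ ^ n - ρ ^ N) := by
    induction N, hnN using Nat.le_induction with
    | base => simp
    | succ N hN ih =>
      have h2 : |M.val θ (M.relCost i θ) (N + 1) s - M.val θ (M.relCost i θ) N s|
          ≤ mc * ρ ^ N * (2 * B) := by
        rw [val_eq_sum measurable_relCost (hP.abs_relCost_le hB),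
          val_eq_sum measurable_relCost (hP.abs_relCost_le hB), Finset.sum_range_succ,
          add_sub_cancel_left]
        have := hP.mixing _ (2 * B) (measurable_expNext (θ := θ) (measurable_relCost (i := i)))
          (abs_expNext_le (hP.abs_relCost_le hB)) N s
        rwa [hP.integral_expNext_relCost hB, sub_zero] at this
      have h3 := abs_sub_le (M.val θ (M.relCost i θ) (N + 1) s) (M.val θ (M.relCost i θ) N s)
        (M.val θ (M.relCost i θ) n s)
      have h4 : mc / (1 - ρ) * (2 * B) * (ρ ^ n - ρ ^ (N + 1)) =
          mc / (1 - ρ) * (2 * B) * (ρ ^ n - ρ ^ N) + mc * ρ ^ N * (2 * B) := by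
        rw [pow_succ]; field_simp; ring
      linarith
  refine key.trans (mul_le_mul_of_nonneg_left ?_ (mul_nonneg (div_nonneg hP.mc_pos.le h1ρ.le) hB0))
  linarith [pow_nonneg hP.ρ_pos.le N]

/-- Performance difference: for `θ` near `θ₀`, the difference of the long-run costs is, up to
small errors, the stationary mean under `θ₀` of the one-step gain of the policy of `θ` over that of
`θ₀`, measured by the Q-values of `θ₀`. -/
lemma abs_J_sub_J_sub_le (hP : M.ErgodicLaw θ₀ P mc ρ) {ε : ℝ} (hε : 0 ≤ ε)
    (h : M.PolicyClose θ θ₀ ε) {n₁ : ℕ} (hn₁ : n₁ * ε + mc * ρ ^ n₁ ≤ 1 / 2)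
    (hB : ∀ x, |M.cost' i x| ≤ B) (n n' : ℕ) :
    |M.J i θ - M.J i θ₀
        - ∫ s, (M.expNext θ (M.qFn i θ₀ n) s - M.expNext θ₀ (M.qFn i θ₀ n) s) ∂P|
      ≤ ε * ((1 + mc / (1 - ρ)) * (2 * B)) * (n' * ε + mc * ρ ^ n' + ρ ^ n) := by
  have := hP.prob
  set Q := (1 + mc / (1 - ρ)) * (2 * B) with hQ
  have hB0 : 0 ≤ B := (abs_nonneg _).trans (hP.abs_J_le hB)
  have h1ρ : 0 < 1 - ρ := by linarith [hP.ρ_lt_one]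
  have hmcρ : 0 ≤ mc / (1 - ρ) := div_nonneg hP.mc_pos.le h1ρ.le
  set D : ℕ → M.S → ℝ := fun n s =>
    M.expNext θ (M.qFn i θ₀ n) s - M.expNext θ₀ (M.qFn i θ₀ n) s with hD
  set U : ℕ → M.S → ℝ := M.val θ₀ (M.relCost i θ₀) with hU
  have hUm : ∀ n, Measurable (U n) := measurable_val measurable_relCost
  have hUb := hP.abs_val_relCost_le hB
  have hDm : ∀ n, Measurable (D n) := fun n =>
    (measurable_expNext (measurable_qFn n)).sub (measurable_expNext (measurable_qFn n))
  have hDb : ∀ n s, |D n s| ≤ ε * Q := fun n s =>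
    h.abs_expNext_sub_le (measurable_qFn n) (hP.abs_qFn_le hB n) s
  -- limits of expectations under `θ`
  have lim : ∀ {g : M.S → ℝ} {C : ℝ}, Measurable g → (∀ s, |g s| ≤ C) →
      ∃ L, Tendsto (fun j => ∫ s, (M.stateOp θ)^[j] g s ∂M.init) atTop (𝓝 L) ∧
      ∀ n' : ℕ, |L - ∫ s, g s ∂P| ≤ (n' * ε + mc * ρ ^ n') * C :=
    fun hg hC => hP.exists_tendsto_of_policyClose h hn₁ hg hC
  have hI : ∀ {g : M.S → ℝ} {C : ℝ}, Measurable g → (∀ s, |g s| ≤ C) → ∀ j,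
      Integrable ((M.stateOp θ)^[j] g) M.init := fun hg hC j =>
    integrable_of_abs_le (measurable_stateOp_iterate hg j) (abs_stateOp_iterate_le hC j)
  have hcm : Measurable (M.expNext θ (M.relCost i θ₀)) := measurable_expNext measurable_relCost
  have hcb : ∀ s, |M.expNext θ (M.relCost i θ₀) s| ≤ 2 * B :=
    abs_expNext_le (hP.abs_relCost_le hB)
  obtain ⟨Lc, hLc, -⟩ := lim hcm hcb
  have hJ : M.J i θ = Lc + M.J i θ₀ := by
    refine J_eq_of_tendsto hB ((hLc.add_const (M.J i θ₀)).congr fun j => ?_)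
    have h2 := stateOp_iterate_sub (θ := θ) (g := M.expNext θ (M.costFn i)) (C := B)
      (g' := fun _ => M.J i θ₀) (C' := |M.J i θ₀|) (measurable_expNext (measurable_costFn i))
      (abs_expNext_le fun _ => hB _) measurable_const (fun _ => le_rfl) j
    have h3 : M.expNext θ (M.relCost i θ₀) = fun s => M.expNext θ (M.costFn i) s - M.J i θ₀ :=
      funext fun s => expNext_relCost hB θ s
    rw [h3, h2, stateOp_iterate_const, integral_sub (hI (C := B)
      (measurable_expNext (measurable_costFn i)) (abs_expNext_le fun _ => hB _) j)
      (integrable_const _)]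
    simp
  choose L hL hLP using fun n => lim (hDm n) (hDb n)
  -- the identity `E c = D + (U (n + 1) - U n) + (U n - K U n)` behind the difference formula
  have hdec : ∀ n, M.expNext θ (M.relCost i θ₀)
      = fun s => (D n s - (U n s - U (n + 1) s)) - (M.stateOp θ (U n) s - U n s) := by
    intro n
    funext s
    have h2 : M.expNext θ (M.qFn i θ₀ n) s
        = M.expNext θ (M.relCost i θ₀) s + M.stateOp θ (U n) s :=
      expNext_add measurable_relCost (hP.abs_relCost_le hB) ((hUm n).comp (by fun_prop))
        (fun _ => hUb n _) s
    have h3 : U (n + 1) s = M.expNext θ₀ (M.qFn i θ₀ n) s := rfl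
    simp only [hD]
    rw [h2, h3]; ring
  -- the differences `U n - K U n` have limit mean zero under `θ`, so only `U (n + 1) - U n` counts
  have hLn : ∀ n, |Lc - L n| ≤ mc / (1 - ρ) * (2 * B) * ρ ^ n := by
    intro n
    have hUd : ∀ s, |U n s - U (n + 1) s| ≤ mc / (1 - ρ) * (2 * B) * ρ ^ n := fun s => by
      rw [abs_sub_comm]; exact hP.abs_val_relCost_sub_le hB n.le_succ s
    obtain ⟨LU, hLU, -⟩ := lim (hUm n) (hUb n)
    have hLU' := hLU.sub (hLU.comp (tendsto_add_atTop_nat 1))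
    rw [sub_self] at hLU'
    have hdiff := (hLc.sub (hL n)).sub hLU'
    rw [sub_zero] at hdiff
    refine le_of_tendsto hdiff.abs (Eventually.of_forall fun j => ?_)
    have m1 : Measurable fun s => U n s - U (n + 1) s := (hUm n).sub (hUm (n + 1))
    have m2 : Measurable fun s => D n s - (U n s - U (n + 1) s) := (hDm n).sub m1
    have mK : Measurable (M.stateOp θ (U n)) := measurable_stateOp (hUm n)
    have m3 : Measurable fun s => M.stateOp θ (U n) s - U n s := mK.sub (hUm n)
    have e1 : (M.stateOp θ)^[j] (M.expNext θ (M.relCost i θ₀)) = fun s =>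
        ((M.stateOp θ)^[j] (D n) s - (M.stateOp θ)^[j] (fun s => U n s - U (n + 1) s) s)
          - ((M.stateOp θ)^[j + 1] (U n) s - (M.stateOp θ)^[j] (U n) s) := by
      rw [hdec n, stateOp_iterate_sub m2
        (fun s => (abs_sub _ _).trans (add_le_add (hDb n s) (hUd s))) m3
        (fun s => (abs_sub _ _).trans (add_le_add (abs_stateOp_le (hUb n) s) (hUb n s))),
        stateOp_iterate_sub (hDm n) (hDb n) m1 hUd,
        stateOp_iterate_sub mK (abs_stateOp_le (hUb n)) (hUm n) (hUb n)]
      rfl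
    have i1 := hI (hDm n) (hDb n) j
    have i2 := hI m1 hUd j
    have i3 := hI (hUm n) (hUb n) j
    have i4 := hI (hUm n) (hUb n) (j + 1)
    have e2 : ∫ s, (M.stateOp θ)^[j] (M.expNext θ (M.relCost i θ₀)) s ∂M.init
        = (∫ s, (M.stateOp θ)^[j] (D n) s ∂M.init
          - ∫ s, (M.stateOp θ)^[j] (fun s => U n s - U (n + 1) s) s ∂M.init)
          - (∫ s, (M.stateOp θ)^[j + 1] (U n) s ∂M.init
            - ∫ s, (M.stateOp θ)^[j] (U n) s ∂M.init) := by
      rw [← integral_sub i1 i2, ← integral_sub i4 i3, e1]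
      exact integral_sub (i1.sub i2) (i4.sub i3)
    simp only [Function.comp]
    rw [e2]
    have e3 := abs_integral_le_of_abs_le_prob (ν := M.init)
      (abs_stateOp_iterate_le (θ := θ) hUd j)
    rw [← abs_neg] at e3
    refine le_trans (le_of_eq ?_) e3
    congr 1; ring
  have hLL : ∀ n N, n ≤ N → |L N - L n| ≤ ε * Q * ρ ^ n := by
    intro n N hnN
    have hq : ∀ z, |M.qFn i θ₀ N z - M.qFn i θ₀ n z| ≤ mc / (1 - ρ) * (2 * B) * ρ ^ n := by
      intro z
      simp only [qFn, add_sub_add_left_eq_sub]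
      exact hP.abs_val_relCost_sub_le hB hnN _
    have hDD : ∀ s, |D N s - D n s| ≤ ε * (mc / (1 - ρ) * (2 * B) * ρ ^ n) := by
      intro s
      have := h.abs_expNext_sub_le (f := fun z => M.qFn i θ₀ N z - M.qFn i θ₀ n z)
        ((measurable_qFn N).sub (measurable_qFn n)) hq s
      rw [expNext_sub (measurable_qFn N) (hP.abs_qFn_le hB N) (measurable_qFn n)
        (hP.abs_qFn_le hB n), expNext_sub (measurable_qFn N) (hP.abs_qFn_le hB N)
        (measurable_qFn n) (hP.abs_qFn_le hB n)] at this
      refine le_trans (le_of_eq ?_) this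
      simp only [hD]; congr 1; ring
    have h2 : |L N - L n| ≤ ε * (mc / (1 - ρ) * (2 * B) * ρ ^ n) := by
      refine le_of_tendsto ((hL N).sub (hL n)).abs (Eventually.of_forall fun j => ?_)
      rw [← integral_sub (hI (hDm N) (hDb N) j) (hI (hDm n) (hDb n) j)]
      have e := stateOp_iterate_sub (θ := θ) (hDm N) (hDb N) (hDm n) (hDb n) j
      have e' := abs_integral_le_of_abs_le_prob (ν := M.init)
        (abs_stateOp_iterate_le (θ := θ) hDD j)
      rwa [e] at e'
    refine h2.trans ?_
    rw [hQ]
    have : 0 ≤ ε * (2 * B) * ρ ^ n := by have := pow_nonneg hP.ρ_pos.le n; positivity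
    nlinarith
  -- the bound for `Lc - L n` lacks the factor `ε`, which passing through `L N`, `N → ∞`, supplies
  have hfin : |Lc - L n| ≤ ε * Q * ρ ^ n := by
    have hlim : Tendsto (fun N : ℕ => mc / (1 - ρ) * (2 * B) * ρ ^ N + ε * Q * ρ ^ n) atTop
        (𝓝 (ε * Q * ρ ^ n)) := by
      have := ((tendsto_pow_atTop_nhds_zero_of_lt_one hP.ρ_pos.le hP.ρ_lt_one).const_mul
        (mc / (1 - ρ) * (2 * B))).add_const (ε * Q * ρ ^ n)
      simpa using this
    refine ge_of_tendsto hlim ?_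
    filter_upwards [eventually_ge_atTop n] with N hN
    exact (abs_sub_le _ (L N) _).trans (add_le_add (hLn N) (hLL n N hN))
  have h5 := hLP n n'
  have h6 : M.J i θ - M.J i θ₀ - ∫ s, D n s ∂P = (Lc - L n) + (L n - ∫ s, D n s ∂P) := by
    rw [hJ]; ring
  rw [h6]
  refine (abs_add_le _ _).trans ((add_le_add hfin h5).trans_eq ?_)
  ring

/-- The policy gradient theorem, with truncated Q-values: along `v`, the derivative of the long-run
cost is the stationary mean of score times Q-value, up to an error that is geometric in the
truncation. -/
lemma abs_inner_gradient_sub_le (hP : M.ErgodicLaw θ P mc ρ) (hθ : θ ∈ M.dom)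
    (hJ : DifferentiableAt ℝ (M.J i) θ) (hB : ∀ x, |M.cost' i x| ≤ B) {Bs : ℝ}
    (hBs : ∀ θ ∈ M.dom, ∀ x, ‖M.score θ x‖ ≤ Bs) (v : RVec nθ) (n : ℕ) :
    |inner ℝ (∇ (M.J i) θ) v
        - ∫ s, M.expNext θ (fun z => inner ℝ (M.score θ (z.1, z.2.1)) v * M.qFn i θ n z) s ∂P|
      ≤ Bs * ‖v‖ * ((1 + mc / (1 - ρ)) * (2 * B)) * ρ ^ n := by
  have := hP.prob
  obtain ⟨s₀⟩ : Nonempty M.S := nonempty_of_isProbabilityMeasure P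
  obtain ⟨a₀⟩ : Nonempty M.A := nonempty_of_isProbabilityMeasure (M.policy θ s₀)
  set Q := (1 + mc / (1 - ρ)) * (2 * B) with hQ
  have hBs0 : 0 ≤ Bs := (norm_nonneg _).trans (hBs θ hθ (s₀, a₀))
  have hQ0 : 0 ≤ Q := (abs_nonneg _).trans (hP.abs_qFn_le hB n (s₀, a₀, s₀))
  set b := Bs * ‖v‖ with hb
  have hb0 : 0 ≤ b := mul_nonneg hBs0 (norm_nonneg v)
  set ε : ℝ → ℝ := fun h => h * (b * Real.exp (b * h)) with hε
  obtain ⟨r, hr0, hr⟩ := Metric.isOpen_iff.1 M.isOpen_dom θ hθ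
  have hball : ∀ᶠ h : ℝ in 𝓝[>] 0, θ + h • v ∈ Metric.ball θ r :=
    eventually_add_smul_mem Metric.isOpen_ball (Metric.mem_ball_self hr0) v
  have hpos : ∀ᶠ h : ℝ in 𝓝[>] 0, 0 < h ∧ h ≤ 1 := by
    filter_upwards [Ioo_mem_nhdsGT (zero_lt_one (α := ℝ))] with h hh using ⟨hh.1, hh.2.le⟩
  have hclose : ∀ᶠ h : ℝ in 𝓝[>] 0, M.PolicyClose (θ + h • v) θ (ε h) := by
    filter_upwards [hball, hpos] with h hh hh0
    have h1 := policyClose_of_mem_ball hBs hr hh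
    have e1 : ‖θ + h • v - θ‖ = h * ‖v‖ := by
      rw [add_sub_cancel_left, norm_smul, Real.norm_of_nonneg hh0.1.le]
    rw [e1, show Bs * (h * ‖v‖) = b * h by rw [hb]; ring] at h1
    rwa [show ε h = b * h * Real.exp (b * h) by simp only [hε]; ring]
  have hεc : Continuous ε := by fun_prop
  have hε0 : Tendsto ε (𝓝[>] 0) (𝓝 0) := by
    have := hεc.tendsto 0
    simp only [hε, zero_mul] at this
    exact this.mono_left nhdsWithin_le_nhds
  set c : M.S × M.A × M.S → ℝ := fun z => inner ℝ (M.score θ (z.1, z.2.1)) v * M.qFn i θ n z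
    with hc
  have hcm : Measurable c :=
    ((measurable_inner_score hθ v).comp (by fun_prop)).mul (measurable_qFn n)
  have hcb : ∀ z, |c z| ≤ b * Q := fun z => by
    rw [hc, abs_mul]
    exact mul_le_mul (abs_inner_score_le hBs hθ v _) (hP.abs_qFn_le hB n z) (abs_nonneg _) hb0
  -- difference quotients of the long-run cost
  have hslope : Tendsto (fun h : ℝ => h⁻¹ * (M.J i (θ + h • v) - M.J i θ)) (𝓝[>] 0)
      (𝓝 (inner ℝ (∇ (M.J i) θ) v)) := by
    have hline : HasDerivAt (fun h : ℝ => θ + h • v) v 0 := by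
      simpa using ((hasDerivAt_id (0 : ℝ)).smul_const v).const_add θ
    have hf : HasFDerivAt (M.J i) (fderiv ℝ (M.J i) θ) (θ + (0 : ℝ) • v) := by
      simpa using hJ.hasFDerivAt
    have h1 := (hf.comp_hasDerivAt (0 : ℝ) hline).tendsto_slope_zero_right
    rw [← inner_gradient_left] at h1
    refine h1.congr fun h => ?_
    simp
  -- difference quotients of the one-step gain
  have hgain : Tendsto (fun h : ℝ => h⁻¹ * ∫ s, (M.expNext (θ + h • v) (M.qFn i θ n) s
      - M.expNext θ (M.qFn i θ n) s) ∂P) (𝓝[>] 0) (𝓝 (∫ s, M.expNext θ c s ∂P)) := by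
    simp only [← integral_const_mul]
    refine tendsto_integral_filter_of_dominated_convergence (fun _ => b * Real.exp b * Q)
      (Eventually.of_forall fun h => ?_) ?_ (integrable_const _) (ae_of_all _ fun s => ?_)
    · exact (((measurable_expNext (measurable_qFn n)).sub
        (measurable_expNext (measurable_qFn n))).const_mul _).aestronglyMeasurable
    · filter_upwards [hclose, hpos] with h hh hh0
      refine ae_of_all _ fun s => ?_
      have h1 := hh.abs_expNext_sub_le (measurable_qFn n) (hP.abs_qFn_le hB n) s
      rw [norm_mul, Real.norm_of_nonneg (inv_pos.2 hh0.1).le, inv_mul_le_iff₀ hh0.1]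
      refine h1.trans ?_
      have h2 : b * Real.exp (b * h) ≤ b * Real.exp b :=
        mul_le_mul_of_nonneg_left (Real.exp_le_exp.2 (mul_le_of_le_one_right hb0 hh0.2)) hb0
      simp only [hε, mul_assoc h]
      exact mul_le_mul_of_nonneg_left (mul_le_mul_of_nonneg_right h2 hQ0) hh0.1.le
    · set q : M.A → ℝ := fun a => ∫ s', M.qFn i θ n (s, a, s') ∂(M.transition (s, a)) with hq
      have hqm : Measurable q := (measurable_transition_integral (measurable_qFn n)).comp
        measurable_prodMk_left
      have h1 := tendsto_slope_integral_policy hBs hθ v s hqm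
        (fun a => abs_integral_le_of_abs_le_prob fun _ => hP.abs_qFn_le hB n _)
      have h2 : M.expNext θ c s
          = ∫ a, inner ℝ (M.score θ (s, a)) v * q a ∂(M.policy θ s) := by
        rw [expNext_eq hcm hcb]
        simp only [hc, hq, integral_const_mul]
      rw [h2]
      refine h1.congr fun h => ?_
      rw [expNext_eq (measurable_qFn n) (hP.abs_qFn_le hB n),
        expNext_eq (measurable_qFn n) (hP.abs_qFn_le hB n)]
  -- the performance difference, divided by `h`; as `h → 0`, only the truncation error remains and
  -- the term `mc * ρ ^ n'`, where `n'` is arbitrary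
  have hmain : ∀ n' : ℕ, |inner ℝ (∇ (M.J i) θ) v - ∫ s, M.expNext θ c s ∂P|
      ≤ b * Q * (mc * ρ ^ n' + ρ ^ n) := by
    intro n'
    obtain ⟨n₁, hn₁⟩ : ∃ n₁ : ℕ, mc * ρ ^ n₁ < 1 / 4 := by
      have := (tendsto_pow_atTop_nhds_zero_of_lt_one hP.ρ_pos.le hP.ρ_lt_one).const_mul mc
      rw [mul_zero] at this
      exact (this.eventually (gt_mem_nhds (by norm_num))).exists
    have hsmall : ∀ᶠ h : ℝ in 𝓝[>] 0, n₁ * ε h < 1 / 4 := by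
      have := hε0.const_mul (n₁ : ℝ)
      rw [mul_zero] at this
      exact this.eventually (gt_mem_nhds (by norm_num))
    have hup : Tendsto (fun h : ℝ => b * Real.exp (b * h) * Q * (n' * ε h + mc * ρ ^ n' + ρ ^ n))
        (𝓝[>] 0) (𝓝 (b * Q * (mc * ρ ^ n' + ρ ^ n))) := by
      have : Continuous fun h : ℝ =>
          b * Real.exp (b * h) * Q * (n' * ε h + mc * ρ ^ n' + ρ ^ n) := by fun_prop
      have := this.tendsto 0
      simp only [hε, zero_mul, mul_zero, Real.exp_zero, mul_one, zero_add] at this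
      exact this.mono_left nhdsWithin_le_nhds
    refine le_of_tendsto_of_tendsto (hslope.sub hgain).abs hup ?_
    filter_upwards [hclose, hpos, hsmall] with h hh hh0 hhs
    have hεh : 0 ≤ ε h := by have := hh0.1.le; simp only [hε]; positivity
    have h1 := hP.abs_J_sub_J_sub_le hεh hh (n₁ := n₁) (by linarith) hB n n'
    rw [← mul_sub, abs_mul, abs_of_pos (inv_pos.2 hh0.1), inv_mul_le_iff₀ hh0.1]
    refine h1.trans_eq ?_
    simp only [hε]; ring
  have hlim : Tendsto (fun n' : ℕ => b * Q * (mc * ρ ^ n' + ρ ^ n)) atTop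
      (𝓝 (b * Q * ρ ^ n)) := by
    have := (((tendsto_pow_atTop_nhds_zero_of_lt_one hP.ρ_pos.le hP.ρ_lt_one).const_mul
      mc).add_const (ρ ^ n)).const_mul (b * Q)
    simpa using this
  exact ge_of_tendsto hlim (Eventually.of_forall hmain)

end ErgodicLaw

end ValueFunction

end CMDP

/-! ### Conditional laws and joint measurability -/

section ConditionalLaw

/-- If the conditional law of `Y` given a `σ`-algebra is a kernel at a random variable `ξ` known to
that `σ`-algebra, then the joint law of `ξ` and `Y` is the composition product. -/
lemma map_prodMk_eq_compProd_of_condExp {Ω E F : Type*} {𝓜 : MeasurableSpace Ω}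
    [mΩ : MeasurableSpace Ω] [MeasurableSpace E] [MeasurableSpace F] {μ : Measure Ω}
    [IsProbabilityMeasure μ] (h𝓜 : 𝓜 ≤ mΩ) {ξ : Ω → E} (hξ : Measurable[𝓜] ξ) {Y : Ω → F}
    (hY : Measurable Y) (κ : Kernel E F) [IsMarkovKernel κ]
    (h : ∀ B, MeasurableSet B → μ⟦Y ⁻¹' B | 𝓜⟧ =ᵐ[μ] fun ω => (κ (ξ ω)).real B) :
    μ.map (fun ω => (ξ ω, Y ω)) = (μ.map ξ) ⊗ₘ κ := by
  have hξ' : Measurable ξ := hξ.mono h𝓜 le_rfl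
  have : IsProbabilityMeasure (μ.map fun ω => (ξ ω, Y ω)) :=
    Measure.isProbabilityMeasure_map (hξ'.prodMk hY).aemeasurable
  have : IsProbabilityMeasure (μ.map ξ) := Measure.isProbabilityMeasure_map hξ'.aemeasurable
  refine Measure.ext_prod fun {A B} hA hB => ?_
  rw [Measure.map_apply (hξ'.prodMk hY) (hA.prod hB), Measure.compProd_apply_prod hA hB,
    setLIntegral_map hA (Kernel.measurable_coe κ hB) hξ']
  have hset : (fun ω => (ξ ω, Y ω)) ⁻¹' (A ×ˢ B) = ξ ⁻¹' A ∩ Y ⁻¹' B := rfl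
  rw [hset]
  have hint : Integrable ((Y ⁻¹' B).indicator fun _ => (1 : ℝ)) μ :=
    (integrable_const 1).indicator (hY hB)
  have h1 := setIntegral_condExp h𝓜 hint (hξ hA)
  rw [setIntegral_congr_ae (h𝓜 _ (hξ hA)) ((h B hB).mono fun ω hω _ => hω),
    integral_indicator_const _ (hY hB), smul_eq_mul, mul_one,
    measureReal_restrict_apply (hY hB)] at h1
  have hκm : Measurable fun ω => κ (ξ ω) B := (Kernel.measurable_coe κ hB).comp hξ'
  have h2 : ∫ ω in ξ ⁻¹' A, (κ (ξ ω)).real B ∂μ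
      = (∫⁻ ω in ξ ⁻¹' A, κ (ξ ω) B ∂μ).toReal :=
    integral_toReal hκm.aemeasurable (ae_of_all _ fun _ => measure_lt_top _ _)
  rw [h2, measureReal_def] at h1
  have hfin : ∫⁻ ω in ξ ⁻¹' A, κ (ξ ω) B ∂μ ≠ ⊤ := by
    refine ne_top_of_le_ne_top ENNReal.one_ne_top ?_
    calc _ ≤ ∫⁻ ω in ξ ⁻¹' A, 1 ∂μ := lintegral_mono fun _ => prob_le_one
      _ ≤ 1 := by rw [setLIntegral_one]; exact prob_le_one
  rw [Set.inter_comm]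
  exact ((ENNReal.toReal_eq_toReal_iff' hfin (measure_ne_top _ _)).1 h1).symm

end ConditionalLaw

noncomputable section

namespace CMDP

variable {nθ ns na m : ℕ} {M : CMDP nθ ns na m}

lemma ProblemAssumptions.exists_policyClose (hM : M.ProblemAssumptions) :
    ∃ L, 0 ≤ L ∧ ∀ θ ∈ M.Θ, ∀ θ' ∈ M.Θ, M.PolicyClose θ θ' (L * ‖θ - θ'‖) := by
  obtain ⟨L, hL⟩ := hM.lipschitz_policy
  refine ⟨|L|, abs_nonneg L, fun θ hθ θ' hθ' s q C hq hC => ?_⟩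
  obtain ⟨a⟩ : Nonempty M.A := nonempty_of_isProbabilityMeasure (M.policy θ s)
  have hC0 : 0 ≤ C := (abs_nonneg _).trans (hC a)
  have h1 := abs_integral_sub_integral_le_tvDistance (M.policy θ s) (M.policy θ' s) hq hC
  have h2 : tvDistance (M.policy θ s) (M.policy θ' s) ≤ |L| * ‖θ - θ'‖ :=
    (hL θ hθ θ' hθ' s).trans (mul_le_mul_of_nonneg_right (le_abs_self L) (norm_nonneg _))
  calc _ ≤ C * tvDistance (M.policy θ s) (M.policy θ' s) := h1
    _ ≤ C * (|L| * ‖θ - θ'‖) := mul_le_mul_of_nonneg_left h2 hC0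
    _ = _ := mul_comm _ _

/-- The policy is jointly measurable in the parameter and the state, being Lipschitz in the former
and measurable in the latter. -/
lemma ProblemAssumptions.measurable_policy (hM : M.ProblemAssumptions) :
    Measurable fun p : M.Θ × M.S => M.policy p.1 p.2 := by
  refine Measure.measurable_of_measurable_coe _ fun B hB => ?_
  obtain ⟨L, hL, hclose⟩ := hM.exists_policyClose
  have h1 : Measurable (Function.uncurry fun (θ : M.Θ) (s : M.S) => (M.policy θ s).real B) := by
    refine measurable_uncurry_of_continuous_of_measurable (fun s => ?_) fun θ => ?_
    · refine (LipschitzWith.of_dist_le' (K := L) fun θ θ' => ?_).continuous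
      have := hclose θ θ.2 θ' θ'.2 s (B.indicator fun _ => 1) 1 (measurable_const.indicator hB)
        (fun a => by by_cases ha : a ∈ B <;> simp [ha])
      rw [integral_indicator_const _ hB, integral_indicator_const _ hB] at this
      simpa [Real.dist_eq, Subtype.dist_eq, dist_eq_norm] using this
    · exact ((M.policy θ).measurable_coe hB).ennreal_toReal
  convert h1.ennreal_ofReal using 2 with p
  exact (ofReal_measureReal (measure_ne_top _ _)).symm

/-- The policies of the parameters in `Θ` as one kernel. -/
def policyKernel (hM : M.ProblemAssumptions) : Kernel (M.Θ × M.S) M.A :=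
  ⟨fun p => M.policy p.1 p.2, hM.measurable_policy⟩

instance (hM : M.ProblemAssumptions) : IsMarkovKernel (policyKernel hM) :=
  ⟨fun p => inferInstanceAs (IsProbabilityMeasure (M.policy p.1 p.2))⟩

/-- The transitions under the parameters in `Θ` as one kernel. -/
def nextKernel (hM : M.ProblemAssumptions) : Kernel (M.Θ × M.S) (M.A × M.S) where
  toFun p := M.next p.1 p.2
  measurable' := by
    refine Measure.measurable_of_measurable_coe _ fun B hB => ?_
    have h1 : Measurable fun q : (M.Θ × M.S) × M.A =>
        M.transition (q.1.2, q.2) {s' | (q.2, s') ∈ B} := by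
      have h2 := Kernel.measurable_kernel_prodMk_left (κ := M.transition)
        (t := {w : (M.S × M.A) × M.S | (w.1.2, w.2) ∈ B})
        ((show Measurable fun w : (M.S × M.A) × M.S => (w.1.2, w.2) by fun_prop) hB)
      exact h2.comp (show Measurable fun q : (M.Θ × M.S) × M.A => (q.1.2, q.2) by fun_prop)
    convert Measurable.lintegral_kernel_prod_right (κ := policyKernel hM)
      (f := fun p a => M.transition (p.2, a) {s' | (a, s') ∈ B}) h1 using 2 with p
    exact Kernel.compProd_apply hB _ _ _

instance (hM : M.ProblemAssumptions) : IsMarkovKernel (nextKernel hM) :=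
  ⟨fun p => inferInstanceAs (IsProbabilityMeasure (M.next p.1 p.2))⟩

section JointMeasurability

variable {E : Type*} [MeasurableSpace E]

lemma ProblemAssumptions.measurable_expNext (hM : M.ProblemAssumptions)
    {F : E → M.S × M.A × M.S → ℝ} (hF : Measurable (Function.uncurry F)) :
    Measurable fun p : E × M.Θ × M.S => M.expNext p.2.1 (F p.1) p.2.2 := by
  have h1 := StronglyMeasurable.integral_kernel_prod_right
    (κ := (nextKernel hM).comap (fun p : E × M.Θ × M.S => p.2) measurable_snd)
    (f := fun (p : E × M.Θ × M.S) y => F p.1 (p.2.2, y))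
    (hF.comp (show Measurable fun q : (E × M.Θ × M.S) × (M.A × M.S) =>
      (q.1.1, (q.1.2.2, q.2)) by fun_prop)).stronglyMeasurable
  exact h1.measurable

lemma ProblemAssumptions.measurable_val (hM : M.ProblemAssumptions)
    {F : M.Θ → M.S × M.A × M.S → ℝ} (hF : Measurable (Function.uncurry F)) (j : ℕ) :
    Measurable fun p : M.Θ × M.S => M.val p.1 (F p.1) j p.2 := by
  induction j with
  | zero => exact measurable_const
  | succ j ih =>
    have h1 : Measurable (Function.uncurry fun (θ : M.Θ) (z : M.S × M.A × M.S) =>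
        F θ z + M.val θ (F θ) j z.2.2) :=
      hF.add (ih.comp (show Measurable fun q : M.Θ × M.S × M.A × M.S => (q.1, q.2.2.2) by
        fun_prop))
    exact (hM.measurable_expNext h1).comp
      (show Measurable fun p : M.Θ × M.S => (p.1, p) by fun_prop)

lemma ProblemAssumptions.continuous_J (hM : M.ProblemAssumptions) (i : Fin (m + 1)) :
    Continuous fun θ : M.Θ => M.J i θ := by
  obtain ⟨B, hB⟩ := hM.deriv_J
  rw [continuous_iff_continuousAt]
  exact fun θ => (hB i θ θ.2).1.continuousAt.comp continuous_subtype_val.continuousAt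

lemma ProblemAssumptions.measurable_inner_score (hM : M.ProblemAssumptions) (v : RVec nθ) :
    Measurable (Function.uncurry fun (θ : M.Θ) (x : M.S × M.A) => inner ℝ (M.score θ x) v) := by
  obtain ⟨L, hL⟩ := hM.lipschitz_score
  refine measurable_uncurry_of_continuous_of_measurable (fun x => ?_) fun θ =>
    CMDP.measurable_inner_score (M.subset_dom θ.2) v
  have h1 : Continuous fun θ : M.Θ => M.score θ x := by
    refine (LipschitzWith.of_dist_le' (K := L) fun θ θ' => ?_).continuous
    simpa [Subtype.dist_eq, dist_eq_norm] using hL θ θ.2 θ' θ'.2 x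
  fun_prop

lemma ProblemAssumptions.measurable_relCost (hM : M.ProblemAssumptions) (i : Fin (m + 1)) :
    Measurable (Function.uncurry fun (θ : M.Θ) (z : M.S × M.A × M.S) => M.relCost i θ z) :=
  ((measurable_costFn i).comp measurable_snd).sub
    ((hM.continuous_J i).measurable.comp measurable_fst)

lemma ProblemAssumptions.measurable_qFn (hM : M.ProblemAssumptions) (i : Fin (m + 1)) (j : ℕ) :
    Measurable (Function.uncurry fun (θ : M.Θ) (z : M.S × M.A × M.S) => M.qFn i θ j z) :=
  (hM.measurable_relCost i).add ((hM.measurable_val (hM.measurable_relCost i) j).comp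
    (show Measurable fun q : M.Θ × M.S × M.A × M.S => (q.1, q.2.2.2) by fun_prop))

end JointMeasurability

end CMDP

/-! ### Transitions of a run as martingale differences -/

/-- The filtration that starts at time `N`. -/
def shiftFiltration {Ω : Type*} {mΩ : MeasurableSpace Ω} (𝓕 : Filtration ℕ mΩ) (N : ℕ) :
    Filtration ℕ mΩ where
  seq t := 𝓕 (N + t)
  mono' _ _ h := 𝓕.mono (by omega)
  le' _ := 𝓕.le _

namespace SCAOPORun

variable {nθ ns na m : ℕ} {M : CMDP nθ ns na m} {α β : ℕ → ℝ} {T : ℕ → ℕ} {N₀ : ℕ}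
  {ς J₀ : Fin (m + 1) → ℝ} {g₀ : Fin (m + 1) → RVec nθ}
  {Ω : Type*} [mΩ : MeasurableSpace Ω] {μ : Measure Ω} {𝓕 : Filtration ℕ mΩ}
  (X : SCAOPORun M α β T N₀ ς J₀ g₀ μ 𝓕)

/-- The iterates stay in `Θ`, being convex combinations of points of `Θ`. -/
lemma θ_mem (hM : M.ProblemAssumptions) (hstep : StepSizes α β) (t : ℕ) (ω : Ω) :
    X.θ t ω ∈ M.Θ ∧ X.θbar t ω ∈ M.Θ := by
  have hbar : ∀ t, X.θbar t ω ∈ M.Θ := by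
    intro t
    have h := X.subproblem t ω
    by_cases hF : {θ | θ ∈ M.Θ ∧ ∀ j : Fin m,
        surrogate (M.Jhat T N₀ α (fun n => (X.s n ω, X.a n ω)) J₀ j.succ t)
          (M.ghat T N₀ α (fun n => (X.s n ω, X.a n ω)) J₀ g₀ (fun t' => X.θ t' ω) j.succ t)
          (X.θ t ω) (ς j.succ) θ ≤ 0}.Nonempty
    · exact (h.1 hF).1.1
    · obtain ⟨y, hy, -⟩ := h.2 hF
      exact hy.1
  refine ⟨?_, hbar t⟩
  induction t with
  | zero => exact X.θ_zero_mem ω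
  | succ t ih =>
    rw [X.update]
    exact hM.convex_Θ ih (hbar t) (by linarith [hstep.β_le_one t]) (hstep.β_pos t).le (by ring)

/-- The state, action and next state of iteration `t`. -/
def trans (t : ℕ) (ω : Ω) : M.S × M.A × M.S :=
  (X.s (N₀ + t) ω, X.a (N₀ + t) ω, X.s (N₀ + t + 1) ω)

lemma measurable_trans (t : ℕ) : Measurable[shiftFiltration 𝓕 N₀ (t + 1)] (X.trans t) :=
  ((X.measurable_s _).mono (𝓕.mono (by omega)) le_rfl).prodMk
    ((X.measurable_a _).prodMk (X.measurable_s _))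

lemma measurable_state (t : ℕ) : Measurable[shiftFiltration 𝓕 N₀ t] (X.s (N₀ + t)) :=
  X.measurable_s _

variable (hM : M.ProblemAssumptions) (hstep : StepSizes α β)

/-- The iterate as a random point of `Θ`. -/
def par (t : ℕ) (ω : Ω) : M.Θ := ⟨X.θ t ω, (X.θ_mem hM hstep t ω).1⟩

lemma measurable_par (t : ℕ) : Measurable[shiftFiltration 𝓕 N₀ t] (X.par hM hstep t) :=
  (X.measurable_θ t).subtype_mk

variable [IsProbabilityMeasure μ] {E : Type*} [MeasurableSpace E]
include hM hstep

/-- Given the past, the transition of iteration `t` has the law that belongs to the present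
parameter and state. -/
lemma integral_trans_eq {t : ℕ} {ξ : Ω → E} (hξ : Measurable[shiftFiltration 𝓕 N₀ t] ξ)
    {F : E → M.S × M.A × M.S → ℝ} (hF : Measurable (Function.uncurry F)) {C : ℝ}
    (hC : ∀ e z, |F e z| ≤ C) :
    ∫ ω, F (ξ ω) (X.trans t ω) ∂μ
      = ∫ ω, M.expNext (X.θ t ω) (F (ξ ω)) (X.s (N₀ + t) ω) ∂μ := by
  set ζ : Ω → E × M.Θ × M.S := fun ω => (ξ ω, X.par hM hstep t ω, X.s (N₀ + t) ω) with hζdef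
  have hζ : Measurable[𝓕 (N₀ + t)] ζ :=
    hξ.prodMk ((X.measurable_par hM hstep t).prodMk (X.measurable_s _))
  have hζ' : Measurable ζ := hζ.mono (𝓕.le _) le_rfl
  have ha : Measurable (X.a (N₀ + t)) := (X.measurable_a _).mono (𝓕.le _) le_rfl
  have hs' : Measurable (X.s (N₀ + t + 1)) := (X.measurable_s _).mono (𝓕.le _) le_rfl
  have law1 := map_prodMk_eq_compProd_of_condExp (μ := μ) (𝓕.le (N₀ + t)) hζ ha
    ((CMDP.policyKernel hM).comap (fun p : E × M.Θ × M.S => p.2) measurable_snd)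
    (fun B hB => X.action_law t B hB)
  have hcomap : MeasurableSpace.comap (X.a (N₀ + t)) inferInstance ≤ mΩ := ha.comap_le
  have hζa : Measurable[𝓕 (N₀ + t) ⊔ MeasurableSpace.comap (X.a (N₀ + t)) inferInstance]
      fun ω => (ζ ω, X.a (N₀ + t) ω) :=
    (hζ.mono le_sup_left le_rfl).prodMk ((comap_measurable _).mono le_sup_right le_rfl)
  have law2 := map_prodMk_eq_compProd_of_condExp (μ := μ) (sup_le (𝓕.le (N₀ + t)) hcomap) hζa hs'
    (M.transition.comap (fun p : (E × M.Θ × M.S) × M.A => (p.1.2.2, p.2)) (by fun_prop))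
    (fun B hB => X.state_law t B hB)
  have hprob : IsProbabilityMeasure (μ.map ζ) := Measure.isProbabilityMeasure_map hζ'.aemeasurable
  have hFm : Measurable fun q : ((E × M.Θ × M.S) × M.A) × M.S =>
      F q.1.1.1 (q.1.1.2.2, q.1.2, q.2) :=
    hF.comp (show Measurable fun q : ((E × M.Θ × M.S) × M.A) × M.S =>
      (q.1.1.1, (q.1.1.2.2, q.1.2, q.2)) by fun_prop)
  have hFm1 : Measurable fun q : (E × M.Θ × M.S) × M.A =>
      ∫ s', F q.1.1 (q.1.2.2, q.2, s') ∂(M.transition (q.1.2.2, q.2)) :=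
    (StronglyMeasurable.integral_kernel_prod_right
      (κ := M.transition.comap (fun p : (E × M.Θ × M.S) × M.A => (p.1.2.2, p.2)) (by fun_prop))
      (f := fun (q : (E × M.Θ × M.S) × M.A) s' => F q.1.1 (q.1.2.2, q.2, s'))
      hFm.stronglyMeasurable).measurable
  calc ∫ ω, F (ξ ω) (X.trans t ω) ∂μ
      = ∫ q, F q.1.1.1 (q.1.1.2.2, q.1.2, q.2)
          ∂(μ.map fun ω => ((ζ ω, X.a (N₀ + t) ω), X.s (N₀ + t + 1) ω)) := by
        rw [integral_map ((hζ'.prodMk ha).prodMk hs').aemeasurable hFm.aestronglyMeasurable]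
        rfl
    _ = ∫ q, ∫ s', F q.1.1 (q.1.2.2, q.2, s') ∂(M.transition (q.1.2.2, q.2))
          ∂(μ.map fun ω => (ζ ω, X.a (N₀ + t) ω)) := by
        have : IsProbabilityMeasure (μ.map fun ω => (ζ ω, X.a (N₀ + t) ω)) :=
          Measure.isProbabilityMeasure_map (hζ'.prodMk ha).aemeasurable
        rw [law2, Measure.integral_compProd (integrable_of_abs_le hFm fun _ => hC _ _)]
        rfl
    _ = ∫ p, ∫ a, ∫ s', F p.1 (p.2.2, a, s') ∂(M.transition (p.2.2, a))
          ∂(M.policy p.2.1 p.2.2) ∂(μ.map ζ) := by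
        rw [law1, Measure.integral_compProd (integrable_of_abs_le hFm1 fun _ =>
          abs_integral_le_of_abs_le_prob fun _ => hC _ _)]
        rfl
    _ = ∫ p, M.expNext p.2.1 (F p.1) p.2.2 ∂(μ.map ζ) := by
        refine integral_congr_ae (ae_of_all _ fun p => ?_)
        exact (CMDP.expNext_eq (hF.comp measurable_prodMk_left) (hC p.1) p.2.2).symm
    _ = _ := by
        rw [integral_map hζ'.aemeasurable (hM.measurable_expNext hF).aestronglyMeasurable]
        rfl

/-- The deviation of a function of the transition of iteration `t` from its expectation under the
current policy is a martingale difference; the function may depend on the past through `ξ`. -/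
lemma isMartingaleDiff_trans {t : ℕ} {ξ : Ω → E} (hξ : Measurable[shiftFiltration 𝓕 N₀ t] ξ)
    {F : E → M.S × M.A × M.S → ℝ} (hF : Measurable (Function.uncurry F)) {C : ℝ}
    (hC : ∀ e z, |F e z| ≤ C) :
    IsMartingaleDiff μ (shiftFiltration 𝓕 N₀) t (2 * C) fun ω =>
      F (ξ ω) (X.trans t ω) - M.expNext (X.θ t ω) (F (ξ ω)) (X.s (N₀ + t) ω) := by
  have hle : shiftFiltration 𝓕 N₀ t ≤ shiftFiltration 𝓕 N₀ (t + 1) :=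
    (shiftFiltration 𝓕 N₀).mono t.le_succ
  have hm1 : Measurable[shiftFiltration 𝓕 N₀ (t + 1)] fun ω => F (ξ ω) (X.trans t ω) :=
    hF.comp ((hξ.mono hle le_rfl).prodMk (X.measurable_trans t))
  have hm2 : Measurable[shiftFiltration 𝓕 N₀ t] fun ω =>
      M.expNext (X.θ t ω) (F (ξ ω)) (X.s (N₀ + t) ω) :=
    (hM.measurable_expNext hF).comp
      (hξ.prodMk ((X.measurable_par hM hstep t).prodMk (X.measurable_state t)))
  refine ⟨hm1.sub (hm2.mono hle le_rfl), fun ω => ?_, fun G hG hGb => ?_⟩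
  · refine (abs_sub _ _).trans ?_
    rw [two_mul]
    exact add_le_add (hC _ _) (CMDP.abs_expNext_le (hC _) _)
  · obtain ⟨CG, hCG⟩ := hGb
    -- the test variable `G` becomes a part of the past, as a point of a bounded interval
    set ξ' : Ω → Set.Icc (-CG) CG × E := fun ω => (⟨G ω, abs_le.1 (hCG ω)⟩, ξ ω) with hξ'
    have hξ'm : Measurable[shiftFiltration 𝓕 N₀ t] ξ' := hG.subtype_mk.prodMk hξ
    set F' : Set.Icc (-CG) CG × E → M.S × M.A × M.S → ℝ := fun e z => (e.1 : ℝ) * F e.2 z with hF'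
    have hF'm : Measurable (Function.uncurry F') := by
      refine Measurable.mul (measurable_subtype_coe.comp (by fun_prop)) ?_
      exact hF.comp (show Measurable fun q : (Set.Icc (-CG) CG × E) × (M.S × M.A × M.S) =>
        (q.1.2, q.2) by fun_prop)
    have h1 := X.integral_trans_eq hM hstep hξ'm hF'm (C := CG * C) fun e z => by
      rw [hF', abs_mul]
      have he : |(e.1 : ℝ)| ≤ CG := abs_le.2 e.1.2
      exact mul_le_mul he (hC _ _) (abs_nonneg _) ((abs_nonneg _).trans he)
    have h2 : ∀ ω, M.expNext (X.θ t ω) (F' (ξ' ω)) (X.s (N₀ + t) ω)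
        = G ω * M.expNext (X.θ t ω) (F (ξ ω)) (X.s (N₀ + t) ω) := fun ω => by
      simp only [CMDP.expNext, hF', hξ']
      exact integral_const_mul _ _
    simp only [h2] at h1
    simp only [mul_sub]
    have hle' : shiftFiltration 𝓕 N₀ t ≤ mΩ := (shiftFiltration 𝓕 N₀).le t
    have hb : ∀ {f : Ω → ℝ}, Measurable f → (∀ ω, |f ω| ≤ C) →
        Integrable (fun ω => G ω * f ω) μ := fun hf hfC =>
      integrable_of_abs_le (C := CG * C) ((hG.mono hle' le_rfl).mul hf) fun ω => by
        rw [abs_mul]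
        exact mul_le_mul (hCG ω) (hfC ω) (abs_nonneg _) ((abs_nonneg _).trans (hCG ω))
    rw [integral_sub (hb (hm1.mono ((shiftFiltration 𝓕 N₀).le _) le_rfl) fun _ => hC _ _)
      (hb (hm2.mono hle' le_rfl) fun _ => CMDP.abs_expNext_le (hC _) _)]
    exact sub_eq_zero.2 h1

end SCAOPORun

end

/-! ### Bounds for the estimates and telescoping over a window -/

namespace CMDP

variable {nθ ns na m : ℕ} {M : CMDP nθ ns na m}

lemma ProblemAssumptions.exists_lipschitz_J (hM : M.ProblemAssumptions) :
    ∃ K, 0 ≤ K ∧ ∀ i, ∀ θ ∈ M.Θ, ∀ θ' ∈ M.Θ, |M.J i θ - M.J i θ'| ≤ K * ‖θ - θ'‖ ∧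
      ‖∇ (M.J i) θ - ∇ (M.J i) θ'‖ ≤ K * ‖θ - θ'‖ := by
  obtain ⟨B, hB⟩ := hM.deriv_J
  refine ⟨|B|, abs_nonneg B, fun i θ hθ θ' hθ' => ⟨?_, ?_⟩⟩
  · refine hM.convex_Θ.norm_image_sub_le_of_norm_fderiv_le (𝕜 := ℝ) (f := M.J i)
      (fun x hx => (hB i x hx).1) (fun x hx => ?_) hθ' hθ
    have h := (hB i x hx).2.1
    rw [gradient, LinearIsometryEquiv.norm_map] at h
    exact h.trans (le_abs_self B)
  · exact hM.convex_Θ.norm_image_sub_le_of_norm_fderiv_le (𝕜 := ℝ) (f := ∇ (M.J i))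
      (fun x hx => (hB i x hx).2.2.1) (fun x hx => (hB i x hx).2.2.2.trans (le_abs_self B)) hθ' hθ

lemma ProblemAssumptions.exists_diam (hM : M.ProblemAssumptions) :
    ∃ D, 0 ≤ D ∧ ∀ θ ∈ M.Θ, ∀ θ' ∈ M.Θ, ‖θ - θ'‖ ≤ D :=
  ⟨Metric.diam M.Θ, Metric.diam_nonneg, fun θ hθ θ' hθ' => by
    rw [← dist_eq_norm]
    exact Metric.dist_le_diam_of_mem hM.compact_Θ.isBounded hθ hθ'⟩

section Estimates

variable {T : ℕ → ℕ} {N₀ : ℕ} {α : ℕ → ℝ} {i : Fin (m + 1)} {B : ℝ}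

lemma abs_Jtilde_le (hB : ∀ x, |M.cost' i x| ≤ B) (hB0 : 0 ≤ B) (x : ℕ → M.S × M.A) (t : ℕ) :
    |M.Jtilde T N₀ x i t| ≤ B := by
  unfold Jtilde
  rw [abs_mul, abs_of_nonneg (by positivity)]
  have h1 : |∑ l ∈ Finset.range (2 * T t), M.cost' i (M.stored T N₀ x t l)| ≤ 2 * T t * B := by
    refine (Finset.abs_sum_le_sum_abs _ _).trans ((Finset.sum_le_sum fun l _ => hB _).trans ?_)
    simp
  rcases (Nat.zero_le (T t)).eq_or_lt with h0 | hpos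
  · rw [← h0]; simpa using hB0
  · have hT : (0 : ℝ) < 2 * T t := by have : (0 : ℝ) < T t := by exact_mod_cast hpos
                                      positivity
    rw [one_div, inv_mul_le_iff₀ hT]
    exact h1

/-- The recursive cost estimates are bounded, since they are eventually convex combinations. -/
lemma exists_abs_Jhat_le (hα : ∀ t, 0 < α t) (hα1 : ∀ᶠ t in atTop, α t ≤ 1)
    (hB : ∀ i x, |M.cost' i x| ≤ B) (hB0 : 0 ≤ B) (J₀ : Fin (m + 1) → ℝ) (i : Fin (m + 1)) :
    ∃ C, 0 ≤ C ∧ ∀ (x : ℕ → M.S × M.A) (t : ℕ), |M.Jhat T N₀ α x J₀ i t| ≤ C := by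
  have step : ∀ (a j y C : ℝ), 0 < a → |j| ≤ C → |y| ≤ B →
      |(1 - a) * j + a * y| ≤ |1 - a| * C + a * B := by
    intro a j y C ha hj hy
    refine (abs_add_le _ _).trans ?_
    rw [abs_mul, abs_mul, abs_of_pos ha]
    exact add_le_add (mul_le_mul_of_nonneg_left hj (abs_nonneg _))
      (mul_le_mul_of_nonneg_left hy ha.le)
  have early : ∀ t, ∃ C, B ≤ C ∧ ∀ (x : ℕ → M.S × M.A), ∀ u ≤ t,
      |M.Jhat T N₀ α x J₀ i u| ≤ C := by
    intro t
    induction t with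
    | zero =>
      refine ⟨max B (|1 - α 0| * |J₀ i| + α 0 * B), le_max_left _ _, fun x u hu => ?_⟩
      obtain rfl := Nat.le_zero.1 hu
      exact (step _ _ _ _ (hα 0) le_rfl (abs_Jtilde_le (hB i) hB0 x 0)).trans (le_max_right _ _)
    | succ t ih =>
      obtain ⟨C, hBC, hC⟩ := ih
      refine ⟨max C (|1 - α (t + 1)| * C + α (t + 1) * B), hBC.trans (le_max_left _ _),
        fun x u hu => ?_⟩
      rcases Nat.le_succ_iff.1 hu with h | rfl
      · exact (hC x u h).trans (le_max_left _ _)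
      · exact (step _ _ _ _ (hα _) (hC x t le_rfl) (abs_Jtilde_le (hB i) hB0 x _)).trans
          (le_max_right _ _)
  obtain ⟨t₁, ht₁⟩ := eventually_atTop.1 hα1
  obtain ⟨C, hBC, hC⟩ := early t₁
  refine ⟨C, hB0.trans hBC, fun x t => ?_⟩
  rcases le_total t t₁ with h | h
  · exact hC x t h
  · induction t, h using Nat.le_induction with
    | base => exact hC x t₁ le_rfl
    | succ t ht ih =>
      have h1 := ht₁ (t + 1) (by omega)
      have h2 := step (α (t + 1)) _ _ C (hα _) ih
        (abs_Jtilde_le (T := T) (N₀ := N₀) (hB i) hB0 x (t + 1))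
      rw [abs_of_nonneg (show 0 ≤ 1 - α (t + 1) by linarith)] at h2
      refine h2.trans ?_
      nlinarith [hα (t + 1)]

end Estimates

end CMDP

namespace SCAOPORun

variable {nθ ns na m : ℕ} {M : CMDP nθ ns na m} {α β : ℕ → ℝ} {T : ℕ → ℕ} {N₀ : ℕ}
  {ς J₀ : Fin (m + 1) → ℝ} {g₀ : Fin (m + 1) → RVec nθ}
  {Ω : Type*} [mΩ : MeasurableSpace Ω] {μ : Measure Ω} {𝓕 : Filtration ℕ mΩ}
  (X : SCAOPORun M α β T N₀ ς J₀ g₀ μ 𝓕)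

lemma measurable_Jhat (i : Fin (m + 1)) (t : ℕ) :
    Measurable[shiftFiltration 𝓕 N₀ (t + 1)] (X.Jhat i t) := by
  have hx : ∀ u ≤ t, ∀ l < 2 * T u, Measurable[shiftFiltration 𝓕 N₀ (t + 1)] fun ω =>
      M.cost' i (M.stored T N₀ (fun n => (X.s n ω, X.a n ω)) u l) := by
    intro u hu l hl
    have hw := X.window u
    refine (CMDP.measurable_cost' i).comp (Measurable.prodMk ?_ ?_)
    · exact (X.measurable_s _).mono (𝓕.mono (by omega)) le_rfl
    · exact (X.measurable_a _).mono (𝓕.mono (by omega)) le_rfl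
  have htilde : ∀ u ≤ t, Measurable[shiftFiltration 𝓕 N₀ (t + 1)] fun ω =>
      M.Jtilde T N₀ (fun n => (X.s n ω, X.a n ω)) i u := fun u hu =>
    (Finset.measurable_fun_sum _ fun l hl => hx u hu l (Finset.mem_range.1 hl)).const_mul _
  have key : ∀ u ≤ t, Measurable[shiftFiltration 𝓕 N₀ (t + 1)] (X.Jhat i u) := by
    intro u hu
    induction u with
    | zero => exact measurable_const.add ((htilde 0 hu).const_mul _)
    | succ u ih => exact ((ih (by omega)).const_mul _).add ((htilde _ hu).const_mul _)
  exact key t le_rfl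

lemma stored_eq {t : ℕ} (ht : 2 * T t ≤ t + 1) (l : ℕ) (ω : Ω) :
    M.stored T N₀ (fun n => (X.s n ω, X.a n ω)) t l
      = ((X.trans (t + 1 - 2 * T t + l) ω).1, (X.trans (t + 1 - 2 * T t + l) ω).2.1) := by
  simp only [CMDP.stored, trans]
  rw [show N₀ + t + 1 - 2 * T t + l = N₀ + (t + 1 - 2 * T t + l) by omega]

variable (hM : M.ProblemAssumptions) (hstep : StepSizes α β)
include hM hstep

/-- The iterates move slowly over a window of times. -/
lemma norm_θ_sub_le {D : ℝ} (hD : ∀ θ ∈ M.Θ, ∀ θ' ∈ M.Θ, ‖θ - θ'‖ ≤ D) {u k n : ℕ} (hu : u ≤ k)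
    (hkn : k ≤ n) (ω : Ω) : ‖X.θ n ω - X.θ k ω‖ ≤ D * ((n - k : ℕ) * β u) := by
  have hD0 : 0 ≤ D := (norm_nonneg _).trans
    (hD _ (X.θ_mem hM hstep 0 ω).1 _ (X.θ_mem hM hstep 0 ω).1)
  induction n, hkn using Nat.le_induction with
  | base => simp
  | succ n hn ih =>
    have h1 : X.θ (n + 1) ω - X.θ n ω = β n • (X.θbar n ω - X.θ n ω) := by
      rw [X.update]; module
    have h2 : ‖X.θ (n + 1) ω - X.θ n ω‖ ≤ D * β u := by
      rw [h1, norm_smul, Real.norm_of_nonneg (hstep.β_pos n).le, mul_comm]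
      exact mul_le_mul (hD _ (X.θ_mem hM hstep n ω).2 _ (X.θ_mem hM hstep n ω).1)
        (hstep.β_anti (hu.trans hn)) (hstep.β_pos n).le hD0
    calc ‖X.θ (n + 1) ω - X.θ k ω‖ ≤ ‖X.θ (n + 1) ω - X.θ n ω‖ + ‖X.θ n ω - X.θ k ω‖ :=
          norm_sub_le_norm_sub_add_norm_sub _ _ _
      _ ≤ D * β u + D * ((n - k : ℕ) * β u) := add_le_add h2 ih
      _ = _ := by rw [Nat.succ_sub hn]; push_cast; ring

/-- Telescoping along the trajectory with the parameter frozen at time `k`: over a window, the sum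
of a function `F` of the transitions is its expected total under the frozen policy, up to a
martingale sum and an error due to the motion of the parameter. Everything may be multiplied by a
factor `G` that is known at the start of the window. -/
lemma exists_isMartingaleSum_sub_val [IsProbabilityMeasure μ] {k n₀ H lo hi : ℕ} (hk : k ≤ n₀)
    (hlo : lo ≤ n₀) (hhi : n₀ + H ≤ hi) {F : M.Θ → M.S × M.A × M.S → ℝ}
    (hF : Measurable (Function.uncurry F)) {C : ℝ}
    (hC : ∀ (θ : M.Θ), ∀ j < H, ∀ z, |F θ z + M.val θ (F θ) j z.2.2| ≤ C) (hC0 : 0 ≤ C)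
    {G : Ω → ℝ} (hG : Measurable[shiftFiltration 𝓕 N₀ n₀] G) {b : ℝ} (hb0 : 0 ≤ b)
    (hb : ∀ ω, |G ω| ≤ b) {L δ : ℝ}
    (hL : ∀ θ ∈ M.Θ, ∀ θ' ∈ M.Θ, M.PolicyClose θ θ' (L * ‖θ - θ'‖))
    (hδ : ∀ ω, ∀ l < H, L * ‖X.θ (n₀ + l) ω - X.θ k ω‖ ≤ δ) :
    ∃ N : Ω → ℝ, IsMartingaleSum μ (shiftFiltration 𝓕 N₀) lo hi (H * (b * (2 * C))) N ∧
      ∀ ω, |G ω * (∑ l ∈ Finset.range H, F (X.par hM hstep k ω) (X.trans (n₀ + l) ω)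
        - M.val (X.θ k ω) (F (X.par hM hstep k ω)) H (X.s (N₀ + n₀) ω)) - N ω|
        ≤ H * (b * (δ * C)) := by
  set W : ℕ → M.Θ → M.S × M.A × M.S → ℝ := fun l θ z =>
    F θ z + M.val θ (F θ) (H - l - 1) z.2.2 with hW
  have hWm : ∀ l, Measurable (Function.uncurry (W l)) := fun l =>
    hF.add ((hM.measurable_val hF _).comp
      (show Measurable fun q : M.Θ × M.S × M.A × M.S => (q.1, q.2.2.2) by fun_prop))
  have hWb : ∀ l < H, ∀ θ z, |W l θ z| ≤ C := fun l hl θ z => hC θ _ (by omega) z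
  set d : ℕ → Ω → ℝ := fun l ω => W l (X.par hM hstep k ω) (X.trans (n₀ + l) ω)
    - M.expNext (X.θ (n₀ + l) ω) (W l (X.par hM hstep k ω)) (X.s (N₀ + (n₀ + l)) ω) with hd
  set e : ℕ → Ω → ℝ := fun l ω =>
    M.expNext (X.θ (n₀ + l) ω) (W l (X.par hM hstep k ω)) (X.s (N₀ + (n₀ + l)) ω)
    - M.expNext (X.θ k ω) (W l (X.par hM hstep k ω)) (X.s (N₀ + (n₀ + l)) ω) with he
  have hdM : ∀ l < H, IsMartingaleDiff μ (shiftFiltration 𝓕 N₀) (n₀ + l) (b * (2 * C))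
      fun ω => G ω * d l ω := by
    intro l hl
    have hξ : Measurable[shiftFiltration 𝓕 N₀ (n₀ + l)] (X.par hM hstep k) :=
      (X.measurable_par hM hstep k).mono ((shiftFiltration 𝓕 N₀).mono (by omega)) le_rfl
    exact (X.isMartingaleDiff_trans hM hstep hξ (hWm l) (hWb l hl)).mul
      (hG.mono ((shiftFiltration 𝓕 N₀).mono (by omega)) le_rfl) hb
  refine ⟨fun ω => ∑ l ∈ Finset.range H, G ω * d l ω, ?_, fun ω => ?_⟩
  · have h1 := IsMartingaleSum.sum (μ := μ) (𝓖 := shiftFiltration 𝓕 N₀) (lo := lo) (hi := hi)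
      (Finset.range H) (c := fun _ => b * (2 * C)) (f := fun l ω => G ω * d l ω) fun l hl => by
        have hl' := Finset.mem_range.1 hl
        exact IsMartingaleSum.single (hdM l hl') (by positivity)
          (Finset.mem_Ico.2 ⟨by omega, by omega⟩)
    simpa using h1
  · set v : ℕ → ℝ := fun l => M.val (X.θ k ω) (F (X.par hM hstep k ω)) (H - l)
      (X.s (N₀ + (n₀ + l)) ω) with hv
    have htel : ∀ l < H, F (X.par hM hstep k ω) (X.trans (n₀ + l) ω)
        = d l ω + e l ω - (v (l + 1) - v l) := by
      intro l hl
      have h1 : v l = M.expNext (X.θ k ω) (W l (X.par hM hstep k ω)) (X.s (N₀ + (n₀ + l)) ω) := by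
        simp only [hv, hW]
        rw [show H - l = (H - l - 1) + 1 by omega]
        rfl
      have h2 : W l (X.par hM hstep k ω) (X.trans (n₀ + l) ω)
          = F (X.par hM hstep k ω) (X.trans (n₀ + l) ω) + v (l + 1) := by
        simp only [hv, hW, trans]
        rw [show H - (l + 1) = H - l - 1 by omega]
        rfl
      simp only [hd, he]
      rw [h1, h2]; ring
    have hsum : ∑ l ∈ Finset.range H, F (X.par hM hstep k ω) (X.trans (n₀ + l) ω)
        - M.val (X.θ k ω) (F (X.par hM hstep k ω)) H (X.s (N₀ + n₀) ω)
        = ∑ l ∈ Finset.range H, d l ω + ∑ l ∈ Finset.range H, e l ω := by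
      rw [Finset.sum_congr rfl fun l hl => htel l (Finset.mem_range.1 hl), Finset.sum_sub_distrib,
        Finset.sum_range_sub, Finset.sum_add_distrib]
      have h3 : v H = 0 := by simp [hv, CMDP.val]
      have h4 : v 0 = M.val (X.θ k ω) (F (X.par hM hstep k ω)) H (X.s (N₀ + n₀) ω) := by
        simp [hv]
      rw [h3, h4]; ring
    have heb : ∀ l ∈ Finset.range H, |e l ω| ≤ δ * C := by
      intro l hl
      have hl' := Finset.mem_range.1 hl
      have h5 := (hL _ (X.θ_mem hM hstep (n₀ + l) ω).1 _
        (X.θ_mem hM hstep k ω).1).abs_expNext_sub_le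
        (f := W l (X.par hM hstep k ω)) ((hWm l).comp measurable_prodMk_left)
        (hWb l hl' _) (X.s (N₀ + (n₀ + l)) ω)
      exact h5.trans (mul_le_mul_of_nonneg_right (hδ ω l hl') hC0)
    have h6 : |∑ l ∈ Finset.range H, e l ω| ≤ H * (δ * C) := by
      refine (Finset.abs_sum_le_sum_abs _ _).trans ((Finset.sum_le_sum heb).trans ?_)
      simp
    beta_reduce
    rw [hsum, ← Finset.mul_sum, ← mul_sub, add_sub_cancel_left, abs_mul]
    calc |G ω| * |∑ l ∈ Finset.range H, e l ω| ≤ b * (H * (δ * C)) :=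
          mul_le_mul (hb ω) h6 (abs_nonneg _) hb0
      _ = _ := by ring

end SCAOPORun

/-! ### Decomposition of the new cost estimate -/

/-- The order of the systematic errors of the estimates at time `t`: the motion of the parameter and
of the estimates over the window, the boundary terms, and the truncation of the Q-values. -/
noncomputable def windowError (α β : ℕ → ℝ) (T : ℕ → ℕ) (ρ : ℝ) (t : ℕ) : ℝ :=
  (T t : ℝ) ^ 2 * β (t - 2 * T t) + (T t : ℝ) ^ 2 * α (t - 2 * T t) + 1 / (T t : ℝ)
    + ρ ^ (T t - 1)

namespace SCAOPORun

variable {nθ ns na m : ℕ} {M : CMDP nθ ns na m} {α β : ℕ → ℝ} {T : ℕ → ℕ} {N₀ : ℕ}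
  {ς J₀ : Fin (m + 1) → ℝ} {g₀ : Fin (m + 1) → RVec nθ}
  {Ω : Type*} [mΩ : MeasurableSpace Ω] {μ : Measure Ω} {𝓕 : Filtration ℕ mΩ}
  (X : SCAOPORun M α β T N₀ ς J₀ g₀ μ 𝓕) (hM : M.ProblemAssumptions) (hstep : StepSizes α β)

include X hstep in
lemma windowError_bounds {ρ : ℝ} (hρ : 0 < ρ) (t : ℕ) :
    (T t : ℝ) ^ 2 * β (t - 2 * T t) ≤ windowError α β T ρ t ∧
    (T t : ℝ) * β (t - 2 * T t) ≤ windowError α β T ρ t ∧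
    (T t : ℝ) ^ 2 * α (t - 2 * T t) ≤ windowError α β T ρ t ∧
    1 / (T t : ℝ) ≤ windowError α β T ρ t ∧ ρ ^ (T t - 1) ≤ windowError α β T ρ t ∧
    0 ≤ windowError α β T ρ t := by
  have hT : (1 : ℝ) ≤ T t := by exact_mod_cast X.one_le_T t
  have hβ := (hstep.β_pos (t - 2 * T t)).le
  have hα := (hstep.α_pos (t - 2 * T t)).le
  have h1 : 0 ≤ (T t : ℝ) ^ 2 * β (t - 2 * T t) := by positivity
  have h2 : 0 ≤ (T t : ℝ) ^ 2 * α (t - 2 * T t) := by positivity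
  have h3 : 0 ≤ 1 / (T t : ℝ) := by positivity
  have h4 : 0 ≤ ρ ^ (T t - 1) := by positivity
  have h5 : (T t : ℝ) * β (t - 2 * T t) ≤ (T t : ℝ) ^ 2 * β (t - 2 * T t) :=
    mul_le_mul_of_nonneg_right (by nlinarith) hβ
  unfold windowError
  exact ⟨by linarith, by linarith, by linarith, by linarith, by linarith, by linarith⟩

include hM hstep

/-- The new cost estimate is the current long-run cost plus a martingale sum and a small error. -/
lemma exists_Jtilde_decomposition [IsProbabilityMeasure μ] {mc ρ : ℝ} (hmc : 0 < mc) (hρ : 0 < ρ)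
    (hρ1 : ρ < 1) (hE : ∀ θ ∈ M.Θ, ∃ P, M.ErgodicLaw θ P mc ρ) (i : Fin (m + 1)) :
    ∃ K, 0 ≤ K ∧ ∀ t, 2 * T t ≤ t → ∃ n : Ω → ℝ,
      IsMartingaleSum μ (shiftFiltration 𝓕 N₀) (t + 1 - 2 * T t) (t + 1) (K * T t) n ∧
      ∀ ω, |M.Jtilde T N₀ (fun n => (X.s n ω, X.a n ω)) i t - M.J i (X.θ t ω) - n ω|
        ≤ K * windowError α β T ρ t := by
  obtain ⟨B, hB0, hB⟩ := hM.exists_cost'_bound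
  obtain ⟨L, hL0, hL⟩ := hM.exists_policyClose
  obtain ⟨D, hD0, hD⟩ := hM.exists_diam
  obtain ⟨KJ, hKJ0, hKJ⟩ := hM.exists_lipschitz_J
  have h1ρ : 0 < 1 - ρ := by linarith
  set Q := (1 + mc / (1 - ρ)) * (2 * B) with hQ
  have hQ0 : 0 ≤ Q := by positivity
  refine ⟨2 * Q + L * (D * 2) * Q + Q + KJ * (D * 2), by positivity, fun t ht => ?_⟩
  obtain ⟨-, hR1, -, hR2, -, hR0⟩ := windowError_bounds X hstep hρ t
  set R := windowError α β T ρ t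
  have hTn := X.one_le_T t
  have hT1 : (1 : ℝ) ≤ T t := by exact_mod_cast hTn
  have hT0 : (0 : ℝ) < T t := by linarith
  set τ : ℝ := (T t : ℝ) with hτ
  set b := β (t - 2 * T t) with hb
  have hb0 : 0 ≤ b := (hstep.β_pos _).le
  set k := t + 1 - 2 * T t with hk
  have hdrift : ∀ ω, ∀ n, k ≤ n → n ≤ t → ‖X.θ n ω - X.θ k ω‖ ≤ D * (2 * (τ * b)) := by
    intro ω n hkn hnt
    refine (X.norm_θ_sub_le hM hstep hD (u := t - 2 * T t) (by omega) hkn ω).trans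
      (mul_le_mul_of_nonneg_left ?_ hD0)
    rw [← mul_assoc]
    refine mul_le_mul_of_nonneg_right ?_ hb0
    have h1 : n - k ≤ 2 * T t := by omega
    have h2 : ((n - k : ℕ) : ℝ) ≤ ((2 * T t : ℕ) : ℝ) := by exact_mod_cast h1
    simpa [hτ] using h2
  obtain ⟨N, hN, hNe⟩ := X.exists_isMartingaleSum_sub_val hM hstep (k := k) (n₀ := k)
    (H := 2 * T t) (lo := k) (hi := t + 1) le_rfl le_rfl (by omega)
    (hM.measurable_relCost i) (C := Q)
    (fun θ j _ z => by
      obtain ⟨P, hP⟩ := hE θ θ.2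
      exact hP.abs_qFn_le (hB i) j z) hQ0
    (G := fun _ => 1) measurable_const (b := 1) zero_le_one (by simp)
    hL (δ := L * (D * (2 * (τ * b))))
    (fun ω l hl => mul_le_mul_of_nonneg_left (hdrift ω _ (by omega) (by omega)) hL0)
  refine ⟨fun ω => 1 / (2 * τ) * N ω, (hN.const_mul (1 / (2 * τ))).mono ?_, fun ω => ?_⟩
  · rw [abs_of_pos (by positivity)]
    push_cast
    have h1 : 1 / (2 * τ) * (2 * τ * (1 * (2 * Q))) = 2 * Q := by field_simp
    rw [h1]
    have : 2 * Q * 1 ≤ 2 * Q * τ := mul_le_mul_of_nonneg_left hT1 (by positivity)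
    have h2 : 0 ≤ (L * (D * 2) * Q + Q + KJ * (D * 2)) * τ := by positivity
    linarith
  · have hNe := hNe ω
    have hval : |M.val (X.θ k ω) (M.relCost i (X.par hM hstep k ω)) (2 * T t)
        (X.s (N₀ + k) ω)| ≤ Q := by
      obtain ⟨P, hP⟩ := hE _ (X.θ_mem hM hstep k ω).1
      refine (hP.abs_val_relCost_le (hB i) _ _).trans ?_
      rw [hQ]; linarith
    have hsum : M.Jtilde T N₀ (fun n => (X.s n ω, X.a n ω)) i t
        = 1 / (2 * τ) * ∑ l ∈ Finset.range (2 * T t),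
          M.relCost i (X.par hM hstep k ω) (X.trans (k + l) ω) + M.J i (X.θ k ω) := by
      simp only [CMDP.Jtilde, CMDP.relCost, Finset.sum_sub_distrib]
      rw [Finset.sum_congr rfl fun l _ => by rw [X.stored_eq (by omega) l ω]]
      simp only [CMDP.costFn, Finset.sum_const, Finset.card_range, nsmul_eq_mul]
      push_cast
      have : 1 / (2 * τ) * (2 * τ * M.J i (X.θ k ω)) = M.J i (X.θ k ω) := by field_simp
      rw [mul_sub, show M.J i (X.par hM hstep k ω) = M.J i (X.θ k ω) from rfl, this]
      ring
    set S := ∑ l ∈ Finset.range (2 * T t), M.relCost i (X.par hM hstep k ω) (X.trans (k + l) ω)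
    set V := M.val (X.θ k ω) (M.relCost i (X.par hM hstep k ω)) (2 * T t) (X.s (N₀ + k) ω)
    have hJ : |M.J i (X.θ k ω) - M.J i (X.θ t ω)| ≤ KJ * (D * (2 * (τ * b))) := by
      rw [abs_sub_comm]
      exact ((hKJ i _ (X.θ_mem hM hstep t ω).1 _ (X.θ_mem hM hstep k ω).1).1).trans
        (mul_le_mul_of_nonneg_left (hdrift ω t (by omega) le_rfl) hKJ0)
    rw [hsum]
    have e1 : 1 / (2 * τ) * S + M.J i (X.θ k ω) - M.J i (X.θ t ω) - 1 / (2 * τ) * N ω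
        = 1 / (2 * τ) * (1 * (S - V) - N ω) + 1 / (2 * τ) * V
          + (M.J i (X.θ k ω) - M.J i (X.θ t ω)) := by ring
    rw [e1]
    refine (abs_add_three _ _ _).trans ?_
    rw [abs_mul, abs_mul, abs_of_pos (show 0 < 1 / (2 * τ) by positivity)]
    push_cast at hNe
    have h1 : 1 / (2 * τ) * |1 * (S - V) - N ω| ≤ L * (D * 2) * Q * R := by
      calc _ ≤ 1 / (2 * τ) * (2 * τ * (1 * (L * (D * (2 * (τ * b))) * Q))) :=
            mul_le_mul_of_nonneg_left hNe (by positivity)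
        _ = L * (D * 2) * Q * (τ * b) := by field_simp
        _ ≤ _ := mul_le_mul_of_nonneg_left hR1 (by positivity)
    have h2 : 1 / (2 * τ) * |V| ≤ Q * R := by
      calc _ ≤ 1 / (2 * τ) * Q := mul_le_mul_of_nonneg_left hval (by positivity)
        _ ≤ 1 / τ * Q := by gcongr; linarith
        _ ≤ R * Q := mul_le_mul_of_nonneg_right hR2 hQ0
        _ = _ := mul_comm _ _
    have h3 : |M.J i (X.θ k ω) - M.J i (X.θ t ω)| ≤ KJ * (D * 2) * R := by
      calc _ ≤ KJ * (D * 2) * (τ * b) := hJ.trans_eq (by ring)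
        _ ≤ _ := mul_le_mul_of_nonneg_left hR1 (by positivity)
    have h4 : 0 ≤ 2 * Q * R := by positivity
    linarith

end SCAOPORun

/-! ### Decomposition of the new gradient estimate -/

namespace CMDP

variable {nθ ns na m : ℕ} {M : CMDP nθ ns na m}

/-- The score along `v`, as a function of (state, action, next state). -/
noncomputable def scoreFn (M : CMDP nθ ns na m) (v : RVec nθ) (θ : RVec nθ)
    (z : M.S × M.A × M.S) : ℝ := inner ℝ (M.score θ (z.1, z.2.1)) v

lemma ProblemAssumptions.measurable_scoreFn (hM : M.ProblemAssumptions) (v : RVec nθ) :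
    Measurable (Function.uncurry fun (θ : M.Θ) (z : M.S × M.A × M.S) => M.scoreFn v θ z) := by
  have h := (hM.measurable_inner_score v).comp
    (show Measurable fun q : M.Θ × M.S × M.A × M.S => (q.1, (q.2.1, q.2.2.1)) by fun_prop)
  simpa only [Function.comp_def, Function.uncurry_def, scoreFn] using h

/-- Expected totals of the score vanish. -/
lemma val_scoreFn {B : ℝ} (hB : ∀ θ ∈ M.dom, ∀ x, ‖M.score θ x‖ ≤ B) {θ : RVec nθ}
    (hθ : θ ∈ M.dom) (v : RVec nθ) (j : ℕ) (s : M.S) : M.val θ (M.scoreFn v θ) j s = 0 := by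
  induction j generalizing s with
  | zero => rfl
  | succ j ih =>
    simp only [val, ih, add_zero]
    exact (expNext_of_stateAction (h := fun x => inner ℝ (M.score θ x) v)
      (measurable_inner_score hθ v) (abs_inner_score_le hB hθ v) s).trans
      (integral_inner_score hB hθ v s)

/-- The recursive cost estimates change slowly over a window of times. -/
lemma abs_Jhat_sub_le {T : ℕ → ℕ} {N₀ : ℕ} {α : ℕ → ℝ} (hα : ∀ t, 0 < α t) (hanti : Antitone α)
    {i : Fin (m + 1)} {B C : ℝ} (hB : ∀ x, |M.cost' i x| ≤ B) (hB0 : 0 ≤ B)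
    {J₀ : Fin (m + 1) → ℝ} {x : ℕ → M.S × M.A} (hC : ∀ t, |M.Jhat T N₀ α x J₀ i t| ≤ C)
    {u t : ℕ} (hut : u ≤ t) :
    |M.Jhat T N₀ α x J₀ i t - M.Jhat T N₀ α x J₀ i u| ≤ (t - u : ℕ) * α u * (B + C) := by
  induction t, hut using Nat.le_induction with
  | base => simp
  | succ t ht ih =>
    have h1 : M.Jhat T N₀ α x J₀ i (t + 1) - M.Jhat T N₀ α x J₀ i t
        = α (t + 1) * (M.Jtilde T N₀ x i (t + 1) - M.Jhat T N₀ α x J₀ i t) := by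
      rw [Jhat]; ring
    have h2 : |M.Jhat T N₀ α x J₀ i (t + 1) - M.Jhat T N₀ α x J₀ i t| ≤ α u * (B + C) := by
      rw [h1, abs_mul, abs_of_pos (hα _)]
      refine mul_le_mul (hanti (by omega)) ?_ (abs_nonneg _) (hα _).le
      exact (abs_sub _ _).trans (add_le_add (abs_Jtilde_le hB hB0 x _) (hC t))
    have h3 := abs_sub_le (M.Jhat T N₀ α x J₀ i (t + 1)) (M.Jhat T N₀ α x J₀ i t)
      (M.Jhat T N₀ α x J₀ i u)
    rw [Nat.succ_sub ht]
    push_cast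
    linarith

end CMDP

namespace SCAOPORun

variable {nθ ns na m : ℕ} {M : CMDP nθ ns na m} {α β : ℕ → ℝ} {T : ℕ → ℕ} {N₀ : ℕ}
  {ς J₀ : Fin (m + 1) → ℝ} {g₀ : Fin (m + 1) → RVec nθ}
  {Ω : Type*} [mΩ : MeasurableSpace Ω] {μ : Measure Ω} {𝓕 : Filtration ℕ mΩ}
  (X : SCAOPORun M α β T N₀ ς J₀ g₀ μ 𝓕) (hM : M.ProblemAssumptions) (hstep : StepSizes α β)

/-- The new gradient estimate of a run. -/
noncomputable def gtilde (i : Fin (m + 1)) (t : ℕ) (ω : Ω) : RVec nθ :=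
  M.gtilde T N₀ α (fun n => (X.s n ω, X.a n ω)) J₀ (fun t' => X.θ t' ω) i t

/-- The exact splitting of the new gradient estimate along `v`. With the parameter frozen at the
start `k` of the window, its terms are: the replacement of the score of `θ^t`, score times
truncated Q-value, score times the deviation of the later costs from their expected total, and the
score times the error of the cost estimate, where the latter is split into its value `c` before the
window and its change over the window. -/
lemma inner_gtilde_eq {i : Fin (m + 1)} {t : ℕ} (ht : 2 * T t ≤ t + 1) (v : RVec nθ) (c : ℝ)
    (ω : Ω) : inner ℝ (X.gtilde i t ω) v
      = 1 / (T t : ℝ) * ∑ l ∈ Finset.range (T t),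
          M.Qhat T N₀ α (fun n => (X.s n ω, X.a n ω)) J₀ i t l *
            (M.scoreFn v (X.θ t ω) (X.trans (t + 1 - 2 * T t + l) ω)
              - M.scoreFn v (X.θ (t + 1 - 2 * T t) ω) (X.trans (t + 1 - 2 * T t + l) ω))
        + 1 / (T t : ℝ) * ∑ l ∈ Finset.range (T t),
          M.scoreFn v (X.θ (t + 1 - 2 * T t) ω) (X.trans (t + 1 - 2 * T t + l) ω)
            * M.qFn i (X.θ (t + 1 - 2 * T t) ω) (T t - 1) (X.trans (t + 1 - 2 * T t + l) ω)
        + 1 / (T t : ℝ) * ∑ l ∈ Finset.range (T t),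
          M.scoreFn v (X.θ (t + 1 - 2 * T t) ω) (X.trans (t + 1 - 2 * T t + l) ω)
            * (∑ l' ∈ Finset.range (T t - 1), M.relCost i (X.θ (t + 1 - 2 * T t) ω)
                (X.trans (t + 1 - 2 * T t + l + 1 + l') ω)
              - M.val (X.θ (t + 1 - 2 * T t) ω) (M.relCost i (X.θ (t + 1 - 2 * T t) ω)) (T t - 1)
                (X.s (N₀ + (t + 1 - 2 * T t + l + 1)) ω))
        + (M.J i (X.θ (t + 1 - 2 * T t) ω) - c) * ∑ l ∈ Finset.range (T t),
          M.scoreFn v (X.θ (t + 1 - 2 * T t) ω) (X.trans (t + 1 - 2 * T t + l) ω)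
        + (c - X.Jhat i t ω) * ∑ l ∈ Finset.range (T t),
          M.scoreFn v (X.θ (t + 1 - 2 * T t) ω) (X.trans (t + 1 - 2 * T t + l) ω) := by
  have hTn := X.one_le_T t
  have hT0 : (0 : ℝ) < T t := by exact_mod_cast hTn
  set k := t + 1 - 2 * T t with hk
  have h1 : inner ℝ (X.gtilde i t ω) v = 1 / (T t : ℝ) * ∑ l ∈ Finset.range (T t),
      M.Qhat T N₀ α (fun n => (X.s n ω, X.a n ω)) J₀ i t l *
        M.scoreFn v (X.θ t ω) (X.trans (k + l) ω) := by
    simp only [gtilde, CMDP.gtilde]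
    rw [real_inner_smul_left, sum_inner]
    congr 1
    refine Finset.sum_congr rfl fun l _ => ?_
    rw [real_inner_smul_left, X.stored_eq ht]
    rfl
  have hQ : ∀ l, M.Qhat T N₀ α (fun n => (X.s n ω, X.a n ω)) J₀ i t l
      = M.relCost i (X.θ k ω) (X.trans (k + l) ω)
        + ∑ l' ∈ Finset.range (T t - 1), M.relCost i (X.θ k ω) (X.trans (k + l + 1 + l') ω)
        + T t * (M.J i (X.θ k ω) - X.Jhat i t ω) := by
    intro l
    have h2 : ∀ l', M.cost' i (M.stored T N₀ (fun n => (X.s n ω, X.a n ω)) t (l + l'))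
        - M.Jhat T N₀ α (fun n => (X.s n ω, X.a n ω)) J₀ i t
        = M.relCost i (X.θ k ω) (X.trans (k + l + l') ω)
          + (M.J i (X.θ k ω) - X.Jhat i t ω) := by
      intro l'
      rw [X.stored_eq ht, ← hk, ← add_assoc]
      simp only [CMDP.relCost, CMDP.costFn, Jhat]
      ring
    simp only [CMDP.Qhat, h2, Finset.sum_add_distrib, Finset.sum_const, Finset.card_range,
      nsmul_eq_mul]
    congr 1
    rw [show T t = (T t - 1) + 1 by omega, Finset.sum_range_succ', add_comm]
    simp only [Nat.add_sub_cancel, add_zero]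
    congr 1
    exact Finset.sum_congr rfl fun l' _ => by rw [show k + l + (l' + 1) = k + l + 1 + l' by ring]
  have h3 : ∀ l, M.Qhat T N₀ α (fun n => (X.s n ω, X.a n ω)) J₀ i t l *
      M.scoreFn v (X.θ t ω) (X.trans (k + l) ω)
      = M.Qhat T N₀ α (fun n => (X.s n ω, X.a n ω)) J₀ i t l *
          (M.scoreFn v (X.θ t ω) (X.trans (k + l) ω) - M.scoreFn v (X.θ k ω) (X.trans (k + l) ω))
        + M.scoreFn v (X.θ k ω) (X.trans (k + l) ω)
            * M.qFn i (X.θ k ω) (T t - 1) (X.trans (k + l) ω)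
        + M.scoreFn v (X.θ k ω) (X.trans (k + l) ω)
            * (∑ l' ∈ Finset.range (T t - 1),
                M.relCost i (X.θ k ω) (X.trans (k + l + 1 + l') ω)
              - M.val (X.θ k ω) (M.relCost i (X.θ k ω)) (T t - 1) (X.s (N₀ + (k + l + 1)) ω))
        + T t * (M.J i (X.θ k ω) - X.Jhat i t ω) * M.scoreFn v (X.θ k ω) (X.trans (k + l) ω) := by
    intro l
    have h4 : M.qFn i (X.θ k ω) (T t - 1) (X.trans (k + l) ω)
        = M.relCost i (X.θ k ω) (X.trans (k + l) ω)
          + M.val (X.θ k ω) (M.relCost i (X.θ k ω)) (T t - 1) (X.s (N₀ + (k + l + 1)) ω) := rfl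
    rw [h4, mul_sub, hQ l]
    ring
  rw [h1, Finset.sum_congr rfl fun l _ => h3 l]
  simp only [Finset.sum_add_distrib, ← Finset.mul_sum]
  field_simp
  ring

end SCAOPORun

namespace SCAOPORun

variable {nθ ns na m : ℕ} {M : CMDP nθ ns na m} {α β : ℕ → ℝ} {T : ℕ → ℕ} {N₀ : ℕ}
  {ς J₀ : Fin (m + 1) → ℝ} {g₀ : Fin (m + 1) → RVec nθ}
  {Ω : Type*} [mΩ : MeasurableSpace Ω] {μ : Measure Ω} {𝓕 : Filtration ℕ mΩ}
  (X : SCAOPORun M α β T N₀ ς J₀ g₀ μ 𝓕) (hM : M.ProblemAssumptions) (hstep : StepSizes α β)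

include hM hstep

lemma measurable_scoreFn_trans (v : RVec nθ) {k n : ℕ} (hkn : k ≤ n) :
    Measurable[shiftFiltration 𝓕 N₀ (n + 1)] fun ω => M.scoreFn v (X.θ k ω) (X.trans n ω) := by
  have h1 : Measurable[shiftFiltration 𝓕 N₀ (n + 1)] (X.par hM hstep k) :=
    (X.measurable_par hM hstep k).mono ((shiftFiltration 𝓕 N₀).mono (by omega)) le_rfl
  have h2 : Measurable[shiftFiltration 𝓕 N₀ (n + 1)] fun ω => (X.par hM hstep k ω, X.trans n ω) :=
    @Measurable.prodMk _ _ _ _ _ (_) _ _ h1 (X.measurable_trans n)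
  have h3 := (hM.measurable_scoreFn v).comp h2
  simp only [Function.comp_def, Function.uncurry_def] at h3
  exact h3

set_option maxHeartbeats 1000000 in
/-- The new gradient estimate is, along a direction `v`, the current gradient plus a martingale sum
and a small error. -/
lemma exists_gtilde_decomposition [IsProbabilityMeasure μ] {mc ρ : ℝ} (hmc : 0 < mc) (hρ : 0 < ρ)
    (hρ1 : ρ < 1) (hE : ∀ θ ∈ M.Θ, ∃ P, M.ErgodicLaw θ P mc ρ) (i : Fin (m + 1)) {v : RVec nθ}
    (hv : ‖v‖ ≤ 1) :
    ∃ K, 0 ≤ K ∧ ∀ t, 2 * T t ≤ t → ∃ n : Ω → ℝ,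
      IsMartingaleSum μ (shiftFiltration 𝓕 N₀) (t + 1 - 2 * T t) (t + 1) (K * T t) n ∧
      ∀ ω, |inner ℝ (X.gtilde i t ω) v - inner ℝ (∇ (M.J i) (X.θ t ω)) v - n ω|
        ≤ K * windowError α β T ρ t := by
  obtain ⟨B, hB0, hB⟩ := hM.exists_cost'_bound
  obtain ⟨L, hL0, hL⟩ := hM.exists_policyClose
  obtain ⟨D, hD0, hD⟩ := hM.exists_diam
  obtain ⟨KJ, hKJ0, hKJ⟩ := hM.exists_lipschitz_J
  obtain ⟨Bh, hBh0, hBh⟩ := CMDP.exists_abs_Jhat_le (M := M) (T := T) (N₀ := N₀)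
    hstep.α_pos hstep.eventually_α_le_one hB hB0 J₀ i
  obtain ⟨Bs, hBs0, hBs⟩ : ∃ Bs, 0 ≤ Bs ∧ ∀ θ ∈ M.dom, ∀ x, ‖M.score θ x‖ ≤ Bs := by
    obtain ⟨b, hb⟩ := hM.bounded_score
    exact ⟨|b|, abs_nonneg b, fun θ hθ x => (hb θ hθ x).trans (le_abs_self b)⟩
  obtain ⟨Ls, hLs0, hLs⟩ : ∃ Ls, 0 ≤ Ls ∧ ∀ θ ∈ M.Θ, ∀ θ' ∈ M.Θ, ∀ x,
      ‖M.score θ x - M.score θ' x‖ ≤ Ls * ‖θ - θ'‖ := by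
    obtain ⟨b, hb⟩ := hM.lipschitz_score
    exact ⟨|b|, abs_nonneg b, fun θ hθ θ' hθ' x => (hb θ hθ θ' hθ' x).trans
      (mul_le_mul_of_nonneg_right (le_abs_self b) (norm_nonneg _))⟩
  have h1ρ : 0 < 1 - ρ := by linarith
  set Q := (1 + mc / (1 - ρ)) * (2 * B) with hQ
  have hQ0 : 0 ≤ Q := by positivity
  set Ch := Bs * Q with hCh
  have hCh0 : 0 ≤ Ch := by positivity
  set A := B + Bh with hA
  have hA0 : 0 ≤ A := by positivity
  set E := mc / (1 - ρ) with hEdef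
  have hE0 : 0 < E := by positivity
  have hψ : ∀ θ ∈ M.Θ, ∀ z, |M.scoreFn v θ z| ≤ Bs := fun θ hθ z =>
    (CMDP.abs_inner_score_le hBs (M.subset_dom hθ) v _).trans
      (mul_le_of_le_one_right hBs0 hv)
  have hq : ∀ θ ∈ M.Θ, ∀ j z, |M.qFn i θ j z| ≤ Q := fun θ hθ j z => by
    obtain ⟨P, hP⟩ := hE θ hθ
    exact hP.abs_qFn_le (hB i) j z
  have hψq : ∀ θ ∈ M.Θ, ∀ j z, |M.scoreFn v θ z * M.qFn i θ j z| ≤ Ch := fun θ hθ j z => by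
    rw [abs_mul]
    exact mul_le_mul (hψ θ hθ z) (hq θ hθ j z) (abs_nonneg _) hBs0
  refine ⟨A * Ls * (D * 2) + L * (D * 2) * Ch + E * Ch + Ch + KJ * (D * 2)
    + Bs * L * (D * 2) * Q + A * L * (D * 2) * Bs + 2 * A * Bs + 4 * Ch + 2 * A * Bs,
    by positivity, fun t ht => ?_⟩
  obtain ⟨hR1, hR1', hR2, hR3, hR4, hR0⟩ := windowError_bounds X hstep hρ t
  set R := windowError α β T ρ t
  have hTn := X.one_le_T t
  have hT1 : (1 : ℝ) ≤ T t := by exact_mod_cast hTn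
  have hT0 : (0 : ℝ) < T t := by linarith
  set τ : ℝ := (T t : ℝ) with hτ
  set b := β (t - 2 * T t) with hb
  set a := α (t - 2 * T t) with ha
  have hb0 : 0 ≤ b := (hstep.β_pos _).le
  have ha0 : 0 ≤ a := (hstep.α_pos _).le
  set k := t + 1 - 2 * T t with hk
  set δ := D * (2 * (τ * b)) with hδ
  have hδ0 : 0 ≤ δ := by positivity
  have hdrift : ∀ ω, ∀ n, k ≤ n → n ≤ t → ‖X.θ n ω - X.θ k ω‖ ≤ δ := by
    intro ω n hkn hnt
    refine (X.norm_θ_sub_le hM hstep hD (u := t - 2 * T t) (by omega) hkn ω).trans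
      (mul_le_mul_of_nonneg_left ?_ hD0)
    rw [← mul_assoc]
    refine mul_le_mul_of_nonneg_right ?_ hb0
    have h1 : n - k ≤ 2 * T t := by omega
    have h2 : ((n - k : ℕ) : ℝ) ≤ ((2 * T t : ℕ) : ℝ) := by exact_mod_cast h1
    simpa [hτ] using h2
  have hLδ : ∀ ω, ∀ n, k ≤ n → n ≤ t → L * ‖X.θ n ω - X.θ k ω‖ ≤ L * δ :=
    fun ω n h1 h2 => mul_le_mul_of_nonneg_left (hdrift ω n h1 h2) hL0
  have hmem : ∀ n ω, X.θ n ω ∈ M.Θ := fun n ω => (X.θ_mem hM hstep n ω).1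
  have hval0 : ∀ θ ∈ M.Θ, ∀ j s, M.val θ (M.scoreFn v θ) j s = 0 := fun θ hθ j s =>
    CMDP.val_scoreFn hBs (M.subset_dom hθ) v j s
  have hF := hM.measurable_scoreFn v
  have hFq : Measurable (Function.uncurry fun (θ : M.Θ) (z : M.S × M.A × M.S) =>
      M.scoreFn v θ z * M.qFn i θ (T t - 1) z) := hF.mul (hM.measurable_qFn i (T t - 1))
  -- the sum of score times truncated Q-value; the expected total of `j` terms is at most `j * Ch`
  obtain ⟨N2, hN2, hN2e⟩ := X.exists_isMartingaleSum_sub_val hM hstep (k := k) (n₀ := k)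
    (H := T t) (lo := k) (hi := t + 1) le_rfl le_rfl (by omega)
    (F := fun θ z => M.scoreFn v θ z * M.qFn i θ (T t - 1) z)
    hFq (C := τ * Ch)
    (fun θ j hj z => by
      have h1 := CMDP.abs_val_le (M := M) (θ := θ) (hψq θ θ.2 (T t - 1)) j z.2.2
      have h2 : (j : ℝ) + 1 ≤ τ := by rw [hτ]; exact_mod_cast hj
      refine (abs_add_le _ _).trans ((add_le_add (hψq θ θ.2 (T t - 1) z) h1).trans ?_)
      nlinarith) (by positivity)
    (G := fun _ => 1) measurable_const (b := 1) zero_le_one (by simp)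
    hL (δ := L * δ) (fun ω l hl => hLδ ω _ (by omega) (by omega))
  -- score times the deviation of the later costs from their expected total
  have hN1 : ∀ l, ∃ N : Ω → ℝ, l < T t →
      IsMartingaleSum μ (shiftFiltration 𝓕 N₀) k (t + 1) (τ * (Bs * (2 * Q))) N ∧ ∀ ω,
        |M.scoreFn v (X.θ k ω) (X.trans (k + l) ω)
            * (∑ l' ∈ Finset.range (T t - 1), M.relCost i (X.θ k ω) (X.trans (k + l + 1 + l') ω)
              - M.val (X.θ k ω) (M.relCost i (X.θ k ω)) (T t - 1) (X.s (N₀ + (k + l + 1)) ω))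
          - N ω| ≤ τ * (Bs * (L * δ * Q)) := by
    intro l
    by_cases hl : l < T t
    · obtain ⟨N, hN, hNe⟩ := X.exists_isMartingaleSum_sub_val hM hstep (k := k) (n₀ := k + l + 1)
        (H := T t - 1) (lo := k) (hi := t + 1) (by omega) (by omega) (by omega)
        (F := fun θ z => M.relCost i θ z) (hM.measurable_relCost i) (C := Q)
        (fun θ j _ z => hq θ θ.2 j z) hQ0
        (G := fun ω => M.scoreFn v (X.θ k ω) (X.trans (k + l) ω))
        (X.measurable_scoreFn_trans hM hstep v (Nat.le_add_right k l))
        (b := Bs) hBs0 (fun ω => hψ _ (hmem k ω) _)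
        hL (δ := L * δ) (fun ω l' hl' => hLδ ω _ (by omega) (by omega))
      have hc : ((T t - 1 : ℕ) : ℝ) ≤ τ := by rw [hτ]; exact_mod_cast Nat.sub_le _ _
      exact ⟨N, fun _ => ⟨hN.mono (mul_le_mul_of_nonneg_right hc (by positivity)), fun ω =>
        (hNe ω).trans (mul_le_mul_of_nonneg_right hc (by positivity))⟩⟩
    · exact ⟨0, fun h => absurd h hl⟩
  choose N1 hN1 using hN1
  -- the score times the error of the cost estimate before the window, where the score has expected
  -- total zero
  obtain ⟨N3, hN3, hN3e⟩ := X.exists_isMartingaleSum_sub_val hM hstep (k := k) (n₀ := k)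
    (H := T t) (lo := k) (hi := t + 1) le_rfl le_rfl (by omega)
    (F := fun θ z => M.scoreFn v θ z) hF (C := Bs)
    (fun θ j _ z => by rw [hval0 θ θ.2, add_zero]; exact hψ θ θ.2 z) hBs0
    (G := fun ω => M.J i (X.θ k ω) - X.Jhat i (t - 2 * T t) ω)
    (((hM.continuous_J i).measurable.comp (X.measurable_par hM hstep k)).sub
      ((X.measurable_Jhat i (t - 2 * T t)).mono ((shiftFiltration 𝓕 N₀).mono (by omega)) le_rfl))
    (b := A) hA0 (fun ω => by
      obtain ⟨P, hP⟩ := hE _ (hmem k ω)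
      exact (abs_sub _ _).trans (add_le_add (hP.abs_J_le (hB i)) (hBh _ _)))
    hL (δ := L * δ) (fun ω l hl => hLδ ω _ (by omega) (by omega))
  refine ⟨fun ω => 1 / τ * N2 ω + 1 / τ * ∑ l ∈ Finset.range (T t), N1 l ω + N3 ω,
    IsMartingaleSum.mono (((hN2.const_mul (1 / τ)).add
      ((IsMartingaleSum.sum (Finset.range (T t)) (c := fun _ => τ * (Bs * (2 * Q)))
        fun l hl => (hN1 l (Finset.mem_range.1 hl)).1).const_mul (1 / τ))).add hN3) ?_, fun ω => ?_⟩
  · rw [abs_of_pos (show 0 < 1 / τ by positivity), Finset.sum_const, Finset.card_range,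
      nsmul_eq_mul, ← hτ]
    have e : 1 / τ * (τ * (1 * (2 * (τ * Ch)))) + 1 / τ * (τ * (τ * (Bs * (2 * Q))))
        + τ * (A * (2 * Bs)) = (4 * Ch + 2 * A * Bs) * τ := by
      rw [hCh]; field_simp; ring
    rw [e]
    refine mul_le_mul_of_nonneg_right ?_ hT0.le
    have : 0 ≤ A * Ls * (D * 2) + L * (D * 2) * Ch + E * Ch + Ch + KJ * (D * 2)
      + Bs * L * (D * 2) * Q + A * L * (D * 2) * Bs + 2 * A * Bs := by positivity
    linarith
  · have hN2e := hN2e ω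
    have hN3e := hN3e ω
    obtain ⟨P, hP⟩ := hE _ (hmem k ω)
    have hsp := X.inner_gtilde_eq (i := i) (t := t) (by omega) v (X.Jhat i (t - 2 * T t) ω) ω
    rw [← hk, ← hτ] at hsp
    set ψ : ℕ → ℝ := fun l => M.scoreFn v (X.θ k ω) (X.trans (k + l) ω) with hψdef
    have hψsum : |∑ l ∈ Finset.range (T t), ψ l| ≤ τ * Bs := by
      refine (Finset.abs_sum_le_sum_abs _ _).trans
        ((Finset.sum_le_sum fun l _ => hψ _ (hmem k ω) _).trans ?_)
      simp [hτ]
    have hQhat : ∀ l, |M.Qhat T N₀ α (fun n => (X.s n ω, X.a n ω)) J₀ i t l| ≤ τ * A := by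
      intro l
      refine (Finset.abs_sum_le_sum_abs _ _).trans ((Finset.sum_le_sum (g := fun _ => A)
        fun l' _ => (abs_sub _ _).trans (add_le_add (hB i _) (hBh _ _))).trans ?_)
      simp [hτ]
    have b1 : |1 / τ * ∑ l ∈ Finset.range (T t),
        M.Qhat T N₀ α (fun n => (X.s n ω, X.a n ω)) J₀ i t l *
          (M.scoreFn v (X.θ t ω) (X.trans (k + l) ω) - M.scoreFn v (X.θ k ω) (X.trans (k + l) ω))|
        ≤ A * Ls * (D * 2) * R := by
      have h : ∀ l ∈ Finset.range (T t), |M.Qhat T N₀ α (fun n => (X.s n ω, X.a n ω)) J₀ i t l *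
          (M.scoreFn v (X.θ t ω) (X.trans (k + l) ω) - M.scoreFn v (X.θ k ω) (X.trans (k + l) ω))|
          ≤ τ * A * (Ls * δ) := by
        intro l _
        rw [abs_mul]
        refine mul_le_mul (hQhat l) ?_ (abs_nonneg _) (by positivity)
        simp only [CMDP.scoreFn]
        rw [← inner_sub_left]
        refine (abs_real_inner_le_norm _ _).trans ((mul_le_of_le_one_right (norm_nonneg _) hv).trans
          ((hLs _ (hmem t ω) _ (hmem k ω) _).trans (mul_le_mul_of_nonneg_left ?_ hLs0)))
        exact hdrift ω t (by omega) le_rfl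
      rw [abs_mul, abs_of_pos (show 0 < 1 / τ by positivity)]
      calc _ ≤ 1 / τ * (τ * (τ * A * (Ls * δ))) := by
            refine mul_le_mul_of_nonneg_left ((Finset.abs_sum_le_sum_abs _ _).trans
              ((Finset.sum_le_sum h).trans_eq ?_)) (by positivity)
            simp [hτ]
        _ = A * Ls * (D * 2) * (τ ^ 2 * b) := by rw [hδ]; field_simp
        _ ≤ _ := mul_le_mul_of_nonneg_left hR1 (by positivity)
    set S2 := ∑ l ∈ Finset.range (T t), ψ l * M.qFn i (X.θ k ω) (T t - 1) (X.trans (k + l) ω)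
      with hS2
    set h2 : M.S × M.A × M.S → ℝ := fun z =>
      M.scoreFn v (X.θ k ω) z * M.qFn i (X.θ k ω) (T t - 1) z with hh2
    have b2 : |1 / τ * (S2 - M.val (X.θ k ω) h2 (T t) (X.s (N₀ + k) ω) - N2 ω)|
        ≤ L * (D * 2) * Ch * R := by
      have hN2e' : |S2 - M.val (X.θ k ω) h2 (T t) (X.s (N₀ + k) ω) - N2 ω|
          ≤ τ * (1 * (L * δ * (τ * Ch))) := by
        have := hN2e
        rw [one_mul (_ - _)] at this
        exact this
      rw [abs_mul, abs_of_pos (show 0 < 1 / τ by positivity)]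
      calc _ ≤ 1 / τ * (τ * (1 * (L * δ * (τ * Ch)))) :=
            mul_le_mul_of_nonneg_left hN2e' (by positivity)
        _ = L * (D * 2) * Ch * (τ ^ 2 * b) := by rw [hδ]; field_simp
        _ ≤ _ := mul_le_mul_of_nonneg_left hR1 (by positivity)
    set I2 := ∫ s, M.expNext (X.θ k ω) h2 s ∂P with hI2
    have hh2m : Measurable h2 := hFq.of_uncurry_left (x := X.par hM hstep k ω)
    have b3 : |1 / τ * (M.val (X.θ k ω) h2 (T t) (X.s (N₀ + k) ω) - τ * I2)| ≤ E * Ch * R := by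
      rw [abs_mul, abs_of_pos (show 0 < 1 / τ by positivity)]
      calc _ ≤ 1 / τ * (E * Ch) := mul_le_mul_of_nonneg_left
            (hP.abs_val_sub_le hh2m (hψq _ (hmem k ω) _) _ _) (by positivity)
        _ = E * Ch * (1 / τ) := mul_comm _ _
        _ ≤ _ := mul_le_mul_of_nonneg_left hR3 (by positivity)
    have b4 : |I2 - inner ℝ (∇ (M.J i) (X.θ k ω)) v| ≤ Ch * R := by
      obtain ⟨_, hBd⟩ := hM.deriv_J
      rw [abs_sub_comm]
      refine (hP.abs_inner_gradient_sub_le (M.subset_dom (hmem k ω)) (hBd i _ (hmem k ω)).1 (hB i)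
        hBs v (T t - 1)).trans ?_
      rw [← hEdef, ← hQ]
      calc _ ≤ Bs * 1 * Q * ρ ^ (T t - 1) := by gcongr
        _ = Ch * ρ ^ (T t - 1) := by rw [hCh]; ring
        _ ≤ _ := mul_le_mul_of_nonneg_left hR4 hCh0
    have b5 : |inner ℝ (∇ (M.J i) (X.θ k ω)) v - inner ℝ (∇ (M.J i) (X.θ t ω)) v|
        ≤ KJ * (D * 2) * R := by
      rw [abs_sub_comm, ← inner_sub_left]
      calc _ ≤ ‖∇ (M.J i) (X.θ t ω) - ∇ (M.J i) (X.θ k ω)‖ :=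
            (abs_real_inner_le_norm _ _).trans (mul_le_of_le_one_right (norm_nonneg _) hv)
        _ ≤ KJ * δ := ((hKJ i _ (hmem t ω) _ (hmem k ω)).2).trans
            (mul_le_mul_of_nonneg_left (hdrift ω t (by omega) le_rfl) hKJ0)
        _ = KJ * (D * 2) * (τ * b) := by rw [hδ]; ring
        _ ≤ _ := mul_le_mul_of_nonneg_left hR1' (by positivity)
    set S3 := ∑ l ∈ Finset.range (T t), ψ l
      * (∑ l' ∈ Finset.range (T t - 1), M.relCost i (X.θ k ω) (X.trans (k + l + 1 + l') ω)
        - M.val (X.θ k ω) (M.relCost i (X.θ k ω)) (T t - 1) (X.s (N₀ + (k + l + 1)) ω)) with hS3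
    have b6 : |1 / τ * (S3 - ∑ l ∈ Finset.range (T t), N1 l ω)| ≤ Bs * L * (D * 2) * Q * R := by
      rw [abs_mul, abs_of_pos (show 0 < 1 / τ by positivity), hS3, ← Finset.sum_sub_distrib]
      calc _ ≤ 1 / τ * (τ * (τ * (Bs * (L * δ * Q)))) := by
            refine mul_le_mul_of_nonneg_left ((Finset.abs_sum_le_sum_abs _ _).trans
              ((Finset.sum_le_sum fun l hl =>
                (hN1 l (Finset.mem_range.1 hl)).2 ω).trans_eq ?_)) (by positivity)
            simp [hτ]
        _ = Bs * L * (D * 2) * Q * (τ ^ 2 * b) := by rw [hδ]; field_simp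
        _ ≤ _ := mul_le_mul_of_nonneg_left hR1 (by positivity)
    set c := X.Jhat i (t - 2 * T t) ω with hc
    have b7 : |(M.J i (X.θ k ω) - c) * ∑ l ∈ Finset.range (T t), ψ l - N3 ω|
        ≤ A * L * (D * 2) * Bs * R := by
      have hN3e' : |(M.J i (X.θ k ω) - c) * ∑ l ∈ Finset.range (T t), ψ l - N3 ω|
          ≤ τ * (A * (L * δ * Bs)) := by
        have h := hN3e
        have hz : M.val (X.θ k ω) (fun z => M.scoreFn v (X.par hM hstep k ω) z) (T t)
          (X.s (N₀ + k) ω) = 0 := hval0 _ (hmem k ω) _ _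
        rw [hz, sub_zero] at h
        exact h
      calc _ ≤ τ * (A * (L * δ * Bs)) := hN3e'
        _ = A * L * (D * 2) * Bs * (τ ^ 2 * b) := by rw [hδ]; ring
        _ ≤ _ := mul_le_mul_of_nonneg_left hR1 (by positivity)
    have b8 : |(c - X.Jhat i t ω) * ∑ l ∈ Finset.range (T t), ψ l| ≤ 2 * A * Bs * R := by
      rw [abs_mul, abs_sub_comm]
      have h1 := CMDP.abs_Jhat_sub_le hstep.α_pos hstep.α_anti (hB i) hB0
        (hBh (fun n => (X.s n ω, X.a n ω))) (Nat.sub_le t (2 * T t))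
      rw [show t - (t - 2 * T t) = 2 * T t by omega] at h1
      push_cast at h1
      calc _ ≤ 2 * τ * a * A * (τ * Bs) := mul_le_mul h1 hψsum (abs_nonneg _) (by positivity)
        _ = 2 * A * Bs * (τ ^ 2 * a) := by ring
        _ ≤ _ := mul_le_mul_of_nonneg_left hR2 (by positivity)
    rw [hsp]
    set S1 := 1 / τ * ∑ l ∈ Finset.range (T t),
        M.Qhat T N₀ α (fun n => (X.s n ω, X.a n ω)) J₀ i t l *
          (M.scoreFn v (X.θ t ω) (X.trans (k + l) ω) - M.scoreFn v (X.θ k ω) (X.trans (k + l) ω))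
    -- from score times truncated Q-value to the current gradient: remove the martingale sum, then
    -- pass to the expected total, the stationary mean `I2` and the gradient at the frozen parameter
    have e1 : S1 + 1 / τ * S2 + 1 / τ * S3 + (M.J i (X.θ k ω) - c) * ∑ l ∈ Finset.range (T t), ψ l
        + (c - X.Jhat i t ω) * ∑ l ∈ Finset.range (T t), ψ l
        - inner ℝ (∇ (M.J i) (X.θ t ω)) v
        - (1 / τ * N2 ω + 1 / τ * ∑ l ∈ Finset.range (T t), N1 l ω + N3 ω)
        = S1 + 1 / τ * (S2 - M.val (X.θ k ω) h2 (T t) (X.s (N₀ + k) ω) - N2 ω)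
          + 1 / τ * (M.val (X.θ k ω) h2 (T t) (X.s (N₀ + k) ω) - τ * I2)
          + (I2 - inner ℝ (∇ (M.J i) (X.θ k ω)) v)
          + (inner ℝ (∇ (M.J i) (X.θ k ω)) v - inner ℝ (∇ (M.J i) (X.θ t ω)) v)
          + 1 / τ * (S3 - ∑ l ∈ Finset.range (T t), N1 l ω)
          + ((M.J i (X.θ k ω) - c) * ∑ l ∈ Finset.range (T t), ψ l - N3 ω)
          + (c - X.Jhat i t ω) * ∑ l ∈ Finset.range (T t), ψ l := by
      have : 1 / τ * (τ * I2) = I2 := by field_simp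
      linear_combination this
    refine (congrArg abs e1).trans_le ?_
    have tri : ∀ x1 x2 x3 x4 x5 x6 x7 x8 : ℝ, |x1 + x2 + x3 + x4 + x5 + x6 + x7 + x8|
        ≤ |x1| + |x2| + |x3| + |x4| + |x5| + |x6| + |x7| + |x8| := fun x1 x2 x3 x4 x5 x6 x7 x8 => by
      refine (abs_add_le _ _).trans (add_le_add_left ?_ _)
      refine (abs_add_le _ _).trans (add_le_add_left ?_ _)
      refine (abs_add_le _ _).trans (add_le_add_left ?_ _)
      refine (abs_add_le _ _).trans (add_le_add_left ?_ _)
      refine (abs_add_le _ _).trans (add_le_add_left ?_ _)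
      exact abs_add_three _ _ _
    refine (tri _ _ _ _ _ _ _ _).trans ?_
    have : 0 ≤ (4 * Ch + 2 * A * Bs) * R := by positivity
    linarith

end SCAOPORun

/-! ### Consistency -/

section Tracking

variable {α β : ℕ → ℝ} (hstep : StepSizes α β) {T : ℕ → ℕ} (hT : Tendsto T atTop atTop)
  (hTlog : (fun t => (T t : ℝ)) =O[atTop] fun t : ℕ => Real.log t)
include hstep hT hTlog

lemma tendsto_windowError {ρ : ℝ} (hρ : 0 < ρ) (hρ1 : ρ < 1) :
    Tendsto (windowError α β T ρ) atTop (𝓝 0) := by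
  obtain ⟨_, -, hα⟩ := exists_le_mul_rpow_neg_half hstep.α_pos hstep.α_anti hstep.α_sq
  obtain ⟨_, -, hβ⟩ := exists_le_mul_rpow_neg_half hstep.β_pos hstep.β_anti hstep.β_sq
  have h := (((tendsto_sq_mul_window hstep.β_pos hβ hTlog).add
    (tendsto_sq_mul_window hstep.α_pos hα hTlog)).add
    (tendsto_one_div_atTop_nhds_zero_nat.comp hT)).add
    ((tendsto_pow_atTop_nhds_zero_of_lt_one hρ.le hρ1).comp
      ((tendsto_sub_atTop_nat 1).comp hT))
  simp only [add_zero] at h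
  exact h

/-- A recursive estimate is consistent when its inputs are the target plus a martingale sum over the
window and an error of the order of `windowError`, and the target moves at the speed of `β`. -/
lemma ae_tendsto_sub_target {Ω : Type*} [mΩ : MeasurableSpace Ω] {μ : Measure Ω}
    [IsProbabilityMeasure μ] {𝓖 : Filtration ℕ mΩ} {ρ K Kg : ℝ} (hρ : 0 < ρ) (hρ1 : ρ < 1)
    (hK : 0 ≤ K) {Y y g : ℕ → Ω → ℝ}
    (hY : ∀ t ω, Y (t + 1) ω = (1 - α (t + 1)) * Y t ω + α (t + 1) * y (t + 1) ω)
    (hdec : ∀ t, 2 * T t ≤ t → ∃ n : Ω → ℝ,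
      IsMartingaleSum μ 𝓖 (t + 1 - 2 * T t) (t + 1) (K * T t) n ∧
      ∀ ω, |y t ω - g t ω - n ω| ≤ K * windowError α β T ρ t)
    (hg : ∀ t ω, |g (t + 1) ω - g t ω| ≤ Kg * β t) :
    ∀ᵐ ω ∂μ, Tendsto (fun t => Y t ω - g t ω) atTop (𝓝 0) := by
  obtain ⟨t₀, ht₀⟩ := eventually_atTop.1 (hstep.eventually_α_le_one.and
    ((eventually_window_le hTlog).and
      (eventually_le_rpow_of_isBigO_log hTlog (r := 1 / 16) (by norm_num) one_pos)))
  have hwin : ∀ u ≥ t₀, 2 * T u ≤ u := fun u hu => by have := (ht₀ u hu).2.1; omega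
  have hTr : ∀ u ≥ t₀, (T u : ℝ) ≤ (u : ℝ) ^ (1 / 16 : ℝ) := fun u hu => by
    simpa using (ht₀ u hu).2.2
  choose! n hn hne using hdec
  obtain ⟨Cw, hCw, hw⟩ := hstep.exists_relaxWeight_le (t₀ := t₀) fun v hv => (ht₀ v hv.le).1
  have hnoise := ae_tendsto_relaxAvg_zero (μ := μ) (𝓖 := 𝓖) (α := α) (t₀ := t₀)
    (fun v hv => ⟨(hstep.α_pos v).le, (ht₀ v hv.le).1⟩) (k := fun u => u + 1 - 2 * T u) (n := n)
    (C := K + 2) (by linarith) hCw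
    (fun u hu => (hn u (hwin u hu.le)).mono
      (mul_le_mul (by linarith) (hTr u hu.le) (by positivity) (by linarith)))
    (fun u hu => by
      have h1 := hwin u hu.le
      rw [Nat.cast_sub (by omega)]
      push_cast
      have h2 := hTr u hu.le
      have h3 : 0 ≤ K * (u : ℝ) ^ (1 / 16 : ℝ) := by positivity
      linarith) hw
  filter_upwards [hnoise] with ω hω
  refine tendsto_sub_target_of_relaxation (α := α) (t₀ := t₀) (Y := fun t => Y t ω)
    (y := fun t => y t ω) (g := fun t => g t ω) (n := fun t => n t ω)
    (b := fun t => K * windowError α β T ρ t)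
    (fun v hv => ⟨hstep.α_pos v, (ht₀ v hv.le).1⟩) hstep.tendsto_sum_α (fun t _ => hY t ω)
    (fun t ht => hne t (hwin t ht.le) ω) ?_ ?_ hstep.α_lim hω
  · simpa using (tendsto_windowError hstep hT hTlog hρ hρ1).const_mul K
  · refine squeeze_zero_norm (fun t => ?_) (by simpa using hstep.ratio.const_mul Kg)
    rw [Real.norm_eq_abs, abs_div, abs_of_pos (hstep.α_pos t), ← mul_div_assoc]
    exact div_le_div_of_nonneg_right (hg t ω) (hstep.α_pos t).le

end Tracking

theorem lemma1 {nθ ns na m : ℕ} (M : CMDP nθ ns na m) (hM : M.ProblemAssumptions)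
    (α β : ℕ → ℝ) (hstep : StepSizes α β)
    (T : ℕ → ℕ) (hT : Tendsto T atTop atTop)
    (hTlog : (fun t => (T t : ℝ)) =O[atTop] fun t : ℕ => Real.log t)
    (N₀ : ℕ) (ς : Fin (m + 1) → ℝ) (hς : ∀ i, 0 < ς i)
    (J₀ : Fin (m + 1) → ℝ) (g₀ : Fin (m + 1) → RVec nθ)
    {Ω : Type*} [mΩ : MeasurableSpace Ω] (μ : Measure Ω) [IsProbabilityMeasure μ]
    (𝓕 : Filtration ℕ mΩ) (X : SCAOPORun M α β T N₀ ς J₀ g₀ μ 𝓕) :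
    ∀ᵐ ω ∂μ, ∀ i : Fin (m + 1),
      Tendsto (fun t => |X.Jhat i t ω - M.J i (X.θ t ω)|) atTop (𝓝 0) ∧
      Tendsto (fun t => ‖X.ghat i t ω - ∇ (M.J i) (X.θ t ω)‖) atTop (𝓝 0) := by
  obtain ⟨mc, ρ, hmc, hρ, hρ1, hE⟩ := hM.exists_ergodicLaw
  obtain ⟨D, hD0, hD⟩ := hM.exists_diam
  obtain ⟨KJ, hKJ0, hKJ⟩ := hM.exists_lipschitz_J
  have hmem : ∀ t ω, X.θ t ω ∈ M.Θ := fun t ω => (X.θ_mem hM hstep t ω).1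
  have hmove : ∀ t ω, KJ * ‖X.θ (t + 1) ω - X.θ t ω‖ ≤ KJ * D * β t := fun t ω => by
    have := X.norm_θ_sub_le hM hstep hD (le_refl t) (Nat.le_succ t) ω
    rw [mul_assoc]
    exact mul_le_mul_of_nonneg_left (by simpa using this) hKJ0
  rw [ae_all_iff]
  intro i
  have hJ : ∀ᵐ ω ∂μ, Tendsto (fun t => X.Jhat i t ω - M.J i (X.θ t ω)) atTop (𝓝 0) := by
    obtain ⟨K, hK, hdec⟩ := X.exists_Jtilde_decomposition hM hstep hmc hρ hρ1 hE i
    exact ae_tendsto_sub_target hstep hT hTlog hρ hρ1 hK (Y := X.Jhat i)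
      (y := fun t ω => M.Jtilde T N₀ (fun n => (X.s n ω, X.a n ω)) i t)
      (g := fun t ω => M.J i (X.θ t ω)) (fun t ω => rfl) hdec
      fun t ω => ((hKJ i _ (hmem (t + 1) ω) _ (hmem t ω)).1).trans (hmove t ω)
  have hg : ∀ j : Fin nθ, ∀ᵐ ω ∂μ,
      Tendsto (fun t => (X.ghat i t ω - ∇ (M.J i) (X.θ t ω)) j) atTop (𝓝 0) := by
    intro j
    set v : RVec nθ := EuclideanSpace.single j 1 with hv
    have hv1 : ‖v‖ ≤ 1 := by simp [hv]
    have hcoord : ∀ w : RVec nθ, inner ℝ w v = w j := fun w => by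
      simp [hv, EuclideanSpace.inner_single_right]
    obtain ⟨K, hK, hdec⟩ := X.exists_gtilde_decomposition hM hstep hmc hρ hρ1 hE i hv1
    have := ae_tendsto_sub_target hstep hT hTlog hρ hρ1 hK
      (Y := fun t ω => inner ℝ (X.ghat i t ω) v)
      (y := fun t ω => inner ℝ (X.gtilde i t ω) v)
      (g := fun t ω => inner ℝ (∇ (M.J i) (X.θ t ω)) v) (Kg := KJ * D) (fun t ω => ?_) hdec
      fun t ω => ?_
    · filter_upwards [this] with ω hω
      simpa only [hcoord, PiLp.sub_apply] using hω
    · rw [← real_inner_smul_left, ← real_inner_smul_left, ← inner_add_left]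
      rfl
    · rw [← inner_sub_left]
      exact (abs_real_inner_le_norm _ _).trans ((mul_le_of_le_one_right (norm_nonneg _) hv1).trans
        (((hKJ i _ (hmem (t + 1) ω) _ (hmem t ω)).2).trans (hmove t ω)))
  filter_upwards [hJ, ae_all_iff.2 hg] with ω hJω hgω
  refine ⟨by simpa using hJω.abs, ?_⟩
  simp only [EuclideanSpace.norm_eq, Real.norm_eq_abs, sq_abs]
  have h := (tendsto_finsetSum Finset.univ fun j _ => (hgω j).pow 2).sqrt
  simpa using h
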